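/- Consider the equations $$u_t=u_{xx}+k(x)u^2(1-u),\qquad x\in I, \tag{1}$$ where $I\subseteq\mathbb R$ is a nonempty open interval and $k:I\to\mathbb R$ is smooth with $k(x)\neq0$ for all $x\in I$. Let $Q=\tau\partial_t+\xi\partial_x+\eta\partial_u$ have smooth real coefficients depending on $(t,x,u)$ in a box $T\times I\times U$, with $T,U$ nonempty open intervals. $Q$ with $(\tau,\xi)\ne(0,0)$ is a nonclassical symmetry of the equation $L=0$, $L=u_t-u_{xx}-k(x)u^2(1-u)$, if its second prolongation satisfies $Q_{(2)}L=0$ at every point of the second-order jet space over $T\times I\times U$ where $L=0$ and where $Q[u]:=\eta-\tau u_t-\xi u_x$ and its total derivatives $D_tQ[u]$, $D_xQ[u]$ vanish; it is a Lie symmetry if $Q_{(2)}L=0$ wherever $L=0$. Two operators are called equivalent if they differ by a nowhere vanishing functional multiplier. The equivalence group consists of the transformations $\tilde t=\varepsilon_1^2t+\varepsilon_2$, $\tilde x=\varepsilon_1x+\varepsilon_3$, $\tilde u=u$, $\tilde k=\varepsilon_1^{-2}k$ with real constants $\varepsilon_i$, $\varepsilon_1\neq0$; it acts on operators by push-forward.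 Theorem. The operator $Q=\partial_t+\xi(t,x,u)\partial_x+\eta(t,x,u)\partial_u$ is a nonclassical symmetry of (1) that is not equivalent to a Lie symmetry of (1) if and only if some transformation of the equivalence group maps the pair $(k,Q)$, where $Q$ is taken up to a nowhere vanishing functional multiplier, to one of the following pairs (restricted to the image of the box): 1. $k=c\tan^2x$, $Q=\partial_t-\cot x\,\partial_x$, with $c\ne0$; 2. $k=c\tanh^2x$, $Q=\partial_t-\coth x\,\partial_x$, with $c\ne0$; 3. $k=c\coth^2x$, $Q=\partial_t-\tanh x\,\partial_x$, with $c\ne0$; 4. $k=cx^2$, $Q=\partial_t-\frac1x\,\partial_x$, with $c\ne0$; 5. $k=\frac{c^2}2$, $Q=\partial_t\pm\frac c2(3u-1)\partial_x-\frac{3c^2}4u^2(u-1)\partial_u$ (either sign), with $c>0$; 6. $k=2x^{-2}$, $Q=\partial_t+\frac3x(u-1)\partial_x-\frac3{x^2}u(u-1)^2\partial_u$. -/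

import Mathlib

open scoped ContDiff

noncomputable section

namespace Huxley

/-- Functions of `(t, x, u)`, written in curried form. -/
abbrev Fun3 : Type := ℝ → ℝ → ℝ → ℝ

/-- Partial derivative in `t`. -/
def pdt (F : Fun3) : Fun3 := fun t x u => deriv (fun s => F s x u) t

/-- Partial derivative in `x`. -/
def pdx (F : Fun3) : Fun3 := fun t x u => deriv (fun s => F t s u) x

/-- Partial derivative in `u`. -/
def pdu (F : Fun3) : Fun3 := fun t x u => deriv (fun s => F t x s) u

/-- A first-order differential operator (vector field) `Q = τ ∂_t + ξ ∂_x + η ∂_u`. -/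
structure Operator where
  τ : Fun3
  ξ : Fun3
  η : Fun3

/-- The operator `∂_t + ξ ∂_x + η ∂_u`. -/
def Operator.unitTime (ξ η : Fun3) : Operator where
  τ := fun _ _ _ => 1
  ξ := ξ
  η := η

/-- A point of the second-order jet space over `(t, x)` with one dependent variable `u`. -/
structure Jet where
  t : ℝ
  x : ℝ
  u : ℝ
  ut : ℝ
  ux : ℝ
  utt : ℝ
  utx : ℝ
  uxx : ℝ

/-- Value of a function of `(t, x, u)` at a jet. -/
def ev (F : Fun3) (j : Jet) : ℝ := F j.t j.x j.u

/-- Total derivative `D_t F` of a function of `(t, x, u)`. -/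
def Dt (F : Fun3) (j : Jet) : ℝ := ev (pdt F) j + ev (pdu F) j * j.ut

/-- Total derivative `D_x F` of a function of `(t, x, u)`. -/
def Dx (F : Fun3) (j : Jet) : ℝ := ev (pdx F) j + ev (pdu F) j * j.ux

/-- Second total derivative `D_t D_t F`. -/
def Dtt (F : Fun3) (j : Jet) : ℝ :=
  ev (pdt (pdt F)) j + 2 * ev (pdt (pdu F)) j * j.ut + ev (pdu (pdu F)) j * j.ut ^ 2
    + ev (pdu F) j * j.utt

/-- Second total derivative `D_t D_x F`. -/
def Dtx (F : Fun3) (j : Jet) : ℝ :=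
  ev (pdt (pdx F)) j + ev (pdx (pdu F)) j * j.ut + ev (pdt (pdu F)) j * j.ux
    + ev (pdu (pdu F)) j * j.ut * j.ux + ev (pdu F) j * j.utx

/-- Second total derivative `D_x D_x F`. -/
def Dxx (F : Fun3) (j : Jet) : ℝ :=
  ev (pdx (pdx F)) j + 2 * ev (pdx (pdu F)) j * j.ux + ev (pdu (pdu F)) j * j.ux ^ 2
    + ev (pdu F) j * j.uxx

namespace Operator

/-- Coefficient `η^t = D_t η - u_t D_t τ - u_x D_t ξ` of `∂_{u_t}` in the prolongation. -/
def ηt (Q : Operator) (j : Jet) : ℝ := Dt Q.η j - j.ut * Dt Q.τ j - j.ux * Dt Q.ξ j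

/-- Coefficient `η^x = D_x η - u_t D_x τ - u_x D_x ξ` of `∂_{u_x}` in the prolongation. -/
def ηx (Q : Operator) (j : Jet) : ℝ := Dx Q.η j - j.ut * Dx Q.τ j - j.ux * Dx Q.ξ j

/-- Coefficient `η^tt = D_t η^t - u_tt D_t τ - u_tx D_t ξ` of `∂_{u_tt}`, expanded. -/
def ηtt (Q : Operator) (j : Jet) : ℝ :=
  Dtt Q.η j - j.ut * Dtt Q.τ j - j.ux * Dtt Q.ξ j
    - 2 * j.utt * Dt Q.τ j - 2 * j.utx * Dt Q.ξ j

/-- Coefficient `η^tx = D_t η^x - u_tx D_t τ - u_xx D_t ξ` of `∂_{u_tx}`, expanded. -/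
def ηtx (Q : Operator) (j : Jet) : ℝ :=
  Dtx Q.η j - j.ut * Dtx Q.τ j - j.ux * Dtx Q.ξ j
    - j.utt * Dx Q.τ j - j.utx * Dx Q.ξ j - j.utx * Dt Q.τ j - j.uxx * Dt Q.ξ j

/-- Coefficient `η^xx = D_x η^x - u_tx D_x τ - u_xx D_x ξ` of `∂_{u_xx}`, expanded. -/
def ηxx (Q : Operator) (j : Jet) : ℝ :=
  Dxx Q.η j - j.ut * Dxx Q.τ j - j.ux * Dxx Q.ξ j
    - 2 * j.utx * Dx Q.τ j - 2 * j.uxx * Dx Q.ξ j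

/-- The second prolongation of `Q` applied to a differential function `L` of order at most two. -/
def prolong (Q : Operator) (L : Jet → ℝ) (j : Jet) : ℝ :=
  ev Q.τ j * deriv (fun s => L { j with t := s }) j.t
    + ev Q.ξ j * deriv (fun s => L { j with x := s }) j.x
    + ev Q.η j * deriv (fun s => L { j with u := s }) j.u
    + Q.ηt j * deriv (fun s => L { j with ut := s }) j.ut
    + Q.ηx j * deriv (fun s => L { j with ux := s }) j.ux
    + Q.ηtt j * deriv (fun s => L { j with utt := s }) j.utt
    + Q.ηtx j * deriv (fun s => L { j with utx := s }) j.utx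
    + Q.ηxx j * deriv (fun s => L { j with uxx := s }) j.uxx

/-- The characteristic `Q[u] = η - τ u_t - ξ u_x`. -/
def char (Q : Operator) (j : Jet) : ℝ := ev Q.η j - ev Q.τ j * j.ut - ev Q.ξ j * j.ux

/-- The total derivative `D_t Q[u]` of the characteristic. -/
def charDt (Q : Operator) (j : Jet) : ℝ :=
  Dt Q.η j - (Dt Q.τ j * j.ut + ev Q.τ j * j.utt) - (Dt Q.ξ j * j.ux + ev Q.ξ j * j.utx)

/-- The total derivative `D_x Q[u]` of the characteristic. -/
def charDx (Q : Operator) (j : Jet) : ℝ :=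
  Dx Q.η j - (Dx Q.τ j * j.ut + ev Q.τ j * j.utx) - (Dx Q.ξ j * j.ux + ev Q.ξ j * j.uxx)

/-- The manifold in the second-order jet space given by the equation `Q[u] = 0` and its
differential consequences. -/
def CharManifold (Q : Operator) : Set Jet :=
  {j | Q.char j = 0 ∧ Q.charDt j = 0 ∧ Q.charDx j = 0}

/-- The coefficients of `Q` are smooth on the box `T × I × U` of the `(t, x, u)`-space. -/
def SmoothOn (Q : Operator) (T I U : Set ℝ) : Prop :=
  ContDiffOn ℝ ∞ (fun p : ℝ × ℝ × ℝ => Q.τ p.1 p.2.1 p.2.2) (T ×ˢ I ×ˢ U) ∧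
  ContDiffOn ℝ ∞ (fun p : ℝ × ℝ × ℝ => Q.ξ p.1 p.2.1 p.2.2) (T ×ˢ I ×ˢ U) ∧
  ContDiffOn ℝ ∞ (fun p : ℝ × ℝ × ℝ => Q.η p.1 p.2.1 p.2.2) (T ×ˢ I ×ˢ U)

end Operator

/-- Jets whose base point `(t, x, u)` lies in `T × I × U` (the derivative coordinates are free). -/
def jetsOver (T I U : Set ℝ) : Set Jet := {j | j.t ∈ T ∧ j.x ∈ I ∧ j.u ∈ U}

/-- `Q` is a nonclassical symmetry (reduction operator) of `L = 0` over `T × I × U`: the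
conditional invariance criterion `Q_(2) L = 0` holds on the intersection of `L = 0` with the
manifold of the invariant surface condition. -/
def IsNonclassicalSymmetry (L : Jet → ℝ) (Q : Operator) (T I U : Set ℝ) : Prop :=
  Q.SmoothOn T I U ∧
  (∀ t ∈ T, ∀ x ∈ I, ∀ u ∈ U, (Q.τ t x u, Q.ξ t x u) ≠ (0, 0)) ∧
  ∀ j ∈ jetsOver T I U, L j = 0 → j ∈ Q.CharManifold → Q.prolong L j = 0

/-- `Q` is a (classical) Lie symmetry operator of `L = 0` over `T × I × U`. -/
def IsLieSymmetry (L : Jet → ℝ) (Q : Operator) (T I U : Set ℝ) : Prop :=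
  Q.SmoothOn T I U ∧ ∀ j ∈ jetsOver T I U, L j = 0 → Q.prolong L j = 0

/-- `Q` is equivalent to a Lie symmetry operator: it differs from one by a nowhere vanishing
functional multiplier. -/
def IsEquivToLie (L : Jet → ℝ) (Q : Operator) (T I U : Set ℝ) : Prop :=
  ∃ R : Operator, IsLieSymmetry L R T I U ∧ ∃ m : Fun3, ∀ t ∈ T, ∀ x ∈ I, ∀ u ∈ U,
    m t x u ≠ 0 ∧ R.τ t x u = m t x u * Q.τ t x u ∧ R.ξ t x u = m t x u * Q.ξ t x u ∧
      R.η t x u = m t x u * Q.η t x u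

/-- The differential function of the equation `u_t = u_xx + k(x) u² (1 - u)`. -/
def huxley (k : ℝ → ℝ) (j : Jet) : ℝ := j.ut - (j.uxx + k j.x * j.u ^ 2 * (1 - j.u))

/-- The equivalence transformation `t̃ = ε₁² t + ε₂`, `x̃ = ε₁ x + ε₃`, `ũ = u`,
`k̃ = ε₁⁻² k` with `ε₁ ≠ 0`. -/
structure EquivTransf where
  ε₁ : ℝ
  ε₂ : ℝ
  ε₃ : ℝ
  ε₁_ne_zero : ε₁ ≠ 0

/-- The transformation `g` maps the equation with coefficient `k`, `x ∈ I`, to the one with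
coefficient `K`, and the operator `Q` on `T × I × U` to the operator `R` up to a nowhere vanishing
functional multiplier (the push-forward of `Q` is `ε₁² τ ∂_t̃ + ε₁ ξ ∂_x̃ + η ∂_ũ`). -/
def EquivTransf.Maps (g : EquivTransf) (T I U : Set ℝ) (k : ℝ → ℝ) (Q : Operator)
    (K : ℝ → ℝ) (R : Operator) : Prop :=
  (∀ x ∈ I, K (g.ε₁ * x + g.ε₃) = (g.ε₁ ^ 2)⁻¹ * k x) ∧
  ∃ m : Fun3, ∀ t ∈ T, ∀ x ∈ I, ∀ u ∈ U, m t x u ≠ 0 ∧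
    R.τ (g.ε₁ ^ 2 * t + g.ε₂) (g.ε₁ * x + g.ε₃) u = m t x u * (g.ε₁ ^ 2 * Q.τ t x u) ∧
    R.ξ (g.ε₁ ^ 2 * t + g.ε₂) (g.ε₁ * x + g.ε₃) u = m t x u * (g.ε₁ * Q.ξ t x u) ∧
    R.η (g.ε₁ ^ 2 * t + g.ε₂) (g.ε₁ * x + g.ε₃) u = m t x u * Q.η t x u

/-- The six canonical pairs of a coefficient `k` and an operator `Q`. -/
inductive CanonicalPair : (ℝ → ℝ) → Operator → Prop
  | tan (c : ℝ) (hc : c ≠ 0) : CanonicalPair (fun x => c * Real.tan x ^ 2)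
      (.unitTime (fun _ x _ => -Real.cot x) (fun _ _ _ => 0))
  | tanh (c : ℝ) (hc : c ≠ 0) : CanonicalPair (fun x => c * Real.tanh x ^ 2)
      (.unitTime (fun _ x _ => -(Real.cosh x / Real.sinh x)) (fun _ _ _ => 0))
  | coth (c : ℝ) (hc : c ≠ 0) : CanonicalPair (fun x => c * (Real.cosh x / Real.sinh x) ^ 2)
      (.unitTime (fun _ x _ => -Real.tanh x) (fun _ _ _ => 0))
  | square (c : ℝ) (hc : c ≠ 0) : CanonicalPair (fun x => c * x ^ 2)
      (.unitTime (fun _ x _ => -(1 / x)) (fun _ _ _ => 0))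
  | const_pos (c : ℝ) (hc : 0 < c) : CanonicalPair (fun _ => c ^ 2 / 2)
      (.unitTime (fun _ _ u => c / 2 * (3 * u - 1))
        (fun _ _ u => -(3 * c ^ 2 / 4) * u ^ 2 * (u - 1)))
  | const_neg (c : ℝ) (hc : 0 < c) : CanonicalPair (fun _ => c ^ 2 / 2)
      (.unitTime (fun _ _ u => -(c / 2 * (3 * u - 1)))
        (fun _ _ u => -(3 * c ^ 2 / 4) * u ^ 2 * (u - 1)))
  | invSquare : CanonicalPair (fun x => 2 / x ^ 2)
      (.unitTime (fun _ x u => 3 / x * (u - 1)) (fun _ x u => -(3 / x ^ 2) * u * (u - 1) ^ 2))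

end Huxley

end

namespace Huxley

/-! On the manifold where `L = 0` and `Q[u] = 0`, the operator with `τ = 1` allows `u_t` and `u_xx`
to be eliminated, and the prolongation becomes a cubic polynomial in the free coordinate `u_x`. Its
four coefficients are the determining equations (`isNonclassicalSymmetry_unitTime_iff`). The first
two give `ξ = a u + b` and make `η` a cubic in `u` with leading coefficients built from `a` and `b`.
The third, split in powers of `u`, yields `a (a² - 9k/2) = 0`. As `k` has no zeros, one of the two
factors vanishes on the whole box (`quasilinear_dichotomy`).

If `a = 0`, the last equation forces `η = 0` and `2 k b_x + b k' = 0`, hence `b = φ(t) h(x)` with `h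
= |k|^(-1/2)`, while `b_t = b_xx - 2 b b_x`. Either `φ = 0` or `h` is affine, and a multiple of `Q`
is then a Lie symmetry, or `φ` is constant and `b = β(x)` solves a Riccati equation `β' = β² + C`
with `kβ²` constant (`semilinear_classification`). The nonconstant nowhere vanishing solutions,
sorted by the sign of `C`, are the first four pairs (`canonical_of_riccati`).

If `a² = 9k/2`, nothing depends on `t`. With `a = 3m` the functions `b`, `c`, `d` are expressed
through `m`, and two ordinary differential equations for `m` remain. In scale-invariant variables `W
= m'/m²`, `s`, `r`, one of them is a polynomial flow and the other a surface that contains the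
trajectory. Differentiating the surface along the flow six times gives polynomials whose ideal
contains `W (W + 1)³` (`mul_add_one_pow_three_eq_zero`), so `m` is constant or `m' = -m²`
(`quasilinear_system`). These are the last two families.

Conversely the determining equations are verified directly. Inequivalence to Lie symmetries holds
because a Lie symmetry has `τ = τ(t)`, `ξ_u = 0` and `τ_t = 2 ξ_x` (`IsLieSymmetry.coefficients`),
which fails for `β` with nonconstant derivative and for `ξ` depending on `u`. -/

/-! ### Calculus on open connected sets. -/

theorem deriv_eq_of_eqOn {f g : ℝ → ℝ} {S : Set ℝ} (hS : IsOpen S) (h : ∀ x ∈ S, f x = g x)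
    {x : ℝ} (hx : x ∈ S) : deriv f x = deriv g x :=
  (Filter.eventuallyEq_of_mem (hS.mem_nhds hx) h).deriv_eq

theorem hasDerivAt_of_eqOn {f g : ℝ → ℝ} {S : Set ℝ} (hS : IsOpen S) (h : ∀ x ∈ S, f x = g x)
    {x g' : ℝ} (hx : x ∈ S) (hg : HasDerivAt g g' x) : HasDerivAt f g' x :=
  hg.congr_of_eventuallyEq (Filter.eventuallyEq_of_mem (hS.mem_nhds hx) h)

theorem smooth_hasDerivAt {f : ℝ → ℝ} {S : Set ℝ} (hS : IsOpen S) (hf : ContDiffOn ℝ ∞ f S)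
    {x : ℝ} (hx : x ∈ S) : HasDerivAt f (deriv f x) x :=
  ((hf.differentiableOn (by simp)).differentiableAt (hS.mem_nhds hx)).hasDerivAt

theorem smooth_deriv {f : ℝ → ℝ} {S : Set ℝ} (hS : IsOpen S) (hf : ContDiffOn ℝ ∞ f S) :
    ContDiffOn ℝ ∞ (deriv f) S :=
  hf.deriv_of_isOpen hS (by simp)

theorem eq_of_deriv_zero {f : ℝ → ℝ} {S : Set ℝ} (hS : IsOpen S) (hS' : IsConnected S)
    (hf : ∀ x ∈ S, HasDerivAt f 0 x) {x y : ℝ} (hx : x ∈ S) (hy : y ∈ S) : f x = f y :=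
  hS.is_const_of_deriv_eq_zero hS'.isPreconnected
    (fun z hz => (hf z hz).differentiableAt.differentiableWithinAt)
    (fun z hz => (hf z hz).deriv) hx hy

/-- A polynomial function of degree at most five that vanishes on a nonempty open set is zero. -/
theorem coeffs_zero {U : Set ℝ} (hU : IsOpen U) (hU' : U.Nonempty) {c0 c1 c2 c3 c4 c5 : ℝ}
    (h : ∀ u ∈ U, c0 + c1 * u + c2 * u ^ 2 + c3 * u ^ 3 + c4 * u ^ 4 + c5 * u ^ 5 = 0) :
    c0 = 0 ∧ c1 = 0 ∧ c2 = 0 ∧ c3 = 0 ∧ c4 = 0 ∧ c5 = 0 := by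
  open Polynomial in
  set P : ℝ[X] := C c0 + C c1 * X + C c2 * X ^ 2 + C c3 * X ^ 3 + C c4 * X ^ 4 + C c5 * X ^ 5
    with hP
  have hP0 : P = 0 := by
    apply Polynomial.eq_zero_of_infinite_isRoot
    have hinf : U.Infinite := by
      obtain ⟨u, hu⟩ := hU'
      exact infinite_of_mem_nhds u (hU.mem_nhds hu)
    refine hinf.mono fun u hu => ?_
    simpa [hP, Polynomial.IsRoot] using h u hu
  have hc : ∀ n, P.coeff n = 0 := by simp [hP0]
  refine ⟨by simpa [hP, Polynomial.coeff_X, Polynomial.coeff_C] using hc 0,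
    by simpa [hP, Polynomial.coeff_X, Polynomial.coeff_C] using hc 1,
    by simpa [hP, Polynomial.coeff_X, Polynomial.coeff_C] using hc 2,
    by simpa [hP, Polynomial.coeff_X, Polynomial.coeff_C] using hc 3,
    by simpa [hP, Polynomial.coeff_X, Polynomial.coeff_C] using hc 4,
    by simpa [hP, Polynomial.coeff_X, Polynomial.coeff_C] using hc 5⟩

theorem affine_of_deriv_deriv_zero {f : ℝ → ℝ} {U : Set ℝ} (hU : IsOpen U) (hU' : IsConnected U)
    (hf : ContDiffOn ℝ ∞ f U) (h : ∀ u ∈ U, deriv (deriv f) u = 0) :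
    ∃ p q : ℝ, ∀ u ∈ U, f u = p * u + q := by
  obtain ⟨u₀, hu₀⟩ := hU'.nonempty
  have h1 : ∀ u ∈ U, deriv f u = deriv f u₀ := fun u hu =>
    eq_of_deriv_zero hU hU'
      (fun v hv => by simpa [h v hv] using smooth_hasDerivAt hU (smooth_deriv hU hf) hv) hu hu₀
  refine ⟨deriv f u₀, f u₀ - deriv f u₀ * u₀, fun u hu => ?_⟩
  have h2 : f u - deriv f u₀ * u = f u₀ - deriv f u₀ * u₀ :=
    eq_of_deriv_zero (f := fun v => f v - deriv f u₀ * v) hU hU' (fun v hv => by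
      have := (smooth_hasDerivAt hU hf hv).sub ((hasDerivAt_id v).const_mul (deriv f u₀))
      exact this.congr_deriv (by rw [h1 v hv]; simp)) hu hu₀
  linarith

section slices

variable {F : Fun3} {T I U : Set ℝ}

theorem slice_t (hF : ContDiffOn ℝ ∞ (fun p : ℝ × ℝ × ℝ => F p.1 p.2.1 p.2.2) (T ×ˢ I ×ˢ U))
    {x u : ℝ} (hx : x ∈ I) (hu : u ∈ U) : ContDiffOn ℝ ∞ (fun t => F t x u) T :=
  hF.comp (t := T ×ˢ I ×ˢ U) (f := fun t : ℝ => (t, x, u)) (by fun_prop) fun _ ht => ⟨ht, hx, hu⟩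

theorem slice_x (hF : ContDiffOn ℝ ∞ (fun p : ℝ × ℝ × ℝ => F p.1 p.2.1 p.2.2) (T ×ˢ I ×ˢ U))
    {t u : ℝ} (ht : t ∈ T) (hu : u ∈ U) : ContDiffOn ℝ ∞ (fun x => F t x u) I :=
  hF.comp (t := T ×ˢ I ×ˢ U) (f := fun x : ℝ => (t, x, u)) (by fun_prop) fun _ hx => ⟨ht, hx, hu⟩

theorem slice_u (hF : ContDiffOn ℝ ∞ (fun p : ℝ × ℝ × ℝ => F p.1 p.2.1 p.2.2) (T ×ˢ I ×ˢ U))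
    {t x : ℝ} (ht : t ∈ T) (hx : x ∈ I) : ContDiffOn ℝ ∞ (fun u => F t x u) U :=
  hF.comp (t := T ×ˢ I ×ˢ U) (f := fun u : ℝ => (t, x, u)) (by fun_prop) fun _ hu => ⟨ht, hx, hu⟩

end slices

/-! ### The determining equations. -/

/-- The second prolongation applied to the Huxley equation. -/
theorem prolong_huxley (Q : Operator) {k : ℝ → ℝ} {j : Jet} {k' : ℝ}
    (hk : HasDerivAt k k' j.x) :
    Q.prolong (huxley k) j = ev Q.ξ j * (-(k' * (j.u ^ 2 * (1 - j.u))))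
      + ev Q.η j * (-(k j.x * (2 * j.u - 3 * j.u ^ 2))) + Q.ηt j - Q.ηxx j := by
  have h1 : deriv (fun s => huxley k { j with t := s }) j.t = 0 := by
    simp [huxley]
  have h2 : deriv (fun s => huxley k { j with x := s }) j.x = -(k' * (j.u ^ 2 * (1 - j.u))) := by
    have := (((hk.mul_const (j.u ^ 2)).mul_const (1 - j.u)).const_add j.uxx).const_sub j.ut
    simp only [huxley]
    rw [this.deriv]; ring
  have h3 : deriv (fun s => huxley k { j with u := s }) j.u
      = -(k j.x * (2 * j.u - 3 * j.u ^ 2)) := by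
    have := (((((hasDerivAt_id j.u).pow 2).const_mul (k j.x)).mul
      ((hasDerivAt_id j.u).const_sub 1)).const_add j.uxx).const_sub j.ut
    simp only [huxley]
    refine (this.congr_deriv ?_).deriv
    simp; ring
  have h4 : deriv (fun s => huxley k { j with ut := s }) j.ut = 1 := by
    simp [huxley]
  have h5 : deriv (fun s => huxley k { j with ux := s }) j.ux = 0 := by
    simp [huxley]
  have h6 : deriv (fun s => huxley k { j with utt := s }) j.utt = 0 := by
    simp [huxley]
  have h7 : deriv (fun s => huxley k { j with utx := s }) j.utx = 0 := by
    simp [huxley]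
  have h8 : deriv (fun s => huxley k { j with uxx := s }) j.uxx = -1 := by
    have := (((hasDerivAt_id j.uxx).add_const (k j.x * j.u ^ 2 * (1 - j.u)))).const_sub j.ut
    exact this.deriv
  rw [Operator.prolong, h1, h2, h3, h4, h5, h6, h7, h8]
  ring

/-- The determining equations of the nonclassical symmetries `∂_t + ξ ∂_x + η ∂_u`. -/
def Determining (k : ℝ → ℝ) (ξ η : Fun3) (t x u : ℝ) : Prop :=
  pdu (pdu ξ) t x u = 0 ∧
  pdu (pdu η) t x u = 2 * pdx (pdu ξ) t x u - 2 * ξ t x u * pdu ξ t x u ∧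
  -pdt ξ t x u + 2 * pdu ξ t x u * η t x u - 3 * pdu ξ t x u * (k x * (u ^ 2 - u ^ 3))
    - 2 * pdx (pdu η) t x u + pdx (pdx ξ) t x u - 2 * ξ t x u * pdx ξ t x u = 0 ∧
  pdt η t x u - pdx (pdx η) t x u + pdu η t x u * (k x * (u ^ 2 - u ^ 3))
    + 2 * pdx ξ t x u * (η t x u - k x * (u ^ 2 - u ^ 3)) - ξ t x u * deriv k x * (u ^ 2 - u ^ 3)
    - η t x u * k x * (2 * u - 3 * u ^ 2) = 0

/-- Since `τ` is constant, the terms with `u_tx` carry the factor `D_x τ = 0` and drop out. Hence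
`u_x` is the only derivative that survives the elimination, and the constraints `D_t Q[u] = D_x Q[u]
= 0` play no role here. -/
theorem prolong_unitTime {k : ℝ → ℝ} {ξ η : Fun3} {j : Jet} (hk : DifferentiableAt ℝ k j.x)
    (hL : huxley k j = 0) (hQ : (Operator.unitTime ξ η).char j = 0) :
    (Operator.unitTime ξ η).prolong (huxley k) j =
      ev (pdu (pdu ξ)) j * j.ux ^ 3
      + (2 * ev (pdx (pdu ξ)) j - 2 * ev ξ j * ev (pdu ξ) j - ev (pdu (pdu η)) j) * j.ux ^ 2
      + (-ev (pdt ξ) j + 2 * ev (pdu ξ) j * ev η j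
          - 3 * ev (pdu ξ) j * (k j.x * (j.u ^ 2 - j.u ^ 3))
          - 2 * ev (pdx (pdu η)) j + ev (pdx (pdx ξ)) j - 2 * ev ξ j * ev (pdx ξ) j) * j.ux
      + (ev (pdt η) j - ev (pdx (pdx η)) j + ev (pdu η) j * (k j.x * (j.u ^ 2 - j.u ^ 3))
          + 2 * ev (pdx ξ) j * (ev η j - k j.x * (j.u ^ 2 - j.u ^ 3))
          - ev ξ j * deriv k j.x * (j.u ^ 2 - j.u ^ 3)
          - ev η j * k j.x * (2 * j.u - 3 * j.u ^ 2)) := by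
  rw [prolong_huxley _ hk.hasDerivAt]
  have hut : j.ut = ev η j - ev ξ j * j.ux := by
    simp only [Operator.char, Operator.unitTime, ev] at hQ ⊢
    linarith
  have huxx : j.uxx = ev η j - ev ξ j * j.ux - k j.x * (j.u ^ 2 - j.u ^ 3) := by
    simp only [huxley] at hL
    linear_combination -hL + hut
  have hτ : (Operator.unitTime ξ η).τ = fun _ _ _ => 1 := rfl
  have h1 : Dt (fun _ _ _ => 1) j = 0 := by simp [Dt, ev, pdt, pdu]
  have h2 : Dx (fun _ _ _ => 1) j = 0 := by simp [Dx, ev, pdx, pdu]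
  have h3 : Dxx (fun _ _ _ => 1) j = 0 := by simp [Dxx, ev, pdx, pdu]
  simp only [Operator.ηt, Operator.ηxx, hτ, h1, h2, h3]
  simp only [Operator.unitTime, Dt, Dx, Dxx, huxx, hut]
  ring

theorem isNonclassicalSymmetry_unitTime_iff {k : ℝ → ℝ} {ξ η : Fun3} {T I U : Set ℝ}
    (hk : ∀ x ∈ I, DifferentiableAt ℝ k x) :
    IsNonclassicalSymmetry (huxley k) (Operator.unitTime ξ η) T I U ↔
      (Operator.unitTime ξ η).SmoothOn T I U ∧
        ∀ t ∈ T, ∀ x ∈ I, ∀ u ∈ U, Determining k ξ η t x u := by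
  constructor
  · rintro ⟨hs, -, h⟩
    refine ⟨hs, fun t ht x hx u hu => ?_⟩
    -- Every value `p` of `u_x` is attained: `u_t`, `u_xx`, `u_tx`, `u_tt` are solved in this order
    -- from `Q[u] = 0`, `L = 0`, `D_x Q[u] = 0`, `D_t Q[u] = 0`.
    have key : ∀ p ∈ (Set.univ : Set ℝ), _ := fun p _ => by
      let ut := η t x u - ξ t x u * p
      let uxx := ut - k x * u ^ 2 * (1 - u)
      let utx := pdx η t x u + pdu η t x u * p
        - (pdx ξ t x u + pdu ξ t x u * p) * p - ξ t x u * uxx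
      let utt := pdt η t x u + pdu η t x u * ut
        - (pdt ξ t x u + pdu ξ t x u * ut) * p - ξ t x u * utx
      let j : Jet := ⟨t, x, u, ut, p, utt, utx, uxx⟩
      have hL : huxley k j = 0 := by simp only [huxley, j, uxx]; ring
      have hc : (Operator.unitTime ξ η).char j = 0 := by
        simp only [Operator.char, Operator.unitTime, ev, j, ut]; ring
      have hm : j ∈ (Operator.unitTime ξ η).CharManifold := by
        refine ⟨hc, ?_, ?_⟩
        · simp only [Operator.charDt, Operator.unitTime, ev, j, Dt, utt]
          simp [pdt, pdu]
          ring
        · simp only [Operator.charDx, Operator.unitTime, ev, j, Dx, utx]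
          simp [pdx, pdu]
          ring
      have := h j ⟨ht, hx, hu⟩ hL hm
      rw [prolong_unitTime (hk x hx) hL hc] at this
      have h0 := this
      simp only [ev, j] at h0
      -- The cubic in `p` is padded to degree five to fit `coeffs_zero`.
      rewrite [show ∀ a b c d : ℝ, a * p ^ 3 + b * p ^ 2 + c * p + d =
        d + c * p + b * p ^ 2 + a * p ^ 3 + 0 * p ^ 4 + 0 * p ^ 5 from fun a b c d => by ring] at h0
      exact h0
    obtain ⟨h0, h1, h2, h3, -, -⟩ := coeffs_zero isOpen_univ Set.univ_nonempty key
    exact ⟨h3, by linarith, h1, h0⟩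
  · rintro ⟨hs, h⟩
    refine ⟨hs, fun _ _ _ _ _ _ => by simp [Operator.unitTime], ?_⟩
    rintro j ⟨ht, hx, hu⟩ hL ⟨hc, -, -⟩
    rw [prolong_unitTime (hk _ hx) hL hc]
    obtain ⟨h3, h2, h1, h0⟩ := h _ ht _ hx _ hu
    simp only [ev]
    rw [h0, h1, h2, h3]
    ring

/-! ### Differential elimination in the case where `ξ` depends on `u`. -/

set_option maxHeartbeats 8000000 in
/-- A certificate that the listed polynomials have no common zeros outside `W = 0` and `W = -1`. -/
theorem mul_add_one_pow_three_eq_zero {W s r : ℝ}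
    (h1 : 36 * W ^ 5 - 108 * W ^ 3 * s - 54 * W ^ 3 - 9 * W ^ 2 * r - 16 * W ^ 2 + 72 * W * s ^
        2 + 66 * W * s + 2 * W + 9 * s * r + 10 * s + r = 0)
    (h2 : -162 * W ^ 6 + 54 * W ^ 4 * s + 288 * W ^ 4 - 81 * W ^ 3 * r + 108 * W ^ 3 + 756 * W ^
        2 * s ^ 2 + 162 * W ^ 2 * s - 30 * W ^ 2 + 171 * W * s * r + 24 * W * s + 63 * W * r - 12 *
        W - 432 * s ^ 3 - 288 * s ^ 2 + 9 * r ^ 2 + 10 * r = 0)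
    (h3 : -486 * W ^ 7 + 3834 * W ^ 5 * s + 1188 * W ^ 5 + 207 * W ^ 4 * r + 384 * W ^ 4 - 5508
        * W ^ 3 * s ^ 2 - 5418 * W ^ 3 * s - 630 * W ^ 3 + 261 * W ^ 2 * s * r - 1500 * W ^ 2 * s -
        189 * W ^ 2 * r - 352 * W ^ 2 - 432 * W * s ^ 3 + 1188 * W * s ^ 2 + 372 * W * s + 39 * W *
        r ^ 2 - 74 * W * r - 40 * W - 774 * s ^ 2 * r - 48 * s ^ 2 - 246 * s * r + 64 * s = 0)
    (h4 : 3726 * W ^ 8 - 5346 * W ^ 6 * s - 9612 * W ^ 6 + 4617 * W ^ 5 * r - 3816 * W ^ 5 -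
        72252 * W ^ 4 * s ^ 2 - 6102 * W ^ 4 * s + 5670 * W ^ 4 - 21141 * W ^ 3 * s * r - 684 * W ^
        3 * s - 7191 * W ^ 3 * r + 4488 * W ^ 3 + 134784 * W ^ 2 * s ^ 3 + 118476 * W ^ 2 * s ^ 2 +
        14220 * W ^ 2 * s + 27 * W ^ 2 * r ^ 2 - 2214 * W ^ 2 * r + 888 * W ^ 2 + 7182 * W * s ^ 2 *
        r + 27864 * W * s ^ 2 + 7794 * W * s * r + 5904 * W * s + 372 * W * r + 2592 * s ^ 4 - 16416
        * s ^ 3 - 5184 * s ^ 2 - 1782 * s * r ^ 2 + 348 * s * r + 240 * s - 246 * r ^ 2 + 64 * r =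
        0)
    (h5 : 27702 * W ^ 9 - 231174 * W ^ 7 * s - 89316 * W ^ 7 - 6075 * W ^ 6 * r - 31752 * W ^ 6
        + 649944 * W ^ 5 * s ^ 2 + 490482 * W ^ 5 * s + 74142 * W ^ 5 - 52947 * W ^ 4 * s * r +
        152748 * W ^ 4 * s + 1665 * W ^ 4 * r + 51288 * W ^ 4 - 316872 * W ^ 3 * s ^ 3 - 675000 * W
        ^ 3 * s ^ 2 - 184968 * W ^ 3 * s - 7101 * W ^ 3 * r ^ 2 + 1770 * W ^ 3 * r + 5136 * W ^ 3 +
        268488 * W ^ 2 * s ^ 2 * r - 140256 * W ^ 2 * s ^ 2 + 140508 * W ^ 2 * s * r - 83016 * W ^ 2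
        * s + 9288 * W ^ 2 * r - 2128 * W ^ 2 - 559872 * W * s ^ 4 - 346680 * W * s ^ 3 - 4968 * W *
        s ^ 2 + 11808 * W * s * r ^ 2 + 40644 * W * s * r - 3936 * W * s + 3090 * W * r ^ 2 + 3872 *
        W * r - 256 * W - 10908 * s ^ 3 * r - 55728 * s ^ 3 - 46260 * s ^ 2 * r - 10416 * s ^ 2 -
        6168 * s * r + 256 * s - 594 * r ^ 3 + 116 * r ^ 2 + 80 * r = 0)
    (h6 : -109350 * W ^ 10 - 843210 * W ^ 8 * s + 212220 * W ^ 8 - 468585 * W ^ 7 * r + 104760 *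
        W ^ 7 + 8648856 * W ^ 6 * s ^ 2 + 4793094 * W ^ 6 * s + 117234 * W ^ 6 + 2931471 * W ^ 5 * s
        * r + 1529820 * W ^ 5 * s + 1022787 * W ^ 5 * r - 3384 * W ^ 5 - 23656536 * W ^ 4 * s ^ 3 -
        21195432 * W ^ 4 * s ^ 2 - 5755104 * W ^ 4 * s - 42417 * W ^ 4 * r ^ 2 + 322038 * W ^ 4 * r
        - 298440 * W ^ 4 - 4557384 * W ^ 3 * s ^ 2 * r - 6667920 * W ^ 3 * s ^ 2 - 3755916 * W ^ 3 *
        s * r - 3756384 * W ^ 3 * s - 398232 * W ^ 3 * r - 227616 * W ^ 3 + 19533312 * W ^ 2 * s ^ 4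
        + 23604696 * W ^ 2 * s ^ 3 + 6684984 * W ^ 2 * s ^ 2 + 587250 * W ^ 2 * s * r ^ 2 - 969912 *
        W ^ 2 * s * r - 262944 * W ^ 2 * s + 175428 * W ^ 2 * r ^ 2 - 175752 * W ^ 2 * r - 48864 * W
        ^ 2 - 5232276 * W * s ^ 3 * r + 2817072 * W * s ^ 3 - 1748844 * W * s ^ 2 * r + 2164032 * W
        * s ^ 2 + 8280 * W * s * r + 144480 * W * s + 17154 * W * r ^ 3 + 61332 * W * r ^ 2 - 6960 *
        W * r - 960 * W + 3359232 * s ^ 5 + 1949184 * s ^ 4 - 525312 * s ^ 3 - 103572 * s ^ 2 * r ^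
        2 - 411048 * s ^ 2 * r - 50400 * s ^ 2 - 132444 * s * r ^ 2 - 41280 * s * r + 2496 * s -
        6168 * r ^ 2 + 256 * r = 0)
    (h7 : -2811510 * W ^ 11 + 27085266 * W ^ 9 * s + 10822572 * W ^ 9 - 321489 * W ^ 8 * r +
        3806568 * W ^ 8 - 83626020 * W ^ 7 * s ^ 2 - 78979698 * W ^ 7 * s - 12617262 * W ^ 7 +
        11596689 * W ^ 6 * s * r - 25936092 * W ^ 6 * s + 3528387 * W ^ 6 * r - 8366040 * W ^ 6 +
        61447896 * W ^ 5 * s ^ 3 + 119142252 * W ^ 5 * s ^ 2 + 56582172 * W ^ 5 * s + 1370763 * W ^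
        5 * r ^ 2 + 1263222 * W ^ 5 * r + 2652408 * W ^ 5 - 45521190 * W ^ 4 * s ^ 2 * r + 38775672
        * W ^ 4 * s ^ 2 - 30974346 * W ^ 4 * s * r + 35418888 * W ^ 4 * s - 5102712 * W ^ 4 * r +
        3351984 * W ^ 4 + 95773104 * W ^ 3 * s ^ 4 + 83014632 * W ^ 3 * s ^ 3 + 21666312 * W ^ 3 * s
        ^ 2 - 5665464 * W ^ 3 * s * r ^ 2 - 10281816 * W ^ 3 * s * r + 5200848 * W ^ 3 * s - 2117448
        * W ^ 3 * r ^ 2 - 3706440 * W ^ 3 * r + 772608 * W ^ 3 + 92500380 * W ^ 2 * s ^ 3 * r +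
        48966768 * W ^ 2 * s ^ 3 + 64832508 * W ^ 2 * s ^ 2 * r + 21603744 * W ^ 2 * s ^ 2 +
        11021544 * W ^ 2 * s * r + 750336 * W ^ 2 * s + 144288 * W ^ 2 * r ^ 3 - 651816 * W ^ 2 * r
        ^ 2 - 447984 * W ^ 2 * r + 25280 * W ^ 2 - 111725568 * W * s ^ 5 - 130941360 * W * s ^ 4 -
        30583440 * W * s ^ 3 - 6959844 * W * s ^ 2 * r ^ 2 + 9580536 * W * s ^ 2 * r + 2930688 * W *
        s ^ 2 - 1131984 * W * s * r ^ 2 + 3819744 * W * s * r + 327744 * W * s + 15096 * W * r ^ 2 +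
        97248 * W * r - 1024 * W + 16063272 * s ^ 4 * r - 5634144 * s ^ 4 + 5268024 * s ^ 3 * r -
        5972256 * s ^ 3 - 1601424 * s ^ 2 * r - 454080 * s ^ 2 - 103356 * s * r ^ 3 - 396696 * s * r
        ^ 2 - 69024 * s * r + 2944 * s - 44148 * r ^ 3 - 13760 * r ^ 2 + 832 * r = 0)
    : W * (W + 1) ^ 3 = 0 := by
  -- Ideal membership: a nonzero integer multiple of `W (W + 1) ^ 3` is written explicitly as a
  -- combination of the seven polynomials with integer polynomial cofactors, which is a ring
  -- identity. The multiplicity of the factor `W + 1` is harmless, since only the zeros matter.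
  have h : (46572368449368888397246672551736328923974087927139727465123783730252286092428732899455028597175867909520673174380457939968 : ℝ) * (W * (W + 1) ^ 3) = 0 := by
    linear_combination
      (6370943311371112607446376241181686622382848054982661811252566269379052498082661806736884438634257858616327393603962889384288
        * W ^ 7 -
        501031969031101099820614909981942240501112173129514943824896622190254410476128941849481514862453222835709496475995688872608
        * W ^ 6 * s +
        3713855512601628779845306360217991627106275155589751458509956707503103372140264835883489348632952435753970293942779209731806
        * W ^ 6 -
        33813270381727056808374279517219846243273476679061668670854394462713295826260708400302924305625025714396728841764513530261152
        * W ^ 5 * s -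
        769837496714348263895947204013583614302293729694050093117226978059654456280099472515342053365576955143494319489600841274020
        * W ^ 5 * r -
        14068632830677567942758599848229031364553742337946156960252371466514578471106858272298205016577754653308600536955300528112888
        * W ^ 5 +
        6849607185115993978701720306826674561184306469670712146617998689656070630526658543593832627470574947766393773685925255881616
        * W ^ 4 * s ^ 2 -
        12634702000959090475661998456640327987234571767866875509494258193181858407909958972292965606780120465881937948685200469221954
        * W ^ 4 * s -
        178289975087290801836512697998572110024466515494992534776785261721963222285300213274289312623990032899480342761911726569712
        * W ^ 4 * r -
        9998669510954045557846314480542803440233964674189061754968757692048335114505757318097341740352346965790157501496310254700520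
        * W ^ 4 +
        41552789153086325099637128443196086269094443811847010969524052678825430521684028648557833524185714109814649277722514995713088
        * W ^ 3 * s ^ 2 +
        1509481895264988349623871441514339252861165271256277823038619342333606762054746530518468869269802620160919651252725736661632
        * W ^ 3 * s * r +
        40653350538861760021705421099777024913743005917064708230994361669628413137550850498231375474601885280441423672249488021000776
        * W ^ 3 * s +
        977862610487078329278122268095394476409317829202116238049240919446455848936827231313628839055949609077639993409835335682471
        * W ^ 3 * r +
        2226588964138860098700096000739743959625676785834398161919991038586097648006650001168742101714875555696597714484333237790292
        * W ^ 3 -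
        13991712164232226623276863001004614489798028043200355281226240247394826796344977431221020793716119818089884216839580145195872
        * W ^ 2 * s ^ 3 +
        10840506466732645536519333758955624340973885083386355270054724890704023946160574391785444708266519867790697546398831970055500
        * W ^ 2 * s ^ 2 -
        3084025290431153507573747931039138288504284487728351490324940559748848592760559722883275576386662134364380153792370620114896
        * W ^ 2 * s * r +
        22279803371148092330538740908211586299769647186760573902588424456267549021472152940971066705132650825247766770041064915740514
        * W ^ 2 * s +
        64277053646643154763160514333542120023016493618892573542484080921415947224370836542978856374280546230447426952177020926632
        * W ^ 2 * r ^ 2 +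
        1811528676463892789988808268610958172879776998692830616952432800698166733698114259106461373602993034863798553652136901740192
        * W ^ 2 * r +
        2581015332763264904912628165902317025710633732262733481779381176169100634803503577980310159747690414972479424329615905961450
        * W ^ 2 -
        2384436508977456215016458128169497093178806797663051366306370544156709746566398807417235146829070860111344066799467528498432
        * W * s ^ 3 -
        769106258785214689505967347218232704920343358154381958266186055314376807068698207078705719965134458008134116512488667166380
        * W * s ^ 2 * r -
        9121022043378253931165359434211668895203695200044361975203722685199508131599781450647990133975400796676638386883351064199328
        * W * s ^ 2 +
        11473423399553804061676418496277582746440040330598896400648657830777878595233309131271877499938593395092154349964201535539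
        * W * s * r +
        670264550848089024077589049292432965623474894337405027351239921292449174486912019602780721381955999117840104296917334778200
        * W * s -
        412469116483271117036422244656554704497474807447080398097358557297472019187976753155311209786632169478962838433011647002672
        * W * r ^ 2 +
        878902663643241295983544004145801919691462364066962533056258775864711422405654396283452250634527797193965042691500385013379
        * W * r +
        466574648333305296075284058669363034540766041484345525082920481175070638067938623278117544564314727201924955111634209585188
        * W +
        4753025252005873123743682319496980264070504239065378785561332048606618370655101470200725067164151336915526312857075249037184
        * s ^ 4 +
        1130922859599508546308928505736459549314785495778130782653321300056006713467389051471381888123158357590354202223011426788368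
        * s ^ 3 +
        2997841145816012380674003581468389327983397462556454240931590359715328259355857780386046085669068333492207264595557802531936
        * s ^ 2 * r -
        3327020436010985604176101936173081141969821714385083173184486061713930045957137213413691779926080515942142049339793159454368
        * s ^ 2 -
        233359634584896236328397474596861882157622949836861497286502515213217696586560447725247836588670341227896744761657747054088
        * s * r ^ 2 +
        829495765705944686086467400001985386435869016202492713531709463158374848673072621320074459762628028181785650874898431486352
        * s * r -
        532427051160634812163804710794726546527925207986066053880168636065078477794070280942587543576638978487961078251604120122624
        * s +
        104934305254035870668739459944296859719938659471104718623679423661145363078396890376184484333244145849976050048089788368901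
        * r ^ 2 +
        85492446960373679429749498415186619109990540038828291406236222861351700433607037790443980228232216631106327077411440694178
        * r +
        16750792967321898068560258370230829889602263073547895523418346421315220130595956504386499240606194178299719269154152797696)
        * h1
      + (-767243463388501060149254759635426848587710206549020469220064426584251083328883315373612675566081008659810517759847049111808
        * W ^ 4 * s -
        36760904597923139507376897577457666548640306760383455817359411984426997889560213406145081231527042228819150648423401362902
        * W ^ 4 * r -
        319137626366499893012925702780339905345535667586464789789692843032036163392254264372257141272549806321789199309982082325664
        * W ^ 4 +
        986694630512574857901331543046568710357988547605701361830564802137014207176848250156736812106926940286243103613146184713600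
        * W ^ 3 * s ^ 2 +
        1611028778932870271784207206830781357535447999694122481121150029853946204931099478257558458024944464009571826455420246883336
        * W ^ 3 * s -
        221061253487075465730320204692840231232647346861066404570596964513113448922622548092671674286104439769405621272517703969856
        * W ^ 3 * r +
        146144866365846004623181618202846703092504509247211247926174239257545729147601748498659975848281356161156911084007197590218
        * W ^ 3 -
        366600813942762210066917024866670260737367707015303823288712789683150150809792832395810091179427825642716703466672983507584
        * W ^ 2 * s ^ 2 -
        288262733908579323811573289032058271333248985872147930983849890165451256721203875873205511660523559682527655517979051531778
        * W ^ 2 * s * r +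
        932306581007590109529524794160831798037176381934231787379463798842511593507995196232847415428280378214003925355886738084564
        * W ^ 2 * s +
        368285863057881844397609551395577747407539174962118046720665042385895030268973779097002401656613062150053242537370879936451
        * W ^ 2 * r +
        133238446377618333343476960240688645756852801540883314239220989273023760024222421229022571224877614514429497038573521848528
        * W ^ 2 -
        1114430246677916415974954260995283039406446176874520006733914881372790027360025208543314843977964785687585756243230110973440
        * W * s ^ 3 -
        1571022418026506441200380398573747637243748691204548973154279188028735169694118920949945594170131842851815724136481229449512
        * W * s ^ 2 -
        143696199353124118902636319472068531358403947579885968502244565429905055793758573533381236521673787260404796462638521364608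
        * W * s * r -
        532573621062800966407453001071431167025266179456083014136282011411531193352365094218904902115958212940331037266338590438458
        * W * s -
        22279573127877886393901585363521421721041247379086365555235438487465919979461207664895997829074534277584612582378365945692
        * W * r ^ 2 +
        121719383336174535722477696721354442109326559416444403240522627977492089476461320856157894873917600689703107375506648339688
        * W * r +
        2233526164911383245978558323380609702343135853988158716716799060955432804870195651968573482641856601732859854404903092070
        * W +
        454224660109097173592336114466150184747593465836510830065507291090501097794468369246594597442356848135410005183211312032000
        * s ^ 3 +
        473216759111597450730535612427340633638065241577451099288890476957323365048482027781125164677231093503176497062984964332448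
        * s ^ 2 * r +
        180459045521303734775662301725232533445208080558216339890636183289954202059377358210456783062873858750407707792497919614608
        * s ^ 2 -
        93003157311392310044993080991949775349165265533589274472352931378346136371997458732728179235785210231769284804356805813669
        * s * r -
        95353304360104337424962370784488732666974986199298070470679784403846400879377934247362693782507314193282339057819136642338
        * s -
        18779336357865824744189771344914284038001328063289281077822338139596950609285642570763307813863451055629395491440940631776
        * r ^ 2 -
        16768795610793752408681299380365837197953988990806230706035172095044065915064875245978996185885234801261492493211360147613
        * r +
        1143542664027045654011682740378355746446488722669962584195702374788707630695503502674357340891225089467152524107606250240)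
        * h2
      + (122326779357866900802136311999769028965344022877804525635395069135299308777828984938889682923672185630691965106421903570004
        * W ^ 4 -
        670130934631527164268208846201408436411390731424245392017225735740730831642540184949166234446985310593849245754163168350784
        * W ^ 3 * s -
        49792294019449003199054369598645055403193945258155794075160182784089087390139931260922836948879071015459605817689819175782
        * W ^ 3 * r -
        217768264256881333995692000258529109129367758916066489624281217052949173597251632283211935906520672875908846106483836674480
        * W ^ 3 +
        460978521860917561782973969833092432701629224205901878093008031916858659498388280264176360794199728698628945680895790285536
        * W ^ 2 * s ^ 2 +
        225196541344357270006244881189311137811561741581492363073526311795501682378990378987733440931285698508162812102209713760396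
        * W ^ 2 * s -
        142221530433494678224114185298750364661871492251450718627329415820178039855041371900898839730049359595838815656176585365264
        * W ^ 2 * r -
        94561867537103677106621766994367534951291655954182694146585757886669897015344747199934538336803712972906262172934727845780
        * W ^ 2 +
        33313191080848867187762572311918546457672700282868513075716569125750862649808263022018997232445744748823421787653921339648
        * W * s ^ 2 +
        32298843073479017618397288937728618207568149460120422245864373908953300499705049453668638774742337602911261293902060981262
        * W * s * r +
        289237899668877625359038040692915190098412167111423820536334791928023895403730515603858993722537753506743689232018672630836
        * W * s +
        15008454598218862353606124606895901810803653645992664170842366635327321135999787687421346382610935364444407550802899095790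
        * W * r -
        2651565800631814086313838687344709261334456158771202185228615912672057140313536321283266965760276267735966048153736863824
        * W -
        238604902232709179838489040733624990785350804931939771255504156820331668438776940810802024055306268339718325611332024069952
        * s ^ 3 -
        187305528342496510203368221111353196502540707567547360828096934825716796830214431637246171526935298446225089511859326478080
        * s ^ 2 +
        60127437440996236095123828296290272682512104894525653925217554104958335684528529196866084582852001446336971851503466021456
        * s * r +
        36835257112656150797164456417167311830518707719772429486287636129235738437454566915704972376612140322296517420985289143136
        * s +
        5141439952587204552438827391581866551009518625943007435823562727876750764491047922668307191324892525596449057471930602852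
        * r ^ 2 +
        16163343012567276377634718360437680662090513009397863597408417620995446880028775226410105852530443970626334607774840801368
        * r -
        1134684418135210707276978810007087429478888054583603926659553490897499271710305026210545396973392616103804541986141215488)
        * h3
      + (-26036384181239171249421238804100007619384046371887207407902148859851207727982067007340750678897749031887424648215783760752
        * W ^ 4 +
        4840888589672474394402076424946301840590455779029129892027986687828545028754869003376632993840127756866758420057929361088
        * W ^ 3 * s -
        3062382034920451550566482885238401203429466817899568354246237486673588820733905597479765954085523290631576775365667659536
        * W ^ 3 -
        15013361640265401320362695775821377424986678455336284822094796418641605706272692990224014860415136842646357571717435271968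
        * W ^ 2 * s -
        654903799409346928255872702093566503475419436838441334063312497154296753524739708548493825953257909129435139778908441856
        * W ^ 2 * r -
        617751994422272914304352327219194283197713023005475755583160262747194881357881008995087851434054025990399385251971120320
        * W ^ 2 +
        16399660655137020948635142950954539922923148427570842805503574729769978226386410379886163479873763081967374246242274513984
        * W * s ^ 2 +
        4524266624102422955283457531855342369665103066997262680191918431288015834973612384039855140849354405951738032671702084416
        * W * s -
        4714637096149088439174570999589181785067754474001897573382024140072621342871530056932702310561084594528086821430932934064
        * W * r -
        491761571046425078889869873687725310509256464530432380502982380674224285920059782369489837787603669959101355689027726016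
        * W -
        6053569062692078291326896345191999708750485741366654249197290851219986163681841398197005503428030497088379098082299636096
        * s ^ 2 -
        1598809706589641985877206475109898238159275673726319048164951730368024115608398592625781109242751788083174360161851123264
        * s * r -
        1439892903162780222793473125354605022968282917777871060050668938946863400339096028479174027992896129774778994157911186688
        * s -
        545063057882519276622380189166385579276851984252046967098300054116457971232671616868715503165773897098966818746072512224
        * r -
        495376156579141444077630169570926373085771565312200167470075106232364096141011655206872092788124054251439883285678225920)
        * h4
      + (-5650378275388879422977048379443262143824034845011537044189274531832037173469684769287560137132854927999911592939884683168
        * W ^ 3 -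
        3136523157985075432608013211689833670669974807349577522978560154325534067323776219331462600790925899671955598304285478128
        * W ^ 2 +
        921076073171762619701935035966077293546595063920080100480315591940995265200586766890943186938095334385911127499304007696
        * W * s +
        126062993512072536202724113264557007510701645956250548905267517236718200842875931500371900102965107221631523389617697712
        * W +
        1731175916802283880243725215548455746199398080413668697851848632720816327365975455247084382798255289612934191981631936960
        * s ^ 2 +
        612021181710306581964913601077342254678079773688746034218948277037294154982805028588246628443451082946058756478011937568
        * s -
        284535399361603405214996535529004303606080728231655773906399062721165918322509735920656178997931076600445386233953645936
        * r +
        56837617913524388904740104392986276330784304390116621464876491087296724023391452994863820416759062730157952545753910912)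
        * h5
      + (-147764933243942497260431100073272849285202765987518764716592395751670794628709764417812933602244180672202794236918032672
        * W ^ 2 -
        122995859291993441716559047309599813806519359664270880353743780873920353435644163389072456632993949517002539666574049968
        * W +
        63084628920428194874009451200784745756185234090111979881776110622147764245956715230938352682989330133479974250476480176
        * s +
        8234012052505144668773711009644199153287608664086025153541033330044066417854919187282980069577927167441376749584185168)
        * h6
      + (-2854797523229411919984650424811141280990968418412288013602272643357342655830194936720816880675749345217670741815979632
        * W -
        3770507337801166268382251552142928565242959482550556254551907680055304338183198496903614473835552853553750759015232112)
        * h7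
  exact (mul_eq_zero.mp h).resolve_left (by norm_num)

theorem deriv_zero_of_eqOn {f : ℝ → ℝ} {f' x : ℝ} {S : Set ℝ} (hS : IsOpen S)
    (h : ∀ y ∈ S, f y = 0) (hx : x ∈ S) (hf : HasDerivAt f f' x) : f' = 0 :=
  hf.unique (hasDerivAt_of_eqOn hS h hx (hasDerivAt_const x 0))

set_option maxHeartbeats 1000000 in
/-- A trajectory of the polynomial flow that stays on the surface `h1` has `W = 0` or `W = -1`: the
iterated derivatives of the equation of the surface have no other common zeros. -/
theorem eq_zero_or_neg_one_of_flow {I : Set ℝ} (hI : IsOpen I) {m W s r : ℝ → ℝ}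
    (hm : ∀ x ∈ I, m x ≠ 0)
    (hW : ∀ x ∈ I, HasDerivAt W (m x * (-2 * s x)) x)
    (hs : ∀ x ∈ I, HasDerivAt s (m x * (-2 * W x * s x + r x / 3)) x)
    (hr : ∀ x ∈ I, HasDerivAt r (m x * (6 * W x ^ 4 - 12 * W x ^ 2 * s x - 10 * W x ^ 2
      - W x * r x - 4 * W x + 4 * s x)) x)
    (h1 : ∀ x ∈ I, 36 * W x ^ 5 - 108 * W x ^ 3 * s x - 54 * W x ^ 3 - 9 * W x ^ 2 * r x - 16 *
        W x ^ 2 + 72 * W x * s x ^ 2 + 66 * W x * s x + 2 * W x + 9 * s x * r x + 10 * s x + r x =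
        0) :
    ∀ x ∈ I, W x = 0 ∨ W x = -1 := by
  -- Each of `h2`, …, `h7` is the derivative of its predecessor along the flow, divided by the
  -- nonzero factor `m` common to all three components of the flow.
  have h2 : ∀ x ∈ I, -162 * W x ^ 6 + 54 * W x ^ 4 * s x + 288 * W x ^ 4 - 81 * W x ^ 3 * r x +
      108 * W x ^ 3 + 756 * W x ^ 2 * s x ^ 2 + 162 * W x ^ 2 * s x - 30 * W x ^ 2 + 171 * W x * s x
      * r x + 24 * W x * s x + 63 * W x * r x - 12 * W x - 432 * s x ^ 3 - 288 * s x ^ 2 + 9 * r x ^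
      2 + 10 * r x = 0 := by
    intro x hx
    have hd := deriv_zero_of_eqOn hI h1 hx (by
      -- The derivative of the polynomial is assembled by structural recursion, with the flow
      -- equations at the leaves.
      with_reducible repeat' first
        | exact hW x hx | exact hs x hx | exact hr x hx | exact hasDerivAt_const _ _
        | apply HasDerivAt.fun_pow | apply HasDerivAt.fun_add | apply HasDerivAt.fun_sub
        | apply HasDerivAt.fun_neg | apply HasDerivAt.fun_mul)
    refine (mul_eq_zero.mp ?_).resolve_left (hm x hx)
    -- The factor 3 clears the denominator of `r / 3` in the equation for `s`.
    linear_combination 3 * hd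
  have h3 : ∀ x ∈ I, -486 * W x ^ 7 + 3834 * W x ^ 5 * s x + 1188 * W x ^ 5 + 207 * W x ^ 4 * r
      x + 384 * W x ^ 4 - 5508 * W x ^ 3 * s x ^ 2 - 5418 * W x ^ 3 * s x - 630 * W x ^ 3 + 261 * W
      x ^ 2 * s x * r x - 1500 * W x ^ 2 * s x - 189 * W x ^ 2 * r x - 352 * W x ^ 2 - 432 * W x * s
      x ^ 3 + 1188 * W x * s x ^ 2 + 372 * W x * s x + 39 * W x * r x ^ 2 - 74 * W x * r x - 40 * W
      x - 774 * s x ^ 2 * r x - 48 * s x ^ 2 - 246 * s x * r x + 64 * s x = 0 := by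
    intro x hx
    have hd := deriv_zero_of_eqOn hI h2 hx (by
      with_reducible repeat' first
        | exact hW x hx | exact hs x hx | exact hr x hx | exact hasDerivAt_const _ _
        | apply HasDerivAt.fun_pow | apply HasDerivAt.fun_add | apply HasDerivAt.fun_sub
        | apply HasDerivAt.fun_neg | apply HasDerivAt.fun_mul)
    refine (mul_eq_zero.mp ?_).resolve_left (hm x hx)
    linear_combination 1 * hd
  have h4 : ∀ x ∈ I, 3726 * W x ^ 8 - 5346 * W x ^ 6 * s x - 9612 * W x ^ 6 + 4617 * W x ^ 5 * r
      x - 3816 * W x ^ 5 - 72252 * W x ^ 4 * s x ^ 2 - 6102 * W x ^ 4 * s x + 5670 * W x ^ 4 - 21141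
      * W x ^ 3 * s x * r x - 684 * W x ^ 3 * s x - 7191 * W x ^ 3 * r x + 4488 * W x ^ 3 + 134784 *
      W x ^ 2 * s x ^ 3 + 118476 * W x ^ 2 * s x ^ 2 + 14220 * W x ^ 2 * s x + 27 * W x ^ 2 * r x ^
      2 - 2214 * W x ^ 2 * r x + 888 * W x ^ 2 + 7182 * W x * s x ^ 2 * r x + 27864 * W x * s x ^ 2
      + 7794 * W x * s x * r x + 5904 * W x * s x + 372 * W x * r x + 2592 * s x ^ 4 - 16416 * s x ^
      3 - 5184 * s x ^ 2 - 1782 * s x * r x ^ 2 + 348 * s x * r x + 240 * s x - 246 * r x ^ 2 + 64 *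
      r x = 0 := by
    intro x hx
    have hd := deriv_zero_of_eqOn hI h3 hx (by
      with_reducible repeat' first
        | exact hW x hx | exact hs x hx | exact hr x hx | exact hasDerivAt_const _ _
        | apply HasDerivAt.fun_pow | apply HasDerivAt.fun_add | apply HasDerivAt.fun_sub
        | apply HasDerivAt.fun_neg | apply HasDerivAt.fun_mul)
    refine (mul_eq_zero.mp ?_).resolve_left (hm x hx)
    linear_combination 3 * hd
  have h5 : ∀ x ∈ I, 27702 * W x ^ 9 - 231174 * W x ^ 7 * s x - 89316 * W x ^ 7 - 6075 * W x ^ 6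
      * r x - 31752 * W x ^ 6 + 649944 * W x ^ 5 * s x ^ 2 + 490482 * W x ^ 5 * s x + 74142 * W x ^
      5 - 52947 * W x ^ 4 * s x * r x + 152748 * W x ^ 4 * s x + 1665 * W x ^ 4 * r x + 51288 * W x
      ^ 4 - 316872 * W x ^ 3 * s x ^ 3 - 675000 * W x ^ 3 * s x ^ 2 - 184968 * W x ^ 3 * s x - 7101
      * W x ^ 3 * r x ^ 2 + 1770 * W x ^ 3 * r x + 5136 * W x ^ 3 + 268488 * W x ^ 2 * s x ^ 2 * r x
      - 140256 * W x ^ 2 * s x ^ 2 + 140508 * W x ^ 2 * s x * r x - 83016 * W x ^ 2 * s x + 9288 * W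
      x ^ 2 * r x - 2128 * W x ^ 2 - 559872 * W x * s x ^ 4 - 346680 * W x * s x ^ 3 - 4968 * W x *
      s x ^ 2 + 11808 * W x * s x * r x ^ 2 + 40644 * W x * s x * r x - 3936 * W x * s x + 3090 * W
      x * r x ^ 2 + 3872 * W x * r x - 256 * W x - 10908 * s x ^ 3 * r x - 55728 * s x ^ 3 - 46260 *
      s x ^ 2 * r x - 10416 * s x ^ 2 - 6168 * s x * r x + 256 * s x - 594 * r x ^ 3 + 116 * r x ^ 2
      + 80 * r x = 0 := by
    intro x hx
    have hd := deriv_zero_of_eqOn hI h4 hx (by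
      with_reducible repeat' first
        | exact hW x hx | exact hs x hx | exact hr x hx | exact hasDerivAt_const _ _
        | apply HasDerivAt.fun_pow | apply HasDerivAt.fun_add | apply HasDerivAt.fun_sub
        | apply HasDerivAt.fun_neg | apply HasDerivAt.fun_mul)
    refine (mul_eq_zero.mp ?_).resolve_left (hm x hx)
    linear_combination 1 * hd
  have h6 : ∀ x ∈ I, -109350 * W x ^ 10 - 843210 * W x ^ 8 * s x + 212220 * W x ^ 8 - 468585 * W
      x ^ 7 * r x + 104760 * W x ^ 7 + 8648856 * W x ^ 6 * s x ^ 2 + 4793094 * W x ^ 6 * s x +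
      117234 * W x ^ 6 + 2931471 * W x ^ 5 * s x * r x + 1529820 * W x ^ 5 * s x + 1022787 * W x ^ 5
      * r x - 3384 * W x ^ 5 - 23656536 * W x ^ 4 * s x ^ 3 - 21195432 * W x ^ 4 * s x ^ 2 - 5755104
      * W x ^ 4 * s x - 42417 * W x ^ 4 * r x ^ 2 + 322038 * W x ^ 4 * r x - 298440 * W x ^ 4 -
      4557384 * W x ^ 3 * s x ^ 2 * r x - 6667920 * W x ^ 3 * s x ^ 2 - 3755916 * W x ^ 3 * s x * r
      x - 3756384 * W x ^ 3 * s x - 398232 * W x ^ 3 * r x - 227616 * W x ^ 3 + 19533312 * W x ^ 2 *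
      s x ^ 4 + 23604696 * W x ^ 2 * s x ^ 3 + 6684984 * W x ^ 2 * s x ^ 2 + 587250 * W x ^ 2 * s x
      * r x ^ 2 - 969912 * W x ^ 2 * s x * r x - 262944 * W x ^ 2 * s x + 175428 * W x ^ 2 * r x ^ 2
      - 175752 * W x ^ 2 * r x - 48864 * W x ^ 2 - 5232276 * W x * s x ^ 3 * r x + 2817072 * W x * s
      x ^ 3 - 1748844 * W x * s x ^ 2 * r x + 2164032 * W x * s x ^ 2 + 8280 * W x * s x * r x +
      144480 * W x * s x + 17154 * W x * r x ^ 3 + 61332 * W x * r x ^ 2 - 6960 * W x * r x - 960 *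
      W x + 3359232 * s x ^ 5 + 1949184 * s x ^ 4 - 525312 * s x ^ 3 - 103572 * s x ^ 2 * r x ^ 2 -
      411048 * s x ^ 2 * r x - 50400 * s x ^ 2 - 132444 * s x * r x ^ 2 - 41280 * s x * r x + 2496 *
      s x - 6168 * r x ^ 2 + 256 * r x = 0 := by
    intro x hx
    have hd := deriv_zero_of_eqOn hI h5 hx (by
      with_reducible repeat' first
        | exact hW x hx | exact hs x hx | exact hr x hx | exact hasDerivAt_const _ _
        | apply HasDerivAt.fun_pow | apply HasDerivAt.fun_add | apply HasDerivAt.fun_sub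
        | apply HasDerivAt.fun_neg | apply HasDerivAt.fun_mul)
    refine (mul_eq_zero.mp ?_).resolve_left (hm x hx)
    linear_combination 3 * hd
  have h7 : ∀ x ∈ I, -2811510 * W x ^ 11 + 27085266 * W x ^ 9 * s x + 10822572 * W x ^ 9 -
      321489 * W x ^ 8 * r x + 3806568 * W x ^ 8 - 83626020 * W x ^ 7 * s x ^ 2 - 78979698 * W x ^ 7
      * s x - 12617262 * W x ^ 7 + 11596689 * W x ^ 6 * s x * r x - 25936092 * W x ^ 6 * s x +
      3528387 * W x ^ 6 * r x - 8366040 * W x ^ 6 + 61447896 * W x ^ 5 * s x ^ 3 + 119142252 * W x ^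
      5 * s x ^ 2 + 56582172 * W x ^ 5 * s x + 1370763 * W x ^ 5 * r x ^ 2 + 1263222 * W x ^ 5 * r x
      + 2652408 * W x ^ 5 - 45521190 * W x ^ 4 * s x ^ 2 * r x + 38775672 * W x ^ 4 * s x ^ 2 -
      30974346 * W x ^ 4 * s x * r x + 35418888 * W x ^ 4 * s x - 5102712 * W x ^ 4 * r x + 3351984
      * W x ^ 4 + 95773104 * W x ^ 3 * s x ^ 4 + 83014632 * W x ^ 3 * s x ^ 3 + 21666312 * W x ^ 3 *
      s x ^ 2 - 5665464 * W x ^ 3 * s x * r x ^ 2 - 10281816 * W x ^ 3 * s x * r x + 5200848 * W x ^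
      3 * s x - 2117448 * W x ^ 3 * r x ^ 2 - 3706440 * W x ^ 3 * r x + 772608 * W x ^ 3 + 92500380
      * W x ^ 2 * s x ^ 3 * r x + 48966768 * W x ^ 2 * s x ^ 3 + 64832508 * W x ^ 2 * s x ^ 2 * r x
      + 21603744 * W x ^ 2 * s x ^ 2 + 11021544 * W x ^ 2 * s x * r x + 750336 * W x ^ 2 * s x +
      144288 * W x ^ 2 * r x ^ 3 - 651816 * W x ^ 2 * r x ^ 2 - 447984 * W x ^ 2 * r x + 25280 * W x
      ^ 2 - 111725568 * W x * s x ^ 5 - 130941360 * W x * s x ^ 4 - 30583440 * W x * s x ^ 3 -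
      6959844 * W x * s x ^ 2 * r x ^ 2 + 9580536 * W x * s x ^ 2 * r x + 2930688 * W x * s x ^ 2 -
      1131984 * W x * s x * r x ^ 2 + 3819744 * W x * s x * r x + 327744 * W x * s x + 15096 * W x *
      r x ^ 2 + 97248 * W x * r x - 1024 * W x + 16063272 * s x ^ 4 * r x - 5634144 * s x ^ 4 +
      5268024 * s x ^ 3 * r x - 5972256 * s x ^ 3 - 1601424 * s x ^ 2 * r x - 454080 * s x ^ 2 -
      103356 * s x * r x ^ 3 - 396696 * s x * r x ^ 2 - 69024 * s x * r x + 2944 * s x - 44148 * r x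
      ^ 3 - 13760 * r x ^ 2 + 832 * r x = 0 := by
    intro x hx
    have hd := deriv_zero_of_eqOn hI h6 hx (by
      with_reducible repeat' first
        | exact hW x hx | exact hs x hx | exact hr x hx | exact hasDerivAt_const _ _
        | apply HasDerivAt.fun_pow | apply HasDerivAt.fun_add | apply HasDerivAt.fun_sub
        | apply HasDerivAt.fun_neg | apply HasDerivAt.fun_mul)
    refine (mul_eq_zero.mp ?_).resolve_left (hm x hx)
    linear_combination 1 * hd
  intro x hx
  have h := mul_add_one_pow_three_eq_zero (h1 x hx) (h2 x hx) (h3 x hx) (h4 x hx) (h5 x hx) (h6 x hx) (h7 x hx)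
  rcases mul_eq_zero.mp h with h | h
  · exact .inl h
  · exact .inr (by linarith [pow_eq_zero_iff (three_ne_zero) |>.mp h])

/-- The overdetermined system for the coefficients of `ξ = 3 m u + b`,
`η = -3 m² u³ + (3 m' - 3 m b) u² + c u + d` has only the solutions with constant `m` and with
`m' = -m²`. -/
theorem quasilinear_system {I : Set ℝ} (hI : IsOpen I) (hI' : IsConnected I) {m b c d : ℝ → ℝ}
    (hm : ContDiffOn ℝ ∞ m I) (hm0 : ∀ x ∈ I, m x ≠ 0)
    (e2 : ∀ x ∈ I, 36 * m x * deriv m x - 18 * m x ^ 2 * b x - 18 * m x ^ 3 = 0)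
    (e1 : ∀ x ∈ I, 6 * m x * c x - 9 * deriv (deriv m) x
      + 6 * (deriv m x * b x + m x * deriv b x) = 0)
    (e0 : ∀ x ∈ I, 6 * m x * d x - 2 * deriv c x + deriv (deriv b) x - 2 * b x * deriv b x = 0)
    (f1 : ∀ x ∈ I, -deriv (deriv c) x + 6 * deriv m x * d x + 2 * deriv b x * c x
      - 4 * m x ^ 2 * d x = 0)
    (f0 : ∀ x ∈ I, -deriv (deriv d) x + 2 * deriv b x * d x = 0) :
    (∀ x ∈ I, deriv m x = 0 ∧ b x = -m x ∧ c x = 0 ∧ d x = 0) ∨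
    (∀ x ∈ I, deriv m x = -m x ^ 2 ∧ b x = -3 * m x ∧ c x = -3 * m x ^ 2 ∧ d x = 0) := by
  -- Under scaling of `x`, `m` behaves like `1/x`, so `W = m'/m²` is invariant, and so are the
  -- quantities obtained from it by the invariant derivative `m⁻¹ d/dx`. Passing to them separates
  -- the powers of `m`. The functions `s` and `r` are normalised versions of the first two
  -- derivatives of `W`, chosen so that `c` and `d` below become `m²` times simple polynomials.
  obtain ⟨W, hWdef⟩ : ∃ W : ℝ → ℝ, W = fun x => deriv m x / m x ^ 2 := ⟨_, rfl⟩
  have hWs : ContDiffOn ℝ ∞ W I := hWdef ▸ (smooth_deriv hI hm).div (hm.pow 2)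
    fun x hx => pow_ne_zero 2 (hm0 x hx)
  obtain ⟨s, hsdef⟩ : ∃ s : ℝ → ℝ, s = fun x => -(deriv W x) / (2 * m x) := ⟨_, rfl⟩
  have hss : ContDiffOn ℝ ∞ s I := hsdef ▸ (smooth_deriv hI hWs).neg.div (contDiffOn_const.mul hm)
    fun x hx => mul_ne_zero two_ne_zero (hm0 x hx)
  obtain ⟨r, hrdef⟩ : ∃ r : ℝ → ℝ, r = fun x => 3 * (deriv s x / m x + 2 * W x * s x) := ⟨_, rfl⟩
  have hrs : ContDiffOn ℝ ∞ r I := hrdef ▸ contDiffOn_const.mul (((smooth_deriv hI hss).div hm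
    hm0).add ((contDiffOn_const.mul hWs).mul hss))
  have hm1 : ∀ x ∈ I, HasDerivAt m (m x ^ 2 * W x) x := fun x hx =>
    (smooth_hasDerivAt hI hm hx).congr_deriv (by have := hm0 x hx; rw [hWdef]; field_simp)
  have hW : ∀ x ∈ I, HasDerivAt W (m x * (-2 * s x)) x := fun x hx =>
    (smooth_hasDerivAt hI hWs hx).congr_deriv (by have := hm0 x hx; rw [hsdef]; field_simp)
  have hs : ∀ x ∈ I, HasDerivAt s (m x * (-2 * W x * s x + r x / 3)) x := fun x hx =>
    (smooth_hasDerivAt hI hss hx).congr_deriv (by have := hm0 x hx; rw [hrdef]; field_simp; ring)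
  have hr' : ∀ x ∈ I, HasDerivAt r (deriv r x) x := fun x hx => smooth_hasDerivAt hI hrs hx
  have hm2 : ∀ x ∈ I, deriv (deriv m) x = m x ^ 3 * (2 * W x ^ 2 - 2 * s x) := fun x hx => by
    rw [deriv_eq_of_eqOn hI (fun y hy => (hm1 y hy).deriv) hx]
    have := ((hm1 x hx).fun_pow 2).fun_mul (hW x hx)
    rw [this.deriv]; push_cast; ring
  -- The equations `e2`, `e1`, `e0` are solved successively for `b`, `c`, `d`; each is linear in its
  -- unknown, with a nonzero multiple of a power of `m` as coefficient.
  have hb : ∀ x ∈ I, b x = m x * (2 * W x - 1) := fun x hx => by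
    have h := e2 x hx
    rw [(hm1 x hx).deriv] at h
    refine mul_left_cancel₀ (pow_ne_zero 2 (hm0 x hx)) ?_
    linear_combination -h / 18
  have hb1 : ∀ x ∈ I, deriv b x = m x ^ 2 * (2 * W x ^ 2 - W x - 4 * s x) := fun x hx => by
    rw [deriv_eq_of_eqOn hI hb hx]
    have := (hm1 x hx).fun_mul (((hW x hx).const_mul 2).sub_const 1)
    rw [this.deriv]; ring
  have hb2 : ∀ x ∈ I, deriv (deriv b) x = m x ^ 3 * (4 * W x ^ 3 - 2 * W x ^ 2 - 8 * W x * s x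
      + 2 * s x - 4 / 3 * r x) := fun x hx => by
    rw [deriv_eq_of_eqOn hI hb1 hx]
    have := ((hm1 x hx).fun_pow 2).fun_mul
      (((((hW x hx).fun_pow 2).const_mul 2).fun_sub (hW x hx)).fun_sub ((hs x hx).const_mul 4))
    rw [this.deriv]; push_cast; ring
  have hc : ∀ x ∈ I, c x = m x ^ 2 * (s x - W x ^ 2 + 2 * W x) := fun x hx => by
    have h := e1 x hx
    rw [hm2 x hx, (hm1 x hx).deriv, hb1 x hx, hb x hx] at h
    refine mul_left_cancel₀ (hm0 x hx) ?_
    linear_combination h / 6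
  have hc1 : ∀ x ∈ I, deriv c x = m x ^ 3 * (4 * W x * s x - 2 * W x ^ 3 + 4 * W x ^ 2 + r x / 3
      - 4 * s x) := fun x hx => by
    rw [deriv_eq_of_eqOn hI hc hx]
    have := ((hm1 x hx).fun_pow 2).fun_mul
      (((hs x hx).fun_sub ((hW x hx).fun_pow 2)).fun_add ((hW x hx).const_mul 2))
    rw [this.deriv]; push_cast; ring
  have hd : ∀ x ∈ I, d x = m x ^ 2 * (r x - s x + W x ^ 2 + W x) / 3 := fun x hx => by
    have h := e0 x hx
    rw [hc1 x hx, hb2 x hx, hb1 x hx, hb x hx] at h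
    refine mul_left_cancel₀ (hm0 x hx) ?_
    linear_combination h / 6
  -- The equation `f1` contains `r'` through `c''` and closes the system for `W`, `s`, `r`.
  have hr : ∀ x ∈ I, HasDerivAt r (m x * (6 * W x ^ 4 - 12 * W x ^ 2 * s x - 10 * W x ^ 2
      - W x * r x - 4 * W x + 4 * s x)) x := fun x hx => by
    refine (hr' x hx).congr_deriv ?_
    have h := f1 x hx
    have hc2 := (deriv_eq_of_eqOn hI hc1 hx).trans (((hm1 x hx).fun_pow 3).fun_mul ((((((hW x hx).const_mul 4).fun_mul (hs x hx)).fun_sub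
        (((hW x hx).fun_pow 3).const_mul 2)).fun_add (((hW x hx).fun_pow 2).const_mul 4)).fun_add
        ((hr' x hx).div_const 3) |>.fun_sub ((hs x hx).const_mul 4))).deriv
    rw [hc2, (hm1 x hx).deriv, hb1 x hx, hc x hx, hd x hx] at h
    refine mul_left_cancel₀ (pow_ne_zero 3 (hm0 x hx)) ?_
    push_cast at h
    linear_combination -3 * h
  have hd1 : ∀ x ∈ I, deriv d x = m x ^ 3 * (6 * W x ^ 4 - 12 * W x ^ 2 * s x - 8 * W x ^ 2
      + W x * r x - 4 * W x + 2 * s x + 2 * W x ^ 3 - 4 * W x * s x - r x / 3) / 3 := fun x hx => by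
    rw [deriv_eq_of_eqOn hI hd hx]
    have := (((hm1 x hx).fun_pow 2).fun_mul ((((hr x hx).fun_sub (hs x hx)).fun_add
      ((hW x hx).fun_pow 2)).fun_add (hW x hx))).div_const 3
    rw [this.deriv]; push_cast; ring
  -- After substitution of the flow, `f0` has no derivatives left: it is the algebraic surface to
  -- which the trajectory is confined.
  have h1 : ∀ x ∈ I, 36 * W x ^ 5 - 108 * W x ^ 3 * s x - 54 * W x ^ 3 - 9 * W x ^ 2 * r x
      - 16 * W x ^ 2 + 72 * W x * s x ^ 2 + 66 * W x * s x + 2 * W x + 9 * s x * r x + 10 * s x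
      + r x = 0 := fun x hx => by
    have h := f0 x hx
    have hd2 := (deriv_eq_of_eqOn hI hd1 hx).trans (HasDerivAt.deriv (by
      with_reducible repeat' first
        | exact hm1 x hx | exact hW x hx | exact hs x hx | exact hr x hx
        | exact hasDerivAt_const _ _ | apply HasDerivAt.div_const
        | apply HasDerivAt.fun_pow | apply HasDerivAt.fun_add | apply HasDerivAt.fun_sub
        | apply HasDerivAt.fun_mul))
    rw [hd2, hb1 x hx, hd x hx] at h
    refine mul_left_cancel₀ (pow_ne_zero 4 (hm0 x hx)) ?_
    push_cast at h
    linear_combination (-9 / 2) * h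
  have hW01 := eq_zero_or_neg_one_of_flow hI hm0 hW hs hr h1
  -- Differentiating `W² + W = 0` gives `(2W + 1) W' = 0`, where `2W + 1 = ±1`. So `W' = 0`, that is
  -- `s = 0`, and `W` cannot jump between its two values.
  have hs0 : ∀ x ∈ I, s x = 0 := fun x hx => by
    have h := deriv_zero_of_eqOn hI (f := fun y => W y ^ 2 + W y)
      (fun y hy => by rcases hW01 y hy with h | h <;> rw [h] <;> norm_num) hx
      (((hW x hx).fun_pow 2).fun_add (hW x hx))
    refine (mul_eq_zero.mp (?_ : m x * s x = 0)).resolve_left (hm0 x hx)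
    push_cast at h
    rcases hW01 x hx with h' | h' <;> rw [h'] at h
    · linear_combination -h / 2
    · linear_combination h / 2
  have hr0 : ∀ x ∈ I, r x = 0 := fun x hx => by
    have h := deriv_zero_of_eqOn hI hs0 hx (hs x hx)
    have h' := (mul_eq_zero.mp h).resolve_left (hm0 x hx)
    rw [hs0 x hx] at h'
    linarith
  obtain ⟨x₀, hx₀⟩ := hI'.nonempty
  have hWc : ∀ x ∈ I, W x = W x₀ := fun x hx => eq_of_deriv_zero hI hI'
    (fun y hy => by simpa [hs0 y hy] using hW y hy) hx hx₀
  refine (hW01 x₀ hx₀).imp (fun h x hx => ?_) (fun h x hx => ?_) <;>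
  · rw [(hm1 x hx).deriv, hb x hx, hc x hx, hd x hx, hr0 x hx, hs0 x hx, hWc x hx, h]
    refine ⟨?_, ?_, ?_, ?_⟩ <;> ring

/-! ### Splitting the determining equations in powers of `u`. -/

/-- Pointwise existence of `p` and `q` says nothing about their regularity in `(t, x)`.
Interpolation at two nodes `u₀`, `u₁` independent of `(t, x)` expresses them through values of `F`,
so that they inherit its smoothness. -/
theorem exists_affine_coeffs {T I U : Set ℝ} (hU : IsOpen U) (hU' : IsConnected U) {F : Fun3}
    (h : ∀ t ∈ T, ∀ x ∈ I, ∃ p q, ∀ u ∈ U, F t x u = p * u + q) :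
    ∃ u₀ ∈ U, ∃ u₁ ∈ U, ∀ t ∈ T, ∀ x ∈ I, ∀ u ∈ U,
      F t x u = (F t x u₁ - F t x u₀) / (u₁ - u₀) * u
        + (F t x u₀ - (F t x u₁ - F t x u₀) / (u₁ - u₀) * u₀) := by
  obtain ⟨u₀, hu₀⟩ := hU'.nonempty
  obtain ⟨u₁, hu₁, hne⟩ := (infinite_of_mem_nhds u₀ (hU.mem_nhds hu₀)).exists_notMem_finset {u₀}
  refine ⟨u₀, hu₀, u₁, hu₁, fun t ht x hx u hu => ?_⟩
  obtain ⟨p, q, hpq⟩ := h t ht x hx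
  have : u₁ - u₀ ≠ 0 := sub_ne_zero.mpr (by simpa using hne)
  rw [hpq u hu, hpq u₁ hu₁, hpq u₀ hu₀]
  field_simp
  ring

/-- Along a determining operator `ξ` is affine and `η` is cubic in `u`; the coefficients satisfy
the equations obtained by splitting the terms linear in `u_x`. -/
theorem coefficient_equations {T I U : Set ℝ} (hT : IsOpen T) (hI : IsOpen I) (hU : IsOpen U)
    (hU' : IsConnected U) {k : ℝ → ℝ} {ξ η : Fun3}
    (hs : (Operator.unitTime ξ η).SmoothOn T I U)
    (h : ∀ t ∈ T, ∀ x ∈ I, ∀ u ∈ U, Determining k ξ η t x u) :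
    ∃ a b c d : ℝ → ℝ → ℝ,
      (∀ t ∈ T, ContDiffOn ℝ ∞ (a t) I ∧ ContDiffOn ℝ ∞ (b t) I ∧ ContDiffOn ℝ ∞ (c t) I ∧
        ContDiffOn ℝ ∞ (d t) I) ∧
      (∀ x ∈ I, ContDiffOn ℝ ∞ (fun t => a t x) T ∧ ContDiffOn ℝ ∞ (fun t => b t x) T) ∧
      (∀ t ∈ T, ∀ x ∈ I, ∀ u ∈ U, ξ t x u = a t x * u + b t x ∧
        η t x u = -(a t x ^ 2 / 3) * u ^ 3 + (deriv (a t) x - a t x * b t x) * u ^ 2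
          + c t x * u + d t x) ∧
      ∀ t ∈ T, ∀ x ∈ I,
        -(2 / 3) * a t x ^ 3 + 3 * a t x * k x = 0 ∧
        4 * a t x * deriv (a t) x - 2 * a t x ^ 2 * b t x - 3 * a t x * k x = 0 ∧
        -deriv (fun s => a s x) t + 2 * a t x * c t x - 3 * deriv (deriv (a t)) x
          + 2 * (deriv (a t) x * b t x + a t x * deriv (b t) x) = 0 ∧
        -deriv (fun s => b s x) t + 2 * a t x * d t x - 2 * deriv (c t) x
          + deriv (deriv (b t)) x - 2 * b t x * deriv (b t) x = 0 := by
  obtain ⟨-, hξs, hηs⟩ := hs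
  obtain ⟨u₀, hu₀, u₁, hu₁, hξ⟩ := exists_affine_coeffs (T := T) (I := I) hU hU' (F := ξ)
    fun t ht x hx => affine_of_deriv_deriv_zero hU hU' (slice_u hξs ht hx)
      fun u hu => (h t ht x hx u hu).1
  obtain ⟨a, ha⟩ : ∃ a : ℝ → ℝ → ℝ, a = fun t x => (ξ t x u₁ - ξ t x u₀) / (u₁ - u₀) := ⟨_, rfl⟩
  obtain ⟨b, hb⟩ : ∃ b : ℝ → ℝ → ℝ, b = fun t x => ξ t x u₀ - a t x * u₀ := ⟨_, rfl⟩
  replace hξ : ∀ t ∈ T, ∀ x ∈ I, ∀ u ∈ U, ξ t x u = a t x * u + b t x := by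
    rw [hb, ha]; exact hξ
  have hax : ∀ t ∈ T, ContDiffOn ℝ ∞ (a t) I := fun t ht => by
    rw [ha]; exact ((slice_x hξs ht hu₁).sub (slice_x hξs ht hu₀)).div_const _
  have hat : ∀ x ∈ I, ContDiffOn ℝ ∞ (fun t => a t x) T := fun x hx => by
    rw [ha]; exact ((slice_t hξs hx hu₁).sub (slice_t hξs hx hu₀)).div_const _
  have hbx : ∀ t ∈ T, ContDiffOn ℝ ∞ (b t) I := fun t ht => by
    rw [hb]; exact (slice_x hξs ht hu₀).sub ((hax t ht).mul contDiffOn_const)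
  have hbt : ∀ x ∈ I, ContDiffOn ℝ ∞ (fun t => b t x) T := fun x hx => by
    rw [hb]; exact (slice_t hξs hx hu₀).sub ((hat x hx).mul contDiffOn_const)
  have hξu : ∀ t ∈ T, ∀ x ∈ I, ∀ u ∈ U, pdu ξ t x u = a t x := fun t ht x hx u hu =>
    (hasDerivAt_of_eqOn hU (hξ t ht x hx) hu
      (((hasDerivAt_id u).const_mul (a t x)).add_const (b t x))).deriv.trans (mul_one _)
  have hξux : ∀ t ∈ T, ∀ x ∈ I, ∀ u ∈ U, pdx (pdu ξ) t x u = deriv (a t) x :=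
    fun t ht x hx u hu => deriv_eq_of_eqOn hI (fun y hy => hξu t ht y hy u hu) hx
  have hξx : ∀ t ∈ T, ∀ x ∈ I, ∀ u ∈ U, pdx ξ t x u = deriv (a t) x * u + deriv (b t) x :=
    fun t ht x hx u hu => (hasDerivAt_of_eqOn hI (fun y hy => hξ t ht y hy u hu) hx
      (((smooth_hasDerivAt hI (hax t ht) hx).mul_const u).add
        (smooth_hasDerivAt hI (hbx t ht) hx))).deriv
  have hξxx : ∀ t ∈ T, ∀ x ∈ I, ∀ u ∈ U,
      pdx (pdx ξ) t x u = deriv (deriv (a t)) x * u + deriv (deriv (b t)) x :=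
    fun t ht x hx u hu => (hasDerivAt_of_eqOn hI (fun y hy => hξx t ht y hy u hu) hx
      (((smooth_hasDerivAt hI (smooth_deriv hI (hax t ht)) hx).mul_const u).add
        (smooth_hasDerivAt hI (smooth_deriv hI (hbx t ht)) hx))).deriv
  have hξt : ∀ t ∈ T, ∀ x ∈ I, ∀ u ∈ U,
      pdt ξ t x u = deriv (fun s => a s x) t * u + deriv (fun s => b s x) t :=
    fun t ht x hx u hu => (hasDerivAt_of_eqOn hT (fun s hs => hξ s hs x hx u hu) ht
      (((smooth_hasDerivAt hT (hat x hx) ht).mul_const u).add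
        (smooth_hasDerivAt hT (hbt x hx) ht))).deriv
  -- The subtracted cubic is a particular solution of the second determining equation, `η_uu = 2 a_x
  -- - 2 (a u + b) a`. Hence `G_uu = 0` and `G` is affine in `u`.
  obtain ⟨G, hG⟩ : ∃ G : Fun3, G = fun t x u => η t x u
      - (-(a t x ^ 2 / 3) * u ^ 3 + (deriv (a t) x - a t x * b t x) * u ^ 2) := ⟨_, rfl⟩
  have hGx : ∀ t ∈ T, ∀ u ∈ U, ContDiffOn ℝ ∞ (fun x => G t x u) I := fun t ht u hu => by
    rw [hG]
    exact (slice_x hηs ht hu).sub (((((hax t ht).pow 2).div_const 3).neg.mul contDiffOn_const).add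
      (((smooth_deriv hI (hax t ht)).sub ((hax t ht).mul (hbx t ht))).mul contDiffOn_const))
  obtain ⟨v₀, hv₀, v₁, hv₁, hGaff⟩ := exists_affine_coeffs (T := T) (I := I) hU hU' (F := G)
    fun t ht x hx => by
      have hcub : ∀ v : ℝ, HasDerivAt
          (fun u => -(a t x ^ 2 / 3) * u ^ 3 + (deriv (a t) x - a t x * b t x) * u ^ 2)
          (-(a t x ^ 2) * v ^ 2 + 2 * (deriv (a t) x - a t x * b t x) * v) v := fun v => by
        refine ((((hasDerivAt_id v).fun_pow 3).const_mul _).add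
          (((hasDerivAt_id v).fun_pow 2).const_mul _)).congr_deriv ?_
        simp; ring
      have hcub' : ∀ v : ℝ, HasDerivAt
          (fun v => -(a t x ^ 2) * v ^ 2 + 2 * (deriv (a t) x - a t x * b t x) * v)
          (-2 * a t x ^ 2 * v + 2 * (deriv (a t) x - a t x * b t x)) v := fun v => by
        refine ((((hasDerivAt_id v).fun_pow 2).const_mul _).add
          ((hasDerivAt_id v).const_mul _)).congr_deriv ?_
        simp; ring
      have hηu := slice_u hηs ht hx
      refine affine_of_deriv_deriv_zero hU hU' ?_ fun u hu => ?_
      · rw [hG]; exact hηu.sub (ContDiff.contDiffOn (by fun_prop))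
      · have h1 : ∀ v ∈ U, deriv (G t x) v = pdu η t x v
            - (-(a t x ^ 2) * v ^ 2 + 2 * (deriv (a t) x - a t x * b t x) * v) := fun v hv => by
          rw [hG]; exact ((smooth_hasDerivAt hU hηu hv).sub (hcub v)).deriv
        rw [deriv_eq_of_eqOn hU h1 hu]
        refine (((smooth_hasDerivAt hU (smooth_deriv hU hηu) hu).sub (hcub' u)).congr_deriv
          ?_).deriv
        have h2 := (h t ht x hx u hu).2.1
        rw [hξux t ht x hx u hu, hξ t ht x hx u hu, hξu t ht x hx u hu] at h2
        have h3 : deriv (deriv fun u => (Operator.unitTime ξ η).η t x u) u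
          = pdu (pdu η) t x u := rfl
        rw [h3]
        linear_combination h2
  obtain ⟨c, hc⟩ : ∃ c : ℝ → ℝ → ℝ, c = fun t x => (G t x v₁ - G t x v₀) / (v₁ - v₀) := ⟨_, rfl⟩
  obtain ⟨d, hd⟩ : ∃ d : ℝ → ℝ → ℝ, d = fun t x => G t x v₀ - c t x * v₀ := ⟨_, rfl⟩
  have hη : ∀ t ∈ T, ∀ x ∈ I, ∀ u ∈ U, η t x u = -(a t x ^ 2 / 3) * u ^ 3
      + (deriv (a t) x - a t x * b t x) * u ^ 2 + c t x * u + d t x := fun t ht x hx u hu => by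
    have h1 : G t x u = c t x * u + d t x := by rw [hd, hc]; exact hGaff t ht x hx u hu
    have h2 : G t x u = η t x u
      - (-(a t x ^ 2 / 3) * u ^ 3 + (deriv (a t) x - a t x * b t x) * u ^ 2) := by rw [hG]
    linear_combination h1 - h2
  have hcx : ∀ t ∈ T, ContDiffOn ℝ ∞ (c t) I := fun t ht => by
    rw [hc]; exact ((hGx t ht v₁ hv₁).sub (hGx t ht v₀ hv₀)).div_const _
  have hdx : ∀ t ∈ T, ContDiffOn ℝ ∞ (d t) I := fun t ht => by
    rw [hd]; exact (hGx t ht v₀ hv₀).sub ((hcx t ht).mul contDiffOn_const)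
  refine ⟨a, b, c, d, fun t ht => ⟨hax t ht, hbx t ht, hcx t ht, hdx t ht⟩,
    fun x hx => ⟨hat x hx, hbt x hx⟩, fun t ht x hx u hu => ⟨hξ t ht x hx u hu, hη t ht x hx u hu⟩,
    fun t ht x hx => ?_⟩
  have hηu : ∀ y ∈ I, ∀ u ∈ U, pdu η t y u = -(a t y ^ 2) * u ^ 2
      + 2 * (deriv (a t) y - a t y * b t y) * u + c t y := fun y hy u hu => by
    refine (hasDerivAt_of_eqOn hU (hη t ht y hy) hu ((((((hasDerivAt_id u).fun_pow 3).const_mul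
      _).add (((hasDerivAt_id u).fun_pow 2).const_mul _)).add
      ((hasDerivAt_id u).const_mul _)).add_const _)).deriv.trans ?_
    simp; ring
  have hηux : ∀ u ∈ U, pdx (pdu η) t x u = -(2 * a t x * deriv (a t) x) * u ^ 2
      + 2 * (deriv (deriv (a t)) x - (deriv (a t) x * b t x + a t x * deriv (b t) x)) * u
      + deriv (c t) x := fun u hu => by
    have h1 := smooth_hasDerivAt hI (hax t ht) hx
    have h2 := smooth_hasDerivAt hI (smooth_deriv hI (hax t ht)) hx
    have h3 := smooth_hasDerivAt hI (hbx t ht) hx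
    have h4 := smooth_hasDerivAt hI (hcx t ht) hx
    refine (hasDerivAt_of_eqOn hI (fun y hy => hηu y hy u hu) hx ((((h1.fun_pow 2).neg.mul_const
      _).add (((h2.sub (h1.fun_mul h3)).const_mul 2).mul_const u)).add h4)).deriv.trans ?_
    simp
  -- The third determining equation is now a cubic polynomial in `u`.
  have key : ∀ u ∈ U,
      (-deriv (fun s => b s x) t + 2 * a t x * d t x - 2 * deriv (c t) x
          + deriv (deriv (b t)) x - 2 * b t x * deriv (b t) x)
        + (-deriv (fun s => a s x) t + 2 * a t x * c t x - 3 * deriv (deriv (a t)) x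
          + 2 * (deriv (a t) x * b t x + a t x * deriv (b t) x)) * u
        + (4 * a t x * deriv (a t) x - 2 * a t x ^ 2 * b t x - 3 * a t x * k x) * u ^ 2
        + (-(2 / 3) * a t x ^ 3 + 3 * a t x * k x) * u ^ 3 + 0 * u ^ 4 + 0 * u ^ 5 = 0 :=
    fun u hu => by
      have h1 := (h t ht x hx u hu).2.2.1
      rw [hξu t ht x hx u hu, hξx t ht x hx u hu, hξxx t ht x hx u hu, hξt t ht x hx u hu,
        hηux u hu, hξ t ht x hx u hu, hη t ht x hx u hu] at h1
      linear_combination h1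
  obtain ⟨e0, e1, e2, e3, -, -⟩ := coeffs_zero hU hU'.nonempty key
  exact ⟨e3, e2, e1, e0⟩

/-- The equations obtained by splitting the terms of order zero in `u_x`. -/
theorem zeroth_order_equations {I U : Set ℝ} (hI : IsOpen I) (hU : IsOpen U)
    (hU' : IsConnected U) {k : ℝ → ℝ} {ξ η : Fun3} {t : ℝ} {a b A B c d ct dt : ℝ → ℝ}
    (h : ∀ x ∈ I, ∀ u ∈ U, Determining k ξ η t x u)
    (ha : ContDiffOn ℝ ∞ a I) (hb : ContDiffOn ℝ ∞ b I) (hA : ContDiffOn ℝ ∞ A I)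
    (hB : ContDiffOn ℝ ∞ B I) (hc : ContDiffOn ℝ ∞ c I) (hd : ContDiffOn ℝ ∞ d I)
    (hξ : ∀ x ∈ I, ∀ u ∈ U, ξ t x u = a x * u + b x)
    (hη : ∀ x ∈ I, ∀ u ∈ U, η t x u = A x * u ^ 3 + B x * u ^ 2 + c x * u + d x)
    (hηt : ∀ x ∈ I, ∀ u ∈ U, pdt η t x u = ct x * u + dt x) {x : ℝ} (hx : x ∈ I) :
    dt x - deriv (deriv d) x + 2 * deriv b x * d x = 0 ∧
    ct x - deriv (deriv c) x + 2 * deriv a x * d x + 2 * deriv b x * c x - 2 * k x * d x = 0 ∧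
    -deriv (deriv B) x + k x * c x + 2 * deriv a x * c x + 2 * deriv b x * B x
      - 2 * deriv b x * k x - b x * deriv k x - k x * (2 * c x - 3 * d x) = 0 ∧
    -deriv (deriv A) x + k x * (2 * B x - c x) + 2 * deriv a x * B x + 2 * deriv b x * A x
      - 2 * deriv a x * k x + 2 * deriv b x * k x - a x * deriv k x + b x * deriv k x
      - k x * (2 * B x - 3 * c x) = 0 := by
  have hξx : ∀ u ∈ U, pdx ξ t x u = deriv a x * u + deriv b x := fun u hu =>
    (hasDerivAt_of_eqOn hI (fun y hy => hξ y hy u hu) hx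
      (((smooth_hasDerivAt hI ha hx).mul_const u).add (smooth_hasDerivAt hI hb hx))).deriv
  have hηx : ∀ u ∈ U, ∀ y ∈ I, pdx η t y u = deriv A y * u ^ 3 + deriv B y * u ^ 2
      + deriv c y * u + deriv d y := fun u hu y hy =>
    (hasDerivAt_of_eqOn hI (fun z hz => hη z hz u hu) hy
      (((((smooth_hasDerivAt hI hA hy).mul_const _).add
      ((smooth_hasDerivAt hI hB hy).mul_const _)).add
      ((smooth_hasDerivAt hI hc hy).mul_const u)).add (smooth_hasDerivAt hI hd hy))).deriv
  have hηxx : ∀ u ∈ U, pdx (pdx η) t x u = deriv (deriv A) x * u ^ 3 + deriv (deriv B) x * u ^ 2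
      + deriv (deriv c) x * u + deriv (deriv d) x := fun u hu =>
    (hasDerivAt_of_eqOn hI (hηx u hu) hx
      (((((smooth_hasDerivAt hI (smooth_deriv hI hA) hx).mul_const _).add
      ((smooth_hasDerivAt hI (smooth_deriv hI hB) hx).mul_const _)).add
      ((smooth_hasDerivAt hI (smooth_deriv hI hc) hx).mul_const u)).add
      (smooth_hasDerivAt hI (smooth_deriv hI hd) hx))).deriv
  have hηu : ∀ u ∈ U, pdu η t x u = 3 * A x * u ^ 2 + 2 * B x * u + c x := fun u hu => by
    refine (hasDerivAt_of_eqOn hU (hη x hx) hu ((((((hasDerivAt_id u).fun_pow 3).const_mul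
      _).add (((hasDerivAt_id u).fun_pow 2).const_mul _)).add
      ((hasDerivAt_id u).const_mul _)).add_const _)).deriv.trans ?_
    simp; ring
  -- The two contributions `∓3 k A` to the coefficient of `u ^ 5` cancel. The coefficient of `u ^ 4`
  -- is discarded, as the four lower ones suffice.
  have key : ∀ u ∈ U,
      (dt x - deriv (deriv d) x + 2 * deriv b x * d x)
      + (ct x - deriv (deriv c) x + 2 * deriv a x * d x + 2 * deriv b x * c x
        - 2 * k x * d x) * u
      + (-deriv (deriv B) x + k x * c x + 2 * deriv a x * c x + 2 * deriv b x * B x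
        - 2 * deriv b x * k x - b x * deriv k x - k x * (2 * c x - 3 * d x)) * u ^ 2
      + (-deriv (deriv A) x + k x * (2 * B x - c x) + 2 * deriv a x * B x + 2 * deriv b x * A x
        - 2 * deriv a x * k x + 2 * deriv b x * k x - a x * deriv k x + b x * deriv k x
        - k x * (2 * B x - 3 * c x)) * u ^ 3
      + (k x * (3 * A x - 2 * B x) + 2 * deriv a x * A x + 2 * deriv a x * k x + a x * deriv k x
        - k x * (2 * A x - 3 * B x)) * u ^ 4 + 0 * u ^ 5 = 0 := fun u hu => by
    have h1 := (h x hx u hu).2.2.2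
    rw [hξx u hu, hηxx u hu, hηu u hu, hηt x hx u hu, hξ x hx u hu, hη x hx u hu] at h1
    linear_combination h1
  obtain ⟨e0, e1, e2, e3, -, -⟩ := coeffs_zero hU hU'.nonempty key
  exact ⟨e0, e1, e2, e3⟩

/-! ### The dichotomy for `ξ_u`, and the case where `ξ_u` does not vanish. -/

/-- Differentiation gives `(2f - 1) f' = 0`, and `f = 1/2` is not a root of `f² - f`, so `f' = 0`.
-/
theorem eq_of_idempotent {f : ℝ → ℝ} {S : Set ℝ} (hS : IsOpen S) (hS' : IsConnected S)
    (hf : ContDiffOn ℝ ∞ f S) (h : ∀ x ∈ S, f x ^ 2 - f x = 0) {x y : ℝ} (hx : x ∈ S)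
    (hy : y ∈ S) : f x = f y := by
  refine eq_of_deriv_zero hS hS' (fun z hz => ?_) hx hy
  have h1 := smooth_hasDerivAt hS hf hz
  refine h1.congr_deriv ?_
  have h2 := deriv_zero_of_eqOn hS h hz ((h1.fun_pow 2).fun_sub h1)
  push_cast at h2
  have h3 : (2 * f z - 1) * deriv f z = 0 := by linear_combination h2
  refine (mul_eq_zero.mp h3).resolve_left fun h4 => ?_
  have := h z hz
  rw [show f z = 1 / 2 by linarith] at this
  norm_num at this

/-- Pointwise either `a = 0` or `a² = 9k/2`, so the ratio `a² / (9k/2)` takes only the values 0 and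
1. It is smooth because `k` has no zeros, hence constant along lines, and any two points of `T × I`
are joined by moving first in `x` and then in `t`. -/
theorem quasilinear_dichotomy {T I : Set ℝ} (hT : IsOpen T) (hT' : IsConnected T)
    (hI : IsOpen I) (hI' : IsConnected I) {k : ℝ → ℝ} (hk : ContDiffOn ℝ ∞ k I)
    (hk0 : ∀ x ∈ I, k x ≠ 0) {a : ℝ → ℝ → ℝ} (hax : ∀ t ∈ T, ContDiffOn ℝ ∞ (a t) I)
    (hat : ∀ x ∈ I, ContDiffOn ℝ ∞ (fun t => a t x) T)
    (h : ∀ t ∈ T, ∀ x ∈ I, -(2 / 3) * a t x ^ 3 + 3 * a t x * k x = 0) :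
    (∀ t ∈ T, ∀ x ∈ I, a t x = 0) ∨ (∀ t ∈ T, ∀ x ∈ I, a t x ^ 2 = 9 / 2 * k x) := by
  obtain ⟨φ, hφ⟩ : ∃ φ : ℝ → ℝ → ℝ, φ = fun t x => a t x ^ 2 / (9 / 2 * k x) := ⟨_, rfl⟩
  have hφ2 : ∀ t ∈ T, ∀ x ∈ I, φ t x ^ 2 - φ t x = 0 := fun t ht x hx => by
    have := hk0 x hx
    rw [hφ]
    field_simp
    linear_combination -6 * a t x * h t ht x hx
  obtain ⟨t₀, ht₀⟩ := hT'.nonempty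
  obtain ⟨x₀, hx₀⟩ := hI'.nonempty
  have hc : ∀ t ∈ T, ∀ x ∈ I, φ t x = φ t₀ x₀ := fun t ht x hx =>
    (eq_of_idempotent (f := φ t) hI hI' (by
      rw [hφ]; exact ((hax t ht).pow 2).div (contDiffOn_const.mul hk)
        fun y hy => mul_ne_zero (by norm_num) (hk0 y hy)) (hφ2 t ht) hx hx₀).trans
    (eq_of_idempotent (f := fun s => φ s x₀) hT hT' (by
      rw [hφ]; exact ((hat x₀ hx₀).pow 2).div_const _) (fun s hs => hφ2 s hs x₀ hx₀) ht ht₀)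
  have h01 : φ t₀ x₀ * (φ t₀ x₀ - 1) = 0 := by linear_combination hφ2 t₀ ht₀ x₀ hx₀
  rcases mul_eq_zero.mp h01 with h0 | h1
  · refine .inl fun t ht x hx => ?_
    have h2 := hc t ht x hx
    have := hk0 x hx
    rw [h0, hφ] at h2
    field_simp at h2
    simpa using h2
  · refine .inr fun t ht x hx => ?_
    have h2 := hc t ht x hx
    have := hk0 x hx
    rw [sub_eq_zero.mp h1, hφ] at h2
    field_simp at h2
    linarith

/-- From `a² = 9k/2` the function `a` is independent of `t`. The split equations determine `b`, `c`,
`d` successively from `a`, so these do not depend on `t` either, and the problem reduces to the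
ordinary differential system of `quasilinear_system`. -/
theorem quasilinear_classification {T I U : Set ℝ} (hT : IsOpen T) (hT' : IsConnected T)
    (hI : IsOpen I) (hI' : IsConnected I) (hU : IsOpen U) (hU' : IsConnected U) {k : ℝ → ℝ}
    (hk0 : ∀ x ∈ I, k x ≠ 0) {ξ η : Fun3} {a b c d : ℝ → ℝ → ℝ}
    (h : ∀ t ∈ T, ∀ x ∈ I, ∀ u ∈ U, Determining k ξ η t x u)
    (hx : ∀ t ∈ T, ContDiffOn ℝ ∞ (a t) I ∧ ContDiffOn ℝ ∞ (b t) I ∧ ContDiffOn ℝ ∞ (c t) I ∧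
        ContDiffOn ℝ ∞ (d t) I)
    (hat : ∀ x ∈ I, ContDiffOn ℝ ∞ (fun t => a t x) T)
    (hξη : ∀ t ∈ T, ∀ x ∈ I, ∀ u ∈ U, ξ t x u = a t x * u + b t x ∧
        η t x u = -(a t x ^ 2 / 3) * u ^ 3 + (deriv (a t) x - a t x * b t x) * u ^ 2
          + c t x * u + d t x)
    (e2 : ∀ t ∈ T, ∀ x ∈ I,
      4 * a t x * deriv (a t) x - 2 * a t x ^ 2 * b t x - 3 * a t x * k x = 0)
    (e1 : ∀ t ∈ T, ∀ x ∈ I,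
      -deriv (fun s => a s x) t + 2 * a t x * c t x - 3 * deriv (deriv (a t)) x
          + 2 * (deriv (a t) x * b t x + a t x * deriv (b t) x) = 0)
    (e0 : ∀ t ∈ T, ∀ x ∈ I, -deriv (fun s => b s x) t + 2 * a t x * d t x - 2 * deriv (c t) x
          + deriv (deriv (b t)) x - 2 * b t x * deriv (b t) x = 0)
    (hak : ∀ t ∈ T, ∀ x ∈ I, a t x ^ 2 = 9 / 2 * k x) :
    (∃ μ : ℝ, μ ≠ 0 ∧ ∀ t ∈ T, ∀ x ∈ I, ∀ u ∈ U, k x = 2 * μ ^ 2 ∧ ξ t x u = μ * (3 * u - 1) ∧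
      η t x u = -(3 * μ ^ 2) * u ^ 2 * (u - 1)) ∨
    (∃ δ : ℝ, ∀ t ∈ T, ∀ x ∈ I, ∀ u ∈ U, x + δ ≠ 0 ∧ k x = 2 / (x + δ) ^ 2 ∧
      ξ t x u = 3 / (x + δ) * (u - 1) ∧
      η t x u = -(3 / (x + δ) ^ 2) * u * (u - 1) ^ 2) := by
  obtain ⟨t₀, ht₀⟩ := hT'.nonempty
  have ha0 : ∀ t ∈ T, ∀ x ∈ I, a t x ≠ 0 := fun t ht x hx h0 => by
    have := hak t ht x hx
    rw [h0] at this
    exact hk0 x hx (by linarith)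
  have hat0 : ∀ t ∈ T, ∀ x ∈ I, deriv (fun s => a s x) t = 0 := fun t ht x hx => by
    have h1 := smooth_hasDerivAt hT (hat x hx) ht
    have h2 := deriv_zero_of_eqOn hT (f := fun s => a s x ^ 2 - 9 / 2 * k x)
      (fun s hs => by rw [hak s hs x hx, sub_self]) ht ((h1.fun_pow 2).sub_const _)
    have h3 : 2 * a t x * deriv (fun s => a s x) t = 0 := by
      push_cast at h2; linear_combination h2
    exact (mul_eq_zero.mp h3).resolve_left (mul_ne_zero two_ne_zero (ha0 t ht x hx))
  -- The normalisation `a = 3m` turns `a² = 9k/2` into `k = 2m²`.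
  obtain ⟨m, hm⟩ : ∃ m : ℝ → ℝ, m = fun x => a t₀ x / 3 := ⟨_, rfl⟩
  have hms : ContDiffOn ℝ ∞ m I := by rw [hm]; exact (hx t₀ ht₀).1.div_const 3
  have ham : ∀ t ∈ T, ∀ x ∈ I, a t x = 3 * m x := fun t ht x hx => by
    have : a t x = a t₀ x := eq_of_deriv_zero (f := fun s => a s x) hT hT'
      (fun s hs => (hat0 s hs x hx) ▸ smooth_hasDerivAt hT (hat x hx) hs) ht ht₀
    rw [hm, this]; ring
  have hm0 : ∀ x ∈ I, m x ≠ 0 := fun x hx h0 => ha0 t₀ ht₀ x hx (by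
    rw [ham t₀ ht₀ x hx, h0, mul_zero])
  have hkm : ∀ x ∈ I, k x = 2 * m x ^ 2 := fun x hx => by
    have := hak t₀ ht₀ x hx
    rw [ham t₀ ht₀ x hx] at this
    linarith
  have ham1 : ∀ t ∈ T, ∀ x ∈ I, deriv (a t) x = 3 * deriv m x := fun t ht x hx => by
    rw [deriv_eq_of_eqOn hI (ham t ht) hx]
    exact ((smooth_hasDerivAt hI hms hx).const_mul 3).deriv
  have ham2 : ∀ t ∈ T, ∀ x ∈ I, deriv (deriv (a t)) x = 3 * deriv (deriv m) x :=
    fun t ht x hx => by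
      rw [deriv_eq_of_eqOn hI (ham1 t ht) hx]
      exact ((smooth_hasDerivAt hI (smooth_deriv hI hms) hx).const_mul 3).deriv
  have hb : ∀ t ∈ T, ∀ x ∈ I, b t x = b t₀ x := fun t ht x hx => by
    have h1 := e2 t ht x hx
    have h2 := e2 t₀ ht₀ x hx
    rw [ham t ht x hx, ham1 t ht x hx] at h1
    rw [ham t₀ ht₀ x hx, ham1 t₀ ht₀ x hx] at h2
    exact mul_left_cancel₀ (pow_ne_zero 2 (hm0 x hx)) (by linear_combination (h2 - h1) / 18)
  have hb1 : ∀ t ∈ T, ∀ x ∈ I, deriv (b t) x = deriv (b t₀) x := fun t ht x hx =>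
    deriv_eq_of_eqOn hI (hb t ht) hx
  have hb2 : ∀ t ∈ T, ∀ x ∈ I, deriv (deriv (b t)) x = deriv (deriv (b t₀)) x := fun t ht x hx =>
    deriv_eq_of_eqOn hI (hb1 t ht) hx
  have hbt : ∀ t ∈ T, ∀ x ∈ I, deriv (fun s => b s x) t = 0 := fun t ht x hx =>
    (deriv_eq_of_eqOn hT (fun s hs => hb s hs x hx) ht).trans (deriv_const _ _)
  have hc : ∀ t ∈ T, ∀ x ∈ I, c t x = c t₀ x := fun t ht x hx => by
    have h1 := e1 t ht x hx
    have h2 := e1 t₀ ht₀ x hx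
    rw [hat0 t ht x hx, ham t ht x hx, ham1 t ht x hx, ham2 t ht x hx, hb t ht x hx,
      hb1 t ht x hx] at h1
    rw [hat0 t₀ ht₀ x hx, ham t₀ ht₀ x hx, ham1 t₀ ht₀ x hx, ham2 t₀ ht₀ x hx] at h2
    exact mul_left_cancel₀ (hm0 x hx) (by linear_combination (h1 - h2) / 6)
  have hc1 : ∀ t ∈ T, ∀ x ∈ I, deriv (c t) x = deriv (c t₀) x := fun t ht x hx =>
    deriv_eq_of_eqOn hI (hc t ht) hx
  have hd : ∀ t ∈ T, ∀ x ∈ I, d t x = d t₀ x := fun t ht x hx => by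
    have h1 := e0 t ht x hx
    have h2 := e0 t₀ ht₀ x hx
    rw [hbt t ht x hx, ham t ht x hx, hc1 t ht x hx, hb2 t ht x hx, hb t ht x hx,
      hb1 t ht x hx] at h1
    rw [hbt t₀ ht₀ x hx, ham t₀ ht₀ x hx] at h2
    exact mul_left_cancel₀ (hm0 x hx) (by linear_combination (h1 - h2) / 6)
  have hξ : ∀ t ∈ T, ∀ x ∈ I, ∀ u ∈ U, ξ t x u = 3 * m x * u + b t₀ x :=
    fun t ht x hx u hu => by
      rw [(hξη t ht x hx u hu).1, ham t ht x hx, hb t ht x hx]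
  have hη : ∀ t ∈ T, ∀ x ∈ I, ∀ u ∈ U, η t x u = -(3 * m x ^ 2) * u ^ 3
      + (3 * deriv m x - 3 * m x * b t₀ x) * u ^ 2 + c t₀ x * u + d t₀ x :=
    fun t ht x hx u hu => by
      rw [(hξη t ht x hx u hu).2, ham t ht x hx, ham1 t ht x hx, hb t ht x hx, hc t ht x hx,
        hd t ht x hx]
      ring
  have hηt : ∀ x ∈ I, ∀ u ∈ U, pdt η t₀ x u = 0 * u + 0 := fun x hx u hu => by
    rw [zero_mul, zero_add]
    exact (deriv_eq_of_eqOn hT (fun s hs => hη s hs x hx u hu) ht₀).trans (deriv_const _ _)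
  obtain ⟨-, hbs, hcs, hds⟩ := hx t₀ ht₀
  -- Stationarity makes `ct` and `dt` zero. Only the coefficients of `u ^ 0` and `u ^ 1` are used
  -- below, as `f0` and `f1`.
  have E := fun x (hx : x ∈ I) => zeroth_order_equations (ct := fun _ => 0) (dt := fun _ => 0)
    hI hU hU' (h t₀ ht₀)
    (contDiffOn_const.mul hms) hbs (contDiffOn_const.mul (hms.pow 2)).neg
    ((contDiffOn_const.mul (smooth_deriv hI hms)).sub ((contDiffOn_const.mul hms).mul hbs))
    hcs hds (hξ t₀ ht₀) (hη t₀ ht₀) hηt hx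
  have h3m : ∀ x ∈ I, deriv (fun y => 3 * m y) x = 3 * deriv m x := fun x hx =>
    ((smooth_hasDerivAt hI hms hx).const_mul 3).deriv
  have Q := quasilinear_system hI hI' hms hm0
    (b := b t₀) (c := c t₀) (d := d t₀)
    (fun x hx => by
      have h2 := e2 t₀ ht₀ x hx
      rw [ham t₀ ht₀ x hx, ham1 t₀ ht₀ x hx, hkm x hx] at h2
      linear_combination h2)
    (fun x hx => by
      have h2 := e1 t₀ ht₀ x hx
      rw [hat0 t₀ ht₀ x hx, ham t₀ ht₀ x hx, ham1 t₀ ht₀ x hx, ham2 t₀ ht₀ x hx] at h2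
      linear_combination h2)
    (fun x hx => by
      have h2 := e0 t₀ ht₀ x hx
      rw [hbt t₀ ht₀ x hx, ham t₀ ht₀ x hx] at h2
      linear_combination h2)
    (fun x hx => by
      have h2 := (E x hx).2.1
      rw [h3m x hx, hkm x hx] at h2
      linear_combination h2)
    (fun x hx => by linear_combination (E x hx).1)
  rcases Q with Q | Q
  · obtain ⟨x₀, hx₀⟩ := hI'.nonempty
    have hmc : ∀ x ∈ I, m x = m x₀ := fun x hx => eq_of_deriv_zero hI hI'
      (fun y hy => (Q y hy).1 ▸ smooth_hasDerivAt hI hms hy) hx hx₀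
    refine .inl ⟨m x₀, hm0 x₀ hx₀, fun t ht x hx u hu => ?_⟩
    obtain ⟨q1, q2, q3, q4⟩ := Q x hx
    rw [hkm x hx, hξ t ht x hx u hu, hη t ht x hx u hu, q1, q2, q3, q4, hmc x hx]
    exact ⟨rfl, by ring, by ring⟩
  · obtain ⟨x₀, hx₀⟩ := hI'.nonempty
    -- The equation `m' = -m²` integrates to `1/m = x + δ`, which also supplies the shift `δ`.
    have hmc : ∀ x ∈ I, (m x)⁻¹ - x = (m x₀)⁻¹ - x₀ := fun x hx =>
      eq_of_deriv_zero (f := fun y => (m y)⁻¹ - y) hI hI'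
      (fun y hy => (((smooth_hasDerivAt hI hms hy).fun_inv (hm0 y hy)).sub
        (hasDerivAt_id y)).congr_deriv (by
          have := hm0 y hy
          rw [(Q y hy).1]; field_simp; ring)) hx hx₀
    have hmi : ∀ x ∈ I, x + ((m x₀)⁻¹ - x₀) = (m x)⁻¹ := fun x hx => by
      rw [← hmc x hx]; ring
    refine .inr ⟨(m x₀)⁻¹ - x₀, fun t ht x hx u hu => ?_⟩
    obtain ⟨q1, q2, q3, q4⟩ := Q x hx
    have := hm0 x hx
    rw [hmi x hx, hkm x hx, hξ t ht x hx u hu, hη t ht x hx u hu, q1, q2, q3, q4]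
    refine ⟨inv_ne_zero this, ?_, ?_, ?_⟩ <;> field_simp <;> ring

/-! ### The case where `ξ` does not depend on `u`. -/

/-- A solution of a homogeneous linear equation `y' = p y` that has a zero vanishes identically. -/
theorem eq_zero_of_linear_ode {S : Set ℝ} (hS : IsOpen S) (hS' : IsConnected S) {p y : ℝ → ℝ}
    (hp : ContinuousOn p S) (hy : ∀ x ∈ S, HasDerivAt y (p x * y x) x) {x₀ : ℝ} (hx₀ : x₀ ∈ S)
    (h0 : y x₀ = 0) {x : ℝ} (hx : x ∈ S) : y x = 0 := by
  have hP : ∀ z ∈ S, HasDerivAt (fun z => ∫ s in x₀..z, p s) (p z) z := fun z hz =>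
    intervalIntegral.integral_hasDerivAt_right
      ((hp.mono (hS'.isPreconnected.ordConnected.uIcc_subset hx₀ hz)).intervalIntegrable)
      (hp.stronglyMeasurableAtFilter hS z hz) (hp.continuousAt (hS.mem_nhds hz))
  -- The integrating factor makes `y exp(-∫ p)` constant.
  have h1 := eq_of_deriv_zero (f := fun z => y z * Real.exp (-∫ s in x₀..z, p s)) hS hS'
    (fun z hz => ((hy z hz).fun_mul (hP z hz).fun_neg.exp).congr_deriv (by ring)) hx hx₀
  simp only [h0, zero_mul, mul_eq_zero, Real.exp_ne_zero, or_false] at h1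
  exact h1

/-- The operators `(2 α t + γ) ∂_t + (α x + β) ∂_x` that preserve the coefficient `k` are Lie
symmetries. -/
theorem isLieSymmetry_affine {T I U : Set ℝ} {k : ℝ → ℝ} (hk : ∀ x ∈ I, DifferentiableAt ℝ k x)
    {α β γ : ℝ} (h : ∀ x ∈ I, 2 * α * k x + (α * x + β) * deriv k x = 0) :
    IsLieSymmetry (huxley k) ⟨fun t _ _ => 2 * α * t + γ, fun _ x _ => α * x + β, fun _ _ _ => 0⟩
      T I U := by
  refine ⟨⟨?_, ?_, ?_⟩, ?_⟩
  · exact ContDiff.contDiffOn (by fun_prop)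
  · exact ContDiff.contDiffOn (by fun_prop)
  · exact contDiffOn_const
  · rintro j ⟨ht, hx, hu⟩ hL
    rw [prolong_huxley _ (hk _ hx).hasDerivAt]
    have h1 := h _ hx
    simp only [huxley] at hL
    simp [Operator.ηt, Operator.ηxx, Dt, Dx, Dxx, ev, pdt, pdx, pdu]
    linear_combination (-(2 * α)) * hL - j.u ^ 2 * (1 - j.u) * h1

/-- Unless `φ` vanishes, `φ' = -2αφ²` integrates to `1/φ = 2αt + γ`, while `h = αx + β`. So the
multiple `(1/φ) Q` is the scaling and translation operator of `isLieSymmetry_affine`. -/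
theorem isEquivToLie_of_affine {T I U : Set ℝ} (hT : IsOpen T) (hT' : IsConnected T)
    (hI : IsOpen I) (hI' : IsConnected I) {k : ℝ → ℝ}
    (hk : ∀ x ∈ I, DifferentiableAt ℝ k x) {ξ η : Fun3} {φ h : ℝ → ℝ} {α : ℝ}
    (hφ : ∀ t ∈ T, HasDerivAt φ (-2 * α * φ t ^ 2) t)
    (hh : ∀ x ∈ I, HasDerivAt h α x)
    (hkh : ∀ x ∈ I, 2 * α * k x + h x * deriv k x = 0)
    (hξ : ∀ t ∈ T, ∀ x ∈ I, ∀ u ∈ U, ξ t x u = φ t * h x)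
    (hη : ∀ t ∈ T, ∀ x ∈ I, ∀ u ∈ U, η t x u = 0) :
    IsEquivToLie (huxley k) (Operator.unitTime ξ η) T I U := by
  by_cases hz : ∃ t₀ ∈ T, φ t₀ = 0
  · obtain ⟨t₀, ht₀, h0⟩ := hz
    -- Read as the linear equation `φ' = (-2αφ) φ`, a single zero makes `φ` vanish identically; then
    -- `Q = ∂_t`.
    have hφ0 : ∀ t ∈ T, φ t = 0 := fun t ht =>
      eq_zero_of_linear_ode hT hT' (p := fun t => -2 * α * φ t)
        (continuousOn_const.mul fun s hs => (hφ s hs).continuousAt.continuousWithinAt)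
        (fun s hs => (hφ s hs).congr_deriv (by ring)) ht₀ h0 ht
    refine ⟨_, isLieSymmetry_affine (α := 0) (β := 0) (γ := 1) hk (by simp),
      fun _ _ _ => 1, fun t ht x hx u hu => ?_⟩
    simp [Operator.unitTime, hξ t ht x hx u hu, hη t ht x hx u hu, hφ0 t ht]
  · push Not at hz
    obtain ⟨t₀, ht₀⟩ := hT'.nonempty
    obtain ⟨x₀, hx₀⟩ := hI'.nonempty
    have hφi : ∀ t ∈ T, 2 * α * t + ((φ t₀)⁻¹ - 2 * α * t₀) = (φ t)⁻¹ := fun t ht => by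
      have := eq_of_deriv_zero (f := fun s => (φ s)⁻¹ - 2 * α * s) hT hT' (fun s hs =>
        (((hφ s hs).fun_inv (hz s hs)).sub ((hasDerivAt_id s).const_mul (2 * α))).congr_deriv (by
          have := hz s hs
          field_simp; ring)) ht ht₀
      linarith
    have hhi : ∀ x ∈ I, α * x + (h x₀ - α * x₀) = h x := fun x hx => by
      have := eq_of_deriv_zero (f := fun y => h y - α * y) hI hI' (fun y hy =>
        ((hh y hy).sub ((hasDerivAt_id y).const_mul α)).congr_deriv (by ring)) hx hx₀
      linarith
    refine ⟨_, isLieSymmetry_affine (α := α) (β := h x₀ - α * x₀) (γ := (φ t₀)⁻¹ - 2 * α * t₀) hk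
      (fun x hx => by rw [hhi x hx]; exact hkh x hx), fun t _ _ => (φ t)⁻¹,
      fun t ht x hx u hu => ?_⟩
    have := hz t ht
    refine ⟨inv_ne_zero this, ?_, ?_, ?_⟩
    · simp [Operator.unitTime, hφi t ht]
    · simp [Operator.unitTime, hhi x hx, hξ t ht x hx u hu, this]
    · simp [Operator.unitTime, hη t ht x hx u hu]

/-- The coefficients of `u²` and `u³` in the last determining equation add up to `k (c + 3d)`, so `c
= -3d`. The coefficients of `u⁰` and `u¹` are then the same linear equation for `d` up to the term
`-2kd`, so `d = 0`. What remains of the coefficient of `u³` is the relation between `k` and `b`. -/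
theorem semilinear_equations {T I U : Set ℝ} (hT : IsOpen T) (hI : IsOpen I) (hU : IsOpen U)
    (hU' : IsConnected U) {k : ℝ → ℝ} (hk0 : ∀ x ∈ I, k x ≠ 0) {ξ η : Fun3}
    (hs : (Operator.unitTime ξ η).SmoothOn T I U) {b : ℝ → ℝ → ℝ}
    (h : ∀ t ∈ T, ∀ x ∈ I, ∀ u ∈ U, Determining k ξ η t x u)
    (hb : ∀ t ∈ T, ContDiffOn ℝ ∞ (b t) I)
    (hξ : ∀ t ∈ T, ∀ x ∈ I, ∀ u ∈ U, ξ t x u = b t x)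
    (hη : ∀ t ∈ T, ∀ x ∈ I, ∃ p q, ∀ u ∈ U, η t x u = p * u + q) :
    (∀ t ∈ T, ∀ x ∈ I, ∀ u ∈ U, η t x u = 0) ∧
    ∀ t ∈ T, ∀ x ∈ I, 2 * k x * deriv (b t) x + b t x * deriv k x = 0 := by
  obtain ⟨-, -, hηs⟩ := hs
  obtain ⟨u₀, hu₀, u₁, hu₁, hη⟩ := exists_affine_coeffs hU hU' hη
  obtain ⟨c, hc⟩ : ∃ c : ℝ → ℝ → ℝ, c = fun t x => (η t x u₁ - η t x u₀) / (u₁ - u₀) := ⟨_, rfl⟩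
  obtain ⟨d, hd⟩ : ∃ d : ℝ → ℝ → ℝ, d = fun t x => η t x u₀ - c t x * u₀ := ⟨_, rfl⟩
  replace hη : ∀ t ∈ T, ∀ x ∈ I, ∀ u ∈ U, η t x u = c t x * u + d t x := by
    rw [hd, hc]; exact hη
  have hcx : ∀ t ∈ T, ContDiffOn ℝ ∞ (c t) I := fun t ht => by
    rw [hc]; exact ((slice_x hηs ht hu₁).sub (slice_x hηs ht hu₀)).div_const _
  have hct : ∀ x ∈ I, ContDiffOn ℝ ∞ (fun t => c t x) T := fun x hx => by
    rw [hc]; exact ((slice_t hηs hx hu₁).sub (slice_t hηs hx hu₀)).div_const _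
  have hdx : ∀ t ∈ T, ContDiffOn ℝ ∞ (d t) I := fun t ht => by
    rw [hd]; exact (slice_x hηs ht hu₀).sub ((hcx t ht).mul contDiffOn_const)
  have hdt : ∀ x ∈ I, ContDiffOn ℝ ∞ (fun t => d t x) T := fun x hx => by
    rw [hd]; exact (slice_t hηs hx hu₀).sub ((hct x hx).mul contDiffOn_const)
  have E := fun t (ht : t ∈ T) x (hx : x ∈ I) => zeroth_order_equations (t := t)
    (a := fun _ => 0) (A := fun _ => 0) (B := fun _ => 0) (b := b t) (c := c t) (d := d t)
    (ct := fun x => deriv (fun s => c s x) t) (dt := fun x => deriv (fun s => d s x) t)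
    hI hU hU' (h t ht) contDiffOn_const (hb t ht) contDiffOn_const contDiffOn_const
    (hcx t ht) (hdx t ht) (fun x hx u hu => by rw [hξ t ht x hx u hu]; ring)
    (fun x hx u hu => by rw [hη t ht x hx u hu]; ring)
    (fun x hx u hu => (hasDerivAt_of_eqOn hT (fun s hs => hη s hs x hx u hu) ht
      (((smooth_hasDerivAt hT (hct x hx) ht).mul_const u).add
        (smooth_hasDerivAt hT (hdt x hx) ht))).deriv) hx
  simp only [deriv_const', mul_zero, zero_mul, add_zero, sub_zero, zero_sub, neg_zero,
    zero_add] at E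
  have hcd : ∀ t ∈ T, ∀ x ∈ I, c t x = -3 * d t x := fun t ht x hx => by
    obtain ⟨-, -, e2, e3⟩ := E t ht x hx
    exact mul_left_cancel₀ (hk0 x hx) (by linear_combination e2 + e3)
  have hcd1 : ∀ t ∈ T, ∀ x ∈ I, deriv (c t) x = -3 * deriv (d t) x := fun t ht x hx =>
    (deriv_eq_of_eqOn hI (hcd t ht) hx).trans
      ((smooth_hasDerivAt hI (hdx t ht) hx).const_mul (-3)).deriv
  have hcd2 : ∀ t ∈ T, ∀ x ∈ I, deriv (deriv (c t)) x = -3 * deriv (deriv (d t)) x :=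
    fun t ht x hx => (deriv_eq_of_eqOn hI (hcd1 t ht) hx).trans
      ((smooth_hasDerivAt hI (smooth_deriv hI (hdx t ht)) hx).const_mul (-3)).deriv
  have hcdt : ∀ t ∈ T, ∀ x ∈ I, deriv (fun s => c s x) t = -3 * deriv (fun s => d s x) t :=
    fun t ht x hx => (deriv_eq_of_eqOn hT (fun s hs => hcd s hs x hx) ht).trans
      ((smooth_hasDerivAt hT (hdt x hx) ht).const_mul (-3)).deriv
  have hd0 : ∀ t ∈ T, ∀ x ∈ I, d t x = 0 := fun t ht x hx => by
    obtain ⟨e0, e1, -, -⟩ := E t ht x hx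
    rw [hcdt t ht x hx, hcd2 t ht x hx, hcd t ht x hx] at e1
    exact mul_left_cancel₀ (hk0 x hx) (by linear_combination (-1 / 2) * e1 - 3 / 2 * e0)
  refine ⟨fun t ht x hx u hu => ?_, fun t ht x hx => ?_⟩
  · rw [hη t ht x hx u hu, hcd t ht x hx, hd0 t ht x hx]; ring
  · obtain ⟨-, -, -, e3⟩ := E t ht x hx
    rw [hcd t ht x hx, hd0 t ht x hx] at e3
    linear_combination e3

/-- If `η = 0` and `ξ = b(t, x)`, then the operator is equivalent to a Lie symmetry, or `b` is a
nonconstant stationary solution of the Riccati equation `b' = b² + C`. -/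
theorem semilinear_classification {T I U : Set ℝ} (hT : IsOpen T) (hT' : IsConnected T)
    (hI : IsOpen I) (hI' : IsConnected I) {k : ℝ → ℝ}
    (hk : ContDiffOn ℝ ∞ k I) (hk0 : ∀ x ∈ I, k x ≠ 0) {ξ η : Fun3} {b : ℝ → ℝ → ℝ}
    (hbx : ∀ t ∈ T, ContDiffOn ℝ ∞ (b t) I) (hbt : ∀ x ∈ I, ContDiffOn ℝ ∞ (fun t => b t x) T)
    (hξ : ∀ t ∈ T, ∀ x ∈ I, ∀ u ∈ U, ξ t x u = b t x)
    (hη : ∀ t ∈ T, ∀ x ∈ I, ∀ u ∈ U, η t x u = 0)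
    (hkb : ∀ t ∈ T, ∀ x ∈ I, 2 * k x * deriv (b t) x + b t x * deriv k x = 0)
    (e0 : ∀ t ∈ T, ∀ x ∈ I,
      deriv (fun s => b s x) t = deriv (deriv (b t)) x - 2 * b t x * deriv (b t) x) :
    IsEquivToLie (huxley k) (Operator.unitTime ξ η) T I U ∨
    ∃ (β : ℝ → ℝ) (C κ : ℝ), κ ≠ 0 ∧ (∀ t ∈ T, ∀ x ∈ I, ∀ u ∈ U, ξ t x u = β x) ∧
      (∀ x ∈ I, β x ≠ 0 ∧ HasDerivAt β (β x ^ 2 + C) x ∧ k x * β x ^ 2 = κ) ∧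
      ∃ x ∈ I, β x ^ 2 + C ≠ 0 := by
  obtain ⟨t₀, ht₀⟩ := hT'.nonempty
  obtain ⟨x₀, hx₀⟩ := hI'.nonempty
  have hk1 : ∀ x ∈ I, HasDerivAt k (deriv k x) x := fun x hx => smooth_hasDerivAt hI hk hx
  -- This is `|k|^(-1/2)`, written through `k²` so that it is visibly smooth for either sign of `k`.
  obtain ⟨h, hh⟩ : ∃ h : ℝ → ℝ, h = fun x => (√√(k x ^ 2))⁻¹ := ⟨_, rfl⟩
  have hksq : ∀ x ∈ I, 0 < k x ^ 2 := fun x hx => by have := hk0 x hx; positivity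
  have hhs : ContDiffOn ℝ ∞ h I := by
    rw [hh]
    exact (((hk.pow 2).sqrt fun x hx => (hksq x hx).ne').sqrt
      fun x hx => (Real.sqrt_pos.mpr (hksq x hx)).ne').inv
      fun x hx => (Real.sqrt_pos.mpr (Real.sqrt_pos.mpr (hksq x hx))).ne'
  have hhk : ∀ x ∈ I, h x ^ 4 * k x ^ 2 = 1 := fun x hx => by
    have : (√√(k x ^ 2)) ^ 4 = k x ^ 2 := by
      rw [show (4 : ℕ) = 2 * 2 from rfl, pow_mul, Real.sq_sqrt (Real.sqrt_nonneg _),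
        Real.sq_sqrt (hksq x hx).le]
    rw [hh]
    simp only [inv_pow]
    rw [this]
    exact inv_mul_cancel₀ (hksq x hx).ne'
  have hh0 : ∀ x ∈ I, h x ≠ 0 := fun x hx h0 => by
    have := hhk x hx
    rw [h0] at this
    norm_num at this
  have hh1 : ∀ x ∈ I, HasDerivAt h (deriv h x) x := fun x hx => smooth_hasDerivAt hI hhs hx
  have hh2 : ∀ x ∈ I, HasDerivAt (deriv h) (deriv (deriv h) x) x := fun x hx =>
    smooth_hasDerivAt hI (smooth_deriv hI hhs) hx
  have hkh : ∀ x ∈ I, 2 * deriv h x * k x + h x * deriv k x = 0 := fun x hx => by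
    have h1 := deriv_zero_of_eqOn hI (f := fun y => h y ^ 4 * k y ^ 2 - 1)
      (fun y hy => by rw [hhk y hy, sub_self]) hx
      ((((hh1 x hx).fun_pow 4).fun_mul ((hk1 x hx).fun_pow 2)).sub_const 1)
    refine mul_left_cancel₀ (mul_ne_zero (pow_ne_zero 3 (hh0 x hx)) (hk0 x hx)) ?_
    push_cast at h1
    linear_combination h1 / 2
  obtain ⟨φ, hφ⟩ : ∃ φ : ℝ → ℝ, φ = fun t => b t x₀ / h x₀ := ⟨_, rfl⟩
  have hφs : ContDiffOn ℝ ∞ φ T := by rw [hφ]; exact (hbt x₀ hx₀).div_const _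
  -- Both `b(t, ·)` and `h` solve `2 k y' + k' y = 0`, so their quotient is constant in `x`.
  have hbφ : ∀ t ∈ T, ∀ x ∈ I, b t x = φ t * h x := fun t ht x hx => by
    have h1 : b t x / h x = b t x₀ / h x₀ := eq_of_deriv_zero (f := fun y => b t y / h y) hI hI' (fun y hy =>
      ((smooth_hasDerivAt hI (hbx t ht) hy).fun_div (hh1 y hy) (hh0 y hy)).congr_deriv (by
        have h2 := hkb t ht y hy
        have h3 := hkh y hy
        have h4 := hh0 y hy
        rw [div_eq_zero_iff]
        left
        refine mul_left_cancel₀ (hk0 y hy) ?_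
        linear_combination (h y * h2 - b t y * h3) / 2)) hx hx₀
    rw [hφ]
    simp only
    rw [← h1, div_mul_cancel₀ _ (hh0 x hx)]
  have hb1 : ∀ t ∈ T, ∀ x ∈ I, deriv (b t) x = φ t * deriv h x := fun t ht x hx =>
    (deriv_eq_of_eqOn hI (hbφ t ht) hx).trans ((hh1 x hx).const_mul _).deriv
  have hb2 : ∀ t ∈ T, ∀ x ∈ I, deriv (deriv (b t)) x = φ t * deriv (deriv h) x :=
    fun t ht x hx => (deriv_eq_of_eqOn hI (hb1 t ht) hx).trans ((hh2 x hx).const_mul _).deriv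
  have hφ1 : ∀ t ∈ T, HasDerivAt φ (deriv φ t) t := fun t ht => smooth_hasDerivAt hT hφs ht
  have hφe : ∀ t ∈ T, ∀ x ∈ I,
      deriv φ t = φ t * (deriv (deriv h) x / h x) - 2 * φ t ^ 2 * deriv h x := fun t ht x hx => by
    have h1 := e0 t ht x hx
    rw [(deriv_eq_of_eqOn hT (fun s hs => hbφ s hs x hx) ht).trans
      ((hφ1 t ht).mul_const _).deriv, hb2 t ht x hx, hb1 t ht x hx, hbφ t ht x hx] at h1
    have := hh0 x hx
    field_simp
    linear_combination h1
  have hξ' : ∀ t ∈ T, ∀ x ∈ I, ∀ u ∈ U, ξ t x u = φ t * h x := fun t ht x hx u hu => by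
    rw [hξ t ht x hx u hu, hbφ t ht x hx]
  have hkd : ∀ x ∈ I, DifferentiableAt ℝ k x := fun x hx => (hk1 x hx).differentiableAt
  -- For constant `h'` the function `h` is affine, and the equation for `φ` becomes `φ' = -2 h' φ²`.
  by_cases hconst : ∀ x ∈ I, deriv h x = deriv h x₀
  · left
    have hh20 : deriv (deriv h) x₀ = 0 :=
      (deriv_eq_of_eqOn hI hconst hx₀).trans (deriv_const _ _)
    refine isEquivToLie_of_affine hT hT' hI hI' hkd (φ := φ) (h := h) (α := deriv h x₀)
      (fun t ht => (hφ1 t ht).congr_deriv ?_) (fun x hx => hconst x hx ▸ hh1 x hx)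
      (fun x hx => by rw [← hconst x hx]; linear_combination hkh x hx) hξ' hη
    rw [hφe t ht x₀ hx₀, hh20]
    ring
  by_cases hzero : ∀ t ∈ T, φ t = 0
  · left
    refine isEquivToLie_of_affine hT hT' hI hI' hkd (φ := fun _ => 0) (h := fun _ => 0) (α := 0)
      (fun t _ => (hasDerivAt_const t 0).congr_deriv (by ring)) (fun x _ => hasDerivAt_const x 0)
      (fun x _ => by ring) (fun t ht x hx u hu => ?_) hη
    rw [hξ' t ht x hx u hu, hzero t ht, zero_mul, zero_mul]
  right
  push Not at hconst hzero
  obtain ⟨x₁, hx₁, hne⟩ := hconst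
  obtain ⟨t₁, ht₁, hφ0⟩ := hzero
  -- Where `φ ≠ 0`, `φ'/φ = h''/h - 2φh'` cannot depend on `x`. Comparing `x₀` and `x₁`, where `h'`
  -- differs, determines the value `φ(t)`.
  have hval : ∀ t ∈ T, φ t ≠ 0 → φ t = φ t₁ := fun t ht h0 => by
    have h1 := hφe t ht x₁ hx₁
    have h2 := hφe t ht x₀ hx₀
    have h3 := hφe t₁ ht₁ x₁ hx₁
    have h4 := hφe t₁ ht₁ x₀ hx₀
    have h5 : φ t * φ t₁ * (deriv h x₁ - deriv h x₀) ≠ 0 :=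
      mul_ne_zero (mul_ne_zero h0 hφ0) (sub_ne_zero.mpr hne)
    refine mul_left_cancel₀ h5 ?_
    linear_combination (φ t₁ * (h1 - h2) - φ t * (h3 - h4)) / 2
  -- The ratio `φ / φ(t₁)` takes only the values 0 and 1, so it is constant.
  have hφc : ∀ t ∈ T, φ t = φ t₁ := fun t ht => by
    have h1 := eq_of_idempotent (f := fun s => φ s / φ t₁) hT hT' (hφs.div_const _)
      (fun s hs => by
        by_cases h0 : φ s = 0
        · simp [h0]
        · rw [hval s hs h0, div_self hφ0]; norm_num) ht ht₁
    simp only [div_self hφ0] at h1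
    exact (div_eq_one_iff_eq hφ0).mp h1
  have hh2e : ∀ x ∈ I, deriv (deriv h) x = 2 * φ t₁ * h x * deriv h x := fun x hx => by
    have h1 := hφe t₁ ht₁ x hx
    rw [(deriv_eq_of_eqOn hT hφc ht₁).trans (deriv_const _ _)] at h1
    have := hh0 x hx
    field_simp at h1
    exact mul_left_cancel₀ hφ0 (by linear_combination -h1)
  -- First integral of `h'' = 2φhh'`; for `β = φh` it is the Riccati equation with constant `C`.
  have hC : ∀ x ∈ I, φ t₁ * deriv h x - (φ t₁ * h x) ^ 2
      = φ t₁ * deriv h x₀ - (φ t₁ * h x₀) ^ 2 := fun x hx =>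
    eq_of_deriv_zero (f := fun y => φ t₁ * deriv h y - (φ t₁ * h y) ^ 2) hI hI' (fun y hy =>
      (((hh2 y hy).const_mul _).fun_sub (((hh1 y hy).const_mul _).fun_pow 2)).congr_deriv (by
        rw [hh2e y hy]; push_cast; ring)) hx hx₀
  have hβ1 : ∀ x ∈ I, φ t₁ * deriv h x
      = (φ t₁ * h x) ^ 2 + (φ t₁ * deriv h x₀ - (φ t₁ * h x₀) ^ 2) := fun x hx => by
    rw [← hC x hx]; ring
  have hκ : ∀ x ∈ I, k x * (φ t₁ * h x) ^ 2 = k x₀ * (φ t₁ * h x₀) ^ 2 := fun x hx =>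
    eq_of_deriv_zero (f := fun y => k y * (φ t₁ * h y) ^ 2) hI hI' (fun y hy =>
      ((hk1 y hy).fun_mul (((hh1 y hy).const_mul _).fun_pow 2)).congr_deriv (by
        push_cast
        linear_combination φ t₁ ^ 2 * h y * hkh y hy)) hx hx₀
  refine ⟨fun x => φ t₁ * h x, φ t₁ * deriv h x₀ - (φ t₁ * h x₀) ^ 2, k x₀ * (φ t₁ * h x₀) ^ 2,
    mul_ne_zero (hk0 x₀ hx₀) (pow_ne_zero 2 (mul_ne_zero hφ0 (hh0 x₀ hx₀))),
    fun t ht x hx u hu => by rw [hξ' t ht x hx u hu, hφc t ht],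
    fun x hx => ⟨mul_ne_zero hφ0 (hh0 x hx), ?_, hκ x hx⟩, ?_⟩
  · exact ((hh1 x hx).const_mul _).congr_deriv (hβ1 x hx)
  · by_contra hcon
    push Not at hcon
    have hz : ∀ x ∈ I, deriv h x = 0 := fun x hx =>
      (mul_eq_zero.mp ((hβ1 x hx).trans (hcon x hx))).resolve_left hφ0
    exact hne (by rw [hz x₁ hx₁, hz x₀ hx₀])

/-! ### Reduction to the canonical pairs. -/

theorem maps_of_stationary {T I U : Set ℝ} {k K β : ℝ → ℝ} {ξ η : Fun3} (ε δ : ℝ) (hε : ε ≠ 0)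
    (hK : ∀ x ∈ I, K (ε * x + δ) = (ε ^ 2)⁻¹ * k x)
    (hξ : ∀ t ∈ T, ∀ x ∈ I, ∀ u ∈ U, ξ t x u = ε * β (ε * x + δ))
    (hη : ∀ t ∈ T, ∀ x ∈ I, ∀ u ∈ U, η t x u = 0) :
    (EquivTransf.mk ε 0 δ hε).Maps T I U k (.unitTime ξ η) K
      (.unitTime (fun _ x _ => β x) (fun _ _ _ => 0)) := by
  refine ⟨hK, fun _ _ _ => (ε ^ 2)⁻¹, fun t ht x hx u hu => ⟨by positivity, ?_, ?_, ?_⟩⟩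
  · simp only [Operator.unitTime]; field_simp
  · simp only [Operator.unitTime]; rw [hξ t ht x hx u hu]; field_simp
  · simp only [Operator.unitTime]; rw [hη t ht x hx u hu, mul_zero]

/-- The Riccati equation is solved by a first integral suited to the sign of `C`. Since `k = κ/β²`,
the coefficient is the reciprocal square of the solution, which is why `tanh` in `ξ` pairs with
`coth` in `k` and vice versa. -/
theorem canonical_of_riccati {T I U : Set ℝ} (hI : IsOpen I) (hI' : IsConnected I)
    {k : ℝ → ℝ} {ξ η : Fun3} {β : ℝ → ℝ} {C κ : ℝ} (hκ : κ ≠ 0)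
    (hξ : ∀ t ∈ T, ∀ x ∈ I, ∀ u ∈ U, ξ t x u = β x)
    (hη : ∀ t ∈ T, ∀ x ∈ I, ∀ u ∈ U, η t x u = 0)
    (hβ0 : ∀ x ∈ I, β x ≠ 0) (hβ : ∀ x ∈ I, HasDerivAt β (β x ^ 2 + C) x)
    (hk : ∀ x ∈ I, k x * β x ^ 2 = κ) (hne : ∃ x ∈ I, β x ^ 2 + C ≠ 0) :
    ∃ (g : EquivTransf) (K : ℝ → ℝ) (R : Operator),
      CanonicalPair K R ∧ g.Maps T I U k (.unitTime ξ η) K R := by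
  obtain ⟨x₀, hx₀⟩ := hI'.nonempty
  have hkβ : ∀ x ∈ I, k x = κ / β x ^ 2 := fun x hx => by
    rw [eq_div_iff (pow_ne_zero 2 (hβ0 x hx)), hk x hx]
  rcases lt_trichotomy C 0 with hC | hC | hC
  · obtain ⟨μ, hμ0, hμ⟩ : ∃ μ : ℝ, 0 < μ ∧ C = -μ ^ 2 :=
      ⟨√(-C), Real.sqrt_pos.mpr (by linarith), by rw [Real.sq_sqrt (by linarith)]; ring⟩
    have hμ' := hμ0.ne'
    subst hμ
    have hcont : ContinuousOn β I := fun x hx => (hβ x hx).continuousAt.continuousWithinAt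
    obtain ⟨x₁, hx₁, hne⟩ := hne
    -- With `C = -μ²`, both `β + μ` and `β - μ` solve homogeneous linear equations. A zero of either
    -- would make `β` an equilibrium, contrary to `hne`.
    have hp : ∀ x ∈ I, β x + μ ≠ 0 := fun x hx h0 => hne (by
      have : β x₁ + μ = 0 := eq_zero_of_linear_ode hI hI' (p := fun x => β x - μ) (y := fun x => β x + μ)
        (hcont.sub continuousOn_const)
        (fun y hy => ((hβ y hy).add_const μ).congr_deriv (by ring)) hx h0 hx₁
      linear_combination (β x₁ - μ) * this)
    have hq : ∀ x ∈ I, β x - μ ≠ 0 := fun x hx h0 => hne (by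
      have : β x₁ - μ = 0 := eq_zero_of_linear_ode hI hI' (p := fun x => β x + μ) (y := fun x => β x - μ)
        (hcont.add continuousOn_const)
        (fun y hy => ((hβ y hy).sub_const μ).congr_deriv (by ring)) hx h0 hx₁
      linear_combination (β x₁ + μ) * this)
    -- Separation of variables: the logarithmic derivative of `(β - μ)/(β + μ)` is `2μ`.
    obtain ⟨A, hA⟩ : ∃ A : ℝ, ∀ x ∈ I, (β x - μ) / (β x + μ) * Real.exp (-(2 * μ * x)) = A :=
      ⟨_, fun x hx => eq_of_deriv_zero
        (f := fun x => (β x - μ) / (β x + μ) * Real.exp (-(2 * μ * x))) hI hI' (fun y hy => by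
          have h1 := ((hβ y hy).sub_const μ).fun_div ((hβ y hy).add_const μ) (hp y hy)
          have h2 := ((hasDerivAt_id y).const_mul (2 * μ)).fun_neg.exp
          refine (h1.fun_mul h2).congr_deriv ?_
          have := hp y hy
          simp only [id]
          field_simp
          ring) hx hx₀⟩
    have hA0 : A ≠ 0 := by
      rw [← hA x₀ hx₀]
      exact mul_ne_zero (div_ne_zero (hq x₀ hx₀) (hp x₀ hx₀)) (Real.exp_ne_zero _)
    -- The phase is `δ = ½ log |A|`, so the first integral becomes a balance of `exp(±(μx + δ))`.
    -- The sign of `A` decides which of the two is the hyperbolic sine and which the cosine.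
    obtain ⟨δ, hδ⟩ : ∃ δ : ℝ, |A| = Real.exp δ * Real.exp δ :=
      ⟨Real.log |A| / 2, by rw [← Real.exp_add, add_halves, Real.exp_log (abs_pos.mpr hA0)]⟩
    have key : ∀ x ∈ I, (β x - μ) * Real.exp (-(μ * x + δ)) * |A|
        = A * ((β x + μ) * Real.exp (μ * x + δ)) := fun x hx => by
      have h1 := hA x hx
      have h2 : Real.exp (-(2 * μ * x)) = Real.exp (-(μ * x)) * Real.exp (-(μ * x)) := by
        rw [← Real.exp_add]; ring_nf
      have h3 : Real.exp (μ * x) * Real.exp (-(μ * x)) = 1 := by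
        rw [← Real.exp_add]; simp
      have h4 : Real.exp δ * Real.exp (-δ) = 1 := by
        rw [← Real.exp_add]; simp
      have := hp x hx
      rw [div_mul_eq_mul_div, div_eq_iff this, h2] at h1
      rw [neg_add, Real.exp_add, Real.exp_add, hδ]
      linear_combination (Real.exp (μ * x) * Real.exp δ) * h1
        + (β x - μ) * Real.exp (-(μ * x)) * Real.exp δ * (h4 - h3)
    rcases hA0.lt_or_gt with hneg | hpos
    · have hβc : ∀ x ∈ I, β x * Real.cosh (μ * x + δ) = -μ * Real.sinh (μ * x + δ) :=
        fun x hx => by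
          have h1 := key x hx
          rw [abs_of_neg hneg] at h1
          rw [Real.cosh_eq, Real.sinh_eq]
          exact mul_left_cancel₀ hA0 (by linear_combination (-1 / 2) * h1)
      have hβt : ∀ x ∈ I, β x = μ * -Real.tanh (μ * x + δ) := fun x hx => by
        have := (Real.cosh_pos (μ * x + δ)).ne'
        rw [Real.tanh_eq_sinh_div_cosh]
        field_simp
        linear_combination hβc x hx
      -- The constant `κ/μ⁴` collects `μ⁻²` from `β² = μ² tanh²` and `μ⁻²` from the rescaling of
      -- `k`.
      refine ⟨_, _, _, .coth (κ / μ ^ 4) (div_ne_zero hκ (pow_ne_zero 4 hμ')),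
        maps_of_stationary μ δ hμ' (fun x hx => ?_)
          (fun t ht x hx u hu => by rw [hξ t ht x hx u hu, hβt x hx]) hη⟩
      have h0 := hβ0 x hx
      rw [hkβ x hx]
      have h1 := (Real.cosh_pos (μ * x + δ)).ne'
      have hs : Real.sinh (μ * x + δ) ≠ 0 := fun h2 => h0 (by
        rw [hβt x hx, Real.tanh_eq_sinh_div_cosh, h2]; simp)
      rw [hβt x hx, Real.tanh_eq_sinh_div_cosh]
      field_simp
    · have hβc : ∀ x ∈ I, β x * Real.sinh (μ * x + δ) = -μ * Real.cosh (μ * x + δ) :=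
        fun x hx => by
          have h1 := key x hx
          rw [abs_of_pos hpos] at h1
          rw [Real.cosh_eq, Real.sinh_eq]
          exact mul_left_cancel₀ hA0 (by linear_combination (-1 / 2) * h1)
      have hs : ∀ x ∈ I, Real.sinh (μ * x + δ) ≠ 0 := fun x hx h2 => by
        have h1 := hβc x hx
        rw [h2, mul_zero] at h1
        exact mul_ne_zero (neg_ne_zero.mpr hμ') (Real.cosh_pos (μ * x + δ)).ne' h1.symm
      have hβt : ∀ x ∈ I, β x = μ * -(Real.cosh (μ * x + δ) / Real.sinh (μ * x + δ)) :=
        fun x hx => by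
          have := hs x hx
          field_simp
          linear_combination hβc x hx
      refine ⟨_, _, _, .tanh (κ / μ ^ 4) (div_ne_zero hκ (pow_ne_zero 4 hμ')),
        maps_of_stationary (β := fun y => -(Real.cosh y / Real.sinh y)) μ δ hμ' (fun x hx => ?_)
          (fun t ht x hx u hu => by rw [hξ t ht x hx u hu, hβt x hx]) hη⟩
      have h1 := (Real.cosh_pos (μ * x + δ)).ne'
      have h2 := hs x hx
      rw [hkβ x hx, hβt x hx, Real.tanh_eq_sinh_div_cosh]
      field_simp
  · subst hC
    have hinv : ∀ x ∈ I, (β x)⁻¹ + x = (β x₀)⁻¹ + x₀ := fun x hx =>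
      eq_of_deriv_zero (f := fun y => (β y)⁻¹ + y) hI hI' (fun y hy =>
        (((hβ y hy).fun_inv (hβ0 y hy)).add (hasDerivAt_id y)).congr_deriv (by
          have := hβ0 y hy
          field_simp; ring)) hx hx₀
    have hβe : ∀ x ∈ I, 1 * x + -((β x₀)⁻¹ + x₀) = -(β x)⁻¹ := fun x hx => by
      rw [← hinv x hx]; ring
    refine ⟨_, _, _, .square κ hκ, maps_of_stationary (β := fun y => -(1 / y)) 1
      (-((β x₀)⁻¹ + x₀)) one_ne_zero (fun x hx => ?_) (fun t ht x hx u hu => ?_) hη⟩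
    · have := hβ0 x hx
      rw [hβe x hx, hkβ x hx]
      field_simp
    · have := hβ0 x hx
      rw [hβe x hx, hξ t ht x hx u hu]
      field_simp
  · obtain ⟨μ, hμ0, hμ⟩ : ∃ μ : ℝ, 0 < μ ∧ C = μ ^ 2 :=
      ⟨√C, Real.sqrt_pos.mpr hC, by rw [Real.sq_sqrt hC.le]⟩
    have hμ' := hμ0.ne'
    subst hμ
    -- Here `arctan(β/μ) - μx` is the first integral. Working with `arctan` also shows that `cos(μx
    -- + δ)` has no zeros on `I`.
    obtain ⟨δ, hδ⟩ : ∃ δ : ℝ, ∀ x ∈ I, Real.arctan (β x / μ) = μ * x + δ :=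
      ⟨_, fun x hx => sub_eq_iff_eq_add'.mp (eq_of_deriv_zero
        (f := fun y => Real.arctan (β y / μ) - μ * y) hI hI' (fun y hy =>
          ((((hβ y hy).div_const μ).arctan).sub ((hasDerivAt_id y).const_mul μ)).congr_deriv (by
            have : μ ^ 2 + β y ^ 2 ≠ 0 := by positivity
            field_simp
            ring)) hx hx₀)⟩
    have hβt : ∀ x ∈ I, β x = μ * Real.tan (μ * x + δ) := fun x hx => by
      rw [← hδ x hx, Real.tan_arctan]; field_simp
    have hc : ∀ x ∈ I, Real.cos (μ * x + δ) ≠ 0 := fun x hx => by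
      rw [← hδ x hx]; exact (Real.cos_arctan_pos _).ne'
    have hs : ∀ x ∈ I, Real.sin (μ * x + δ) ≠ 0 := fun x hx h0 => hβ0 x hx (by
      rw [hβt x hx, Real.tan_eq_sin_div_cos, h0]; simp)
    -- The shift by `π/2` converts `tan` into `-cot`.
    refine ⟨_, _, _, .tan (κ / μ ^ 4) (div_ne_zero hκ (pow_ne_zero 4 hμ')),
      maps_of_stationary (β := fun y => -Real.cot y) μ (δ + Real.pi / 2) hμ' (fun x hx => ?_)
        (fun t ht x hx u hu => ?_) hη⟩
    · have h1 := hc x hx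
      have h2 := hs x hx
      rw [hkβ x hx, hβt x hx, ← add_assoc, Real.tan_eq_sin_div_cos, Real.tan_eq_sin_div_cos,
        Real.sin_add_pi_div_two, Real.cos_add_pi_div_two]
      field_simp
    · rw [hξ t ht x hx u hu, hβt x hx, ← add_assoc, Real.tan_eq_sin_div_cos,
        Real.cot_eq_cos_div_sin, Real.sin_add_pi_div_two, Real.cos_add_pi_div_two]
      ring

theorem canonical_of_const {T I U : Set ℝ} {k : ℝ → ℝ} {ξ η : Fun3} {μ : ℝ} (hμ : μ ≠ 0)
    (h : ∀ t ∈ T, ∀ x ∈ I, ∀ u ∈ U, k x = 2 * μ ^ 2 ∧ ξ t x u = μ * (3 * u - 1) ∧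
      η t x u = -(3 * μ ^ 2) * u ^ 2 * (u - 1)) (hT : T.Nonempty) (hU : U.Nonempty) :
    ∃ (g : EquivTransf) (K : ℝ → ℝ) (R : Operator),
      CanonicalPair K R ∧ g.Maps T I U k (.unitTime ξ η) K R := by
  obtain ⟨t₀, ht₀⟩ := hT
  obtain ⟨u₀, hu₀⟩ := hU
  -- Matching `c²/2 = 2μ²` with `c > 0` gives `c = 2|μ|`; the sign of `μ` selects the branch.
  rcases hμ.lt_or_gt with hneg | hpos
  · refine ⟨⟨1, 0, 0, one_ne_zero⟩, _, _, .const_neg (-2 * μ) (by linarith), fun x hx => ?_,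
      fun _ _ _ => 1, fun t ht x hx u hu => ⟨one_ne_zero, ?_, ?_, ?_⟩⟩
    · simp only [(h t₀ ht₀ x hx u₀ hu₀).1]; ring
    · simp [Operator.unitTime]
    · simp only [Operator.unitTime, (h t ht x hx u hu).2.1]; ring
    · simp only [Operator.unitTime, (h t ht x hx u hu).2.2]; ring
  · refine ⟨⟨1, 0, 0, one_ne_zero⟩, _, _, .const_pos (2 * μ) (by linarith), fun x hx => ?_,
      fun _ _ _ => 1, fun t ht x hx u hu => ⟨one_ne_zero, ?_, ?_, ?_⟩⟩
    · simp only [(h t₀ ht₀ x hx u₀ hu₀).1]; ring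
    · simp [Operator.unitTime]
    · simp only [Operator.unitTime, (h t ht x hx u hu).2.1]; ring
    · simp only [Operator.unitTime, (h t ht x hx u hu).2.2]; ring

theorem canonical_of_invSquare {T I U : Set ℝ} {k : ℝ → ℝ} {ξ η : Fun3} {δ : ℝ}
    (h : ∀ t ∈ T, ∀ x ∈ I, ∀ u ∈ U, x + δ ≠ 0 ∧ k x = 2 / (x + δ) ^ 2 ∧
      ξ t x u = 3 / (x + δ) * (u - 1) ∧ η t x u = -(3 / (x + δ) ^ 2) * u * (u - 1) ^ 2)
    (hT : T.Nonempty) (hU : U.Nonempty) :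
    ∃ (g : EquivTransf) (K : ℝ → ℝ) (R : Operator),
      CanonicalPair K R ∧ g.Maps T I U k (.unitTime ξ η) K R := by
  obtain ⟨t₀, ht₀⟩ := hT
  obtain ⟨u₀, hu₀⟩ := hU
  refine ⟨⟨1, 0, δ, one_ne_zero⟩, _, _, .invSquare, fun x hx => ?_,
    fun _ _ _ => 1, fun t ht x hx u hu => ⟨one_ne_zero, ?_, ?_, ?_⟩⟩
  · simp only [(h t₀ ht₀ x hx u₀ hu₀).2.1]; ring
  · simp [Operator.unitTime]
  · simp only [Operator.unitTime, (h t ht x hx u hu).2.2.1]; ring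
  · simp only [Operator.unitTime, (h t ht x hx u hu).2.2.2]; ring

/-! ### The converse: invariance and inequivalence to Lie symmetries. -/

/-- Bootstrap: the right-hand side is as regular as `β`, so each step gains one derivative. -/
theorem smooth_of_riccati {β : ℝ → ℝ} {I : Set ℝ} (hI : IsOpen I) {C : ℝ}
    (hβ : ∀ x ∈ I, HasDerivAt β (β x ^ 2 + C) x) : ContDiffOn ℝ ∞ β I := by
  rw [contDiffOn_infty]
  intro n
  induction n with
  | zero => exact contDiffOn_zero.mpr fun x hx => (hβ x hx).continuousAt.continuousWithinAt
  | succ n ih =>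
    push_cast
    rw [contDiffOn_succ_iff_deriv_of_isOpen hI]
    refine ⟨fun x hx => (hβ x hx).differentiableAt.differentiableWithinAt, by simp, ?_⟩
    exact ((ih.pow 2).add contDiffOn_const).congr fun x hx => (hβ x hx).deriv

/-- The determining equations for stationary coefficients that are polynomial in `u`. -/
theorem determining_of_stationary {T I U : Set ℝ} (hT : IsOpen T) (hI : IsOpen I) (hU : IsOpen U)
    {k : ℝ → ℝ} {ξ η : Fun3} {a b A B c : ℝ → ℝ}
    (ha : ContDiffOn ℝ ∞ a I) (hb : ContDiffOn ℝ ∞ b I) (hA : ContDiffOn ℝ ∞ A I)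
    (hB : ContDiffOn ℝ ∞ B I) (hc : ContDiffOn ℝ ∞ c I)
    (hξ : ∀ t ∈ T, ∀ x ∈ I, ∀ u ∈ U, ξ t x u = a x * u + b x)
    (hη : ∀ t ∈ T, ∀ x ∈ I, ∀ u ∈ U, η t x u = A x * u ^ 3 + B x * u ^ 2 + c x * u)
    {t x u : ℝ} (ht : t ∈ T) (hx : x ∈ I) (hu : u ∈ U)
    (h2 : 6 * A x * u + 2 * B x = 2 * deriv a x - 2 * (a x * u + b x) * a x)
    (h1 : 2 * a x * (A x * u ^ 3 + B x * u ^ 2 + c x * u) - 3 * a x * (k x * (u ^ 2 - u ^ 3))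
      - 2 * (3 * deriv A x * u ^ 2 + 2 * deriv B x * u + deriv c x)
      + (deriv (deriv a) x * u + deriv (deriv b) x)
      - 2 * (a x * u + b x) * (deriv a x * u + deriv b x) = 0)
    (h0 : -(deriv (deriv A) x * u ^ 3 + deriv (deriv B) x * u ^ 2 + deriv (deriv c) x * u)
      + (3 * A x * u ^ 2 + 2 * B x * u + c x) * (k x * (u ^ 2 - u ^ 3))
      + 2 * (deriv a x * u + deriv b x)
        * (A x * u ^ 3 + B x * u ^ 2 + c x * u - k x * (u ^ 2 - u ^ 3))
      - (a x * u + b x) * deriv k x * (u ^ 2 - u ^ 3)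
      - (A x * u ^ 3 + B x * u ^ 2 + c x * u) * k x * (2 * u - 3 * u ^ 2) = 0) :
    Determining k ξ η t x u := by
  have hξu : ∀ y ∈ I, ∀ v ∈ U, pdu ξ t y v = a y := fun y hy v hv =>
    (hasDerivAt_of_eqOn hU (hξ t ht y hy) hv
      (((hasDerivAt_id v).const_mul (a y)).add_const (b y))).deriv.trans (mul_one _)
  have hξuu : pdu (pdu ξ) t x u = 0 :=
    (deriv_eq_of_eqOn hU (hξu x hx) hu).trans (deriv_const _ _)
  have hξux : pdx (pdu ξ) t x u = deriv a x :=
    deriv_eq_of_eqOn hI (fun y hy => hξu y hy u hu) hx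
  have hξx : ∀ y ∈ I, pdx ξ t y u = deriv a y * u + deriv b y := fun y hy =>
    (hasDerivAt_of_eqOn hI (fun y hy => hξ t ht y hy u hu) hy
      (((smooth_hasDerivAt hI ha hy).mul_const u).add (smooth_hasDerivAt hI hb hy))).deriv
  have hξxx : pdx (pdx ξ) t x u = deriv (deriv a) x * u + deriv (deriv b) x :=
    (hasDerivAt_of_eqOn hI hξx hx (((smooth_hasDerivAt hI (smooth_deriv hI ha) hx).mul_const u).add
      (smooth_hasDerivAt hI (smooth_deriv hI hb) hx))).deriv
  have hξt : pdt ξ t x u = 0 :=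
    (deriv_eq_of_eqOn hT (fun s hs => hξ s hs x hx u hu) ht).trans (deriv_const _ _)
  have hηt : pdt η t x u = 0 :=
    (deriv_eq_of_eqOn hT (fun s hs => hη s hs x hx u hu) ht).trans (deriv_const _ _)
  have hηu : ∀ y ∈ I, ∀ v ∈ U, pdu η t y v = 3 * A y * v ^ 2 + 2 * B y * v + c y :=
    fun y hy v hv => by
      refine (hasDerivAt_of_eqOn hU (hη t ht y hy) hv (((((hasDerivAt_id v).fun_pow 3).const_mul
        _).add (((hasDerivAt_id v).fun_pow 2).const_mul _)).add
        ((hasDerivAt_id v).const_mul _))).deriv.trans ?_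
      simp; ring
  have hηuu : pdu (pdu η) t x u = 6 * A x * u + 2 * B x := by
    refine (hasDerivAt_of_eqOn hU (hηu x hx) hu (((((hasDerivAt_id u).fun_pow 2).const_mul _).add
      ((hasDerivAt_id u).const_mul _)).add_const _)).deriv.trans ?_
    simp; ring
  have hηux : pdx (pdu η) t x u = 3 * deriv A x * u ^ 2 + 2 * deriv B x * u + deriv c x :=
    (hasDerivAt_of_eqOn hI (fun y hy => hηu y hy u hu) hx
      (((((smooth_hasDerivAt hI hA hx).const_mul 3).mul_const _).add
      (((smooth_hasDerivAt hI hB hx).const_mul 2).mul_const _)).add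
      (smooth_hasDerivAt hI hc hx))).deriv
  have hηx : ∀ y ∈ I, pdx η t y u = deriv A y * u ^ 3 + deriv B y * u ^ 2 + deriv c y * u :=
    fun y hy => (hasDerivAt_of_eqOn hI (fun y hy => hη t ht y hy u hu) hy
      ((((smooth_hasDerivAt hI hA hy).mul_const _).add
      ((smooth_hasDerivAt hI hB hy).mul_const _)).add
      ((smooth_hasDerivAt hI hc hy).mul_const u))).deriv
  have hηxx : pdx (pdx η) t x u
      = deriv (deriv A) x * u ^ 3 + deriv (deriv B) x * u ^ 2 + deriv (deriv c) x * u :=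
    (hasDerivAt_of_eqOn hI hηx hx
      ((((smooth_hasDerivAt hI (smooth_deriv hI hA) hx).mul_const _).add
      ((smooth_hasDerivAt hI (smooth_deriv hI hB) hx).mul_const _)).add
      ((smooth_hasDerivAt hI (smooth_deriv hI hc) hx).mul_const u))).deriv
  refine ⟨hξuu, ?_, ?_, ?_⟩
  · rw [hηuu, hξux, hξu x hx u hu, hξ t ht x hx u hu, h2]
  · rw [hξt, hξu x hx u hu, hξ t ht x hx u hu, hη t ht x hx u hu, hηux, hξxx, hξx x hx]
    linear_combination h1
  · rw [hηt, hηxx, hηu x hx u hu, hξx x hx, hξ t ht x hx u hu, hη t ht x hx u hu]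
    linear_combination h0

theorem smoothOn_of_stationary {T I U : Set ℝ} {ξ η : Fun3} {a b A B c : ℝ → ℝ}
    (ha : ContDiffOn ℝ ∞ a I) (hb : ContDiffOn ℝ ∞ b I) (hA : ContDiffOn ℝ ∞ A I)
    (hB : ContDiffOn ℝ ∞ B I) (hc : ContDiffOn ℝ ∞ c I)
    (hξ : ∀ t ∈ T, ∀ x ∈ I, ∀ u ∈ U, ξ t x u = a x * u + b x)
    (hη : ∀ t ∈ T, ∀ x ∈ I, ∀ u ∈ U, η t x u = A x * u ^ 3 + B x * u ^ 2 + c x * u) :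
    (Operator.unitTime ξ η).SmoothOn T I U := by
  have hx : ∀ f : ℝ → ℝ, ContDiffOn ℝ ∞ f I →
      ContDiffOn ℝ ∞ (fun p : ℝ × ℝ × ℝ => f p.2.1) (T ×ˢ I ×ˢ U) := fun f hf =>
    hf.comp (f := fun p : ℝ × ℝ × ℝ => p.2.1) (by fun_prop) fun p hp => hp.2.1
  have hu : ContDiffOn ℝ ∞ (fun p : ℝ × ℝ × ℝ => p.2.2) (T ×ˢ I ×ˢ U) := by fun_prop
  refine ⟨contDiffOn_const, ?_, ?_⟩
  · exact (((hx a ha).mul hu).add (hx b hb)).congr fun p hp => hξ _ hp.1 _ hp.2.1 _ hp.2.2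
  · exact ((((hx A hA).mul (hu.pow 3)).add ((hx B hB).mul (hu.pow 2))).add
      ((hx c hc).mul hu)).congr fun p hp => hη _ hp.1 _ hp.2.1 _ hp.2.2

/-- For a Lie symmetry `τ` depends only on `t`, `ξ` does not depend on `u`, and `τ_t = 2 ξ_x`. -/
theorem IsLieSymmetry.coefficients {T I U : Set ℝ} (hI : IsOpen I) (hU : IsOpen U) {k : ℝ → ℝ}
    (hk : ∀ x ∈ I, DifferentiableAt ℝ k x) {R : Operator}
    (h : IsLieSymmetry (huxley k) R T I U) {t x u : ℝ} (ht : t ∈ T) (hx : x ∈ I) (hu : u ∈ U) :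
    pdx R.τ t x u = 0 ∧ pdu R.τ t x u = 0 ∧ pdu R.ξ t x u = 0 ∧
      pdt R.τ t x u = 2 * pdx R.ξ t x u := by
  -- On `L = 0` the coordinates `u_x = p`, `u_t = q`, `u_tx = r` are free. Evaluating at 0 and 1
  -- extracts coefficients by finite differences.
  have key : ∀ y ∈ I, ∀ v ∈ U, ∀ p q r : ℝ, _ := fun y hy v hv p q r => by
    let j : Jet := ⟨t, y, v, q, p, 0, r, q - k y * v ^ 2 * (1 - v)⟩
    have h1 := h.2 j ⟨ht, hy, hv⟩ (by simp only [huxley, j]; ring)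
    rw [prolong_huxley _ (hk y hy).hasDerivAt] at h1
    simp only [Operator.ηt, Operator.ηxx, Dt, Dx, Dxx, ev, j] at h1
    exact h1
  -- The coefficient of `u_tx` is `2 D_x τ = 2 (τ_x + τ_u u_x)`.
  have hτ : ∀ y ∈ I, ∀ v ∈ U, pdx R.τ t y v = 0 ∧ pdu R.τ t y v = 0 := fun y hy v hv => by
    have h00 := key y hy v hv 0 0 0
    have h01 := key y hy v hv 0 0 1
    have h10 := key y hy v hv 1 0 0
    have h11 := key y hy v hv 1 0 1
    have hx0 : pdx R.τ t y v = 0 := by linear_combination (h01 - h00) / 2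
    exact ⟨hx0, by linear_combination (h11 - h10) / 2 - hx0⟩
  obtain ⟨hτx, hτu⟩ := hτ x hx u hu
  have hτxx : pdx (pdx R.τ) t x u = 0 :=
    (deriv_eq_of_eqOn hI (fun y hy => (hτ y hy u hu).1) hx).trans (deriv_const _ _)
  have hτxu : pdx (pdu R.τ) t x u = 0 :=
    (deriv_eq_of_eqOn hI (fun y hy => (hτ y hy u hu).2) hx).trans (deriv_const _ _)
  have hτuu : pdu (pdu R.τ) t x u = 0 :=
    (deriv_eq_of_eqOn hU (fun v hv => (hτ x hx v hv).2) hu).trans (deriv_const _ _)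
  have h00 := key x hx u hu 0 0 0
  have h01 := key x hx u hu 0 1 0
  have h10 := key x hx u hu 1 0 0
  have h11 := key x hx u hu 1 1 0
  rw [hτxx, hτxu, hτuu, hτx, hτu] at h00 h01 h10 h11
  refine ⟨hτx, hτu, ?_, ?_⟩
  -- The mixed difference isolates the coefficient `2 ξ_u` of `u_x u_t`; the next one isolates the
  -- coefficient `2 ξ_x - τ_t` of `u_t`.
  · linear_combination (h11 - h10 - h01 + h00) / 2
  · linear_combination h00 - h01

/-- The ratio `ξ/τ` is unchanged by multipliers, and for a Lie symmetry it does not depend on `u`.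
-/
theorem not_isEquivToLie_of_pdu_ne_zero {T I U : Set ℝ} (hI : IsOpen I) (hU : IsOpen U)
    {k : ℝ → ℝ} (hk : ∀ x ∈ I, DifferentiableAt ℝ k x) {ξ η : Fun3} {t x u : ℝ} (ht : t ∈ T)
    (hx : x ∈ I) (hu : u ∈ U) {ξ' : ℝ} (hξ : HasDerivAt (fun v => ξ t x v) ξ' u) (hξ' : ξ' ≠ 0) :
    ¬ IsEquivToLie (huxley k) (Operator.unitTime ξ η) T I U := by
  rintro ⟨R, hR, m, hm⟩
  obtain ⟨-, h1, h2, -⟩ := hR.coefficients hI hU hk ht hx hu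
  have hτ := smooth_hasDerivAt hU (slice_u hR.1.1 ht hx) hu
  have h3 : deriv (R.ξ t x) u = _ := (hasDerivAt_of_eqOn hU (g := fun v => R.τ t x v * ξ t x v)
    (fun v hv => by
      obtain ⟨-, e1, e2, -⟩ := hm t ht x hx v hv
      simp only [Operator.unitTime, mul_one] at e1 e2
      rw [e2, e1]) hu (hτ.fun_mul hξ)).deriv
  have h1' : deriv (fun v => R.τ t x v) u = 0 := h1
  have h2' : deriv (R.ξ t x) u = 0 := h2
  rw [h2', h1', zero_mul, zero_add] at h3
  obtain ⟨m0, e1, -, -⟩ := hm t ht x hx u hu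
  refine mul_ne_zero (?_ : R.τ t x u ≠ 0) hξ' h3.symm
  rw [e1]
  simpa [Operator.unitTime] using m0

/-- An equivalent Lie symmetry would have `ξ = τ(t) β(x)` and `τ_t = 2 τ β'`, so `β'` would be
constant. Differentiating `β' = β² + C` then gives `2ββ' = 0`, which fails at a point where `β² + C
≠ 0`. -/
theorem not_isEquivToLie_of_riccati {T I U : Set ℝ} (hT : IsOpen T) (hT' : T.Nonempty)
    (hI : IsOpen I) (hI' : IsConnected I) (hU : IsOpen U) (hU' : U.Nonempty)
    {k : ℝ → ℝ} (hk : ∀ x ∈ I, DifferentiableAt ℝ k x) {ξ η : Fun3} {β : ℝ → ℝ} {C : ℝ}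
    (hξ : ∀ t ∈ T, ∀ x ∈ I, ∀ u ∈ U, ξ t x u = β x) (hβ0 : ∀ x ∈ I, β x ≠ 0)
    (hβ : ∀ x ∈ I, HasDerivAt β (β x ^ 2 + C) x) (hne : ∃ x ∈ I, β x ^ 2 + C ≠ 0) :
    ¬ IsEquivToLie (huxley k) (Operator.unitTime ξ η) T I U := by
  rintro ⟨R, hR, m, hm⟩
  obtain ⟨t, ht⟩ := hT'
  obtain ⟨u, hu⟩ := hU'
  obtain ⟨x₀, hx₀, hne⟩ := hne
  have hτc : ∀ s ∈ T, ∀ x ∈ I, R.τ s x u = R.τ s x₀ u := fun s hs x hx =>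
    eq_of_deriv_zero (f := fun y => R.τ s y u) hI hI' (fun y hy =>
      (smooth_hasDerivAt hI (slice_x hR.1.1 hs hu) hy).congr_deriv
        (hR.coefficients hI hU hk hs hy hu).1) hx hx₀
  have hτt : ∀ x ∈ I, pdt R.τ t x u = pdt R.τ t x₀ u := fun x hx =>
    deriv_eq_of_eqOn hT (fun s hs => hτc s hs x hx) ht
  have hτ0 : R.τ t x₀ u ≠ 0 := by
    obtain ⟨m0, e1, -, -⟩ := hm t ht x₀ hx₀ u hu
    rw [e1]
    simpa [Operator.unitTime] using m0
  have hξx : ∀ x ∈ I, pdx R.ξ t x u = R.τ t x₀ u * (β x ^ 2 + C) := fun x hx =>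
    (hasDerivAt_of_eqOn hI (g := fun y => R.τ t x₀ u * β y) (fun y hy => by
      obtain ⟨-, e1, e2, -⟩ := hm t ht y hy u hu
      simp only [Operator.unitTime, mul_one] at e1 e2
      rw [e2, ← e1, hτc t ht y hy, hξ t ht y hy u hu]) hx ((hβ x hx).const_mul _)).deriv
  have hc : ∀ x ∈ I, β x ^ 2 + C - (β x₀ ^ 2 + C) = 0 := fun x hx => by
    have h1 := (hR.coefficients hI hU hk ht hx hu).2.2.2
    have h2 := (hR.coefficients hI hU hk ht hx₀ hu).2.2.2
    rw [hτt x hx, hξx x hx] at h1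
    rw [hξx x₀ hx₀] at h2
    exact mul_left_cancel₀ hτ0 (by linear_combination (h2 - h1) / 2)
  have h3 := deriv_zero_of_eqOn hI hc hx₀ ((((hβ x₀ hx₀).fun_pow 2).add_const C).sub_const _)
  push_cast at h3
  exact mul_ne_zero (hβ0 x₀ hx₀) hne (by linear_combination h3 / 2)

/-- Two consequences carry the verification: `β'' = 2ββ'`, from the Riccati equation, and `2kβ' +
βk' = 0`, from the constancy of `kβ²`. -/
theorem nonclassical_of_riccati {T I U : Set ℝ} (hT : IsOpen T) (hT' : T.Nonempty)
    (hI : IsOpen I) (hI' : IsConnected I) (hU : IsOpen U) (hU' : U.Nonempty)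
    {k : ℝ → ℝ} (hk : ContDiffOn ℝ ∞ k I) {ξ η : Fun3} {β : ℝ → ℝ} {C κ : ℝ}
    (hξ : ∀ t ∈ T, ∀ x ∈ I, ∀ u ∈ U, ξ t x u = β x)
    (hη : ∀ t ∈ T, ∀ x ∈ I, ∀ u ∈ U, η t x u = 0) (hβ0 : ∀ x ∈ I, β x ≠ 0)
    (hβ : ∀ x ∈ I, HasDerivAt β (β x ^ 2 + C) x) (hkβ : ∀ x ∈ I, k x * β x ^ 2 = κ)
    (hne : ∃ x ∈ I, β x ^ 2 + C ≠ 0) :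
    IsNonclassicalSymmetry (huxley k) (Operator.unitTime ξ η) T I U ∧
      ¬ IsEquivToLie (huxley k) (Operator.unitTime ξ η) T I U := by
  have hkd : ∀ x ∈ I, HasDerivAt k (deriv k x) x := fun x hx => smooth_hasDerivAt hI hk hx
  have hβs := smooth_of_riccati hI hβ
  have hξ' : ∀ t ∈ T, ∀ x ∈ I, ∀ u ∈ U, ξ t x u = 0 * u + β x := fun t ht x hx u hu => by
    rw [hξ t ht x hx u hu]; ring
  have hη' : ∀ t ∈ T, ∀ x ∈ I, ∀ u ∈ U, η t x u = 0 * u ^ 3 + 0 * u ^ 2 + 0 * u :=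
    fun t ht x hx u hu => by rw [hη t ht x hx u hu]; ring
  refine ⟨?_, not_isEquivToLie_of_riccati hT hT' hI hI' hU hU'
    (fun x hx => (hkd x hx).differentiableAt) hξ hβ0 hβ hne⟩
  rw [isNonclassicalSymmetry_unitTime_iff fun x hx => (hkd x hx).differentiableAt]
  refine ⟨smoothOn_of_stationary (a := fun _ => 0) (A := fun _ => 0) (B := fun _ => 0)
    (c := fun _ => 0) contDiffOn_const hβs contDiffOn_const contDiffOn_const contDiffOn_const
    hξ' hη', fun t ht x hx u hu => ?_⟩
  have hβ2 : deriv (deriv β) x = 2 * β x * (β x ^ 2 + C) := by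
    rw [deriv_eq_of_eqOn hI (fun y hy => (hβ y hy).deriv) hx,
      (((hβ x hx).fun_pow 2).add_const C).deriv]
    push_cast; ring
  have hk1 : 2 * k x * (β x ^ 2 + C) + β x * deriv k x = 0 := by
    have h1 := deriv_zero_of_eqOn hI (f := fun y => k y * β y ^ 2 - κ)
      (fun y hy => by rw [hkβ y hy, sub_self]) hx
      (((hkd x hx).fun_mul ((hβ x hx).fun_pow 2)).sub_const κ)
    push_cast at h1
    exact mul_left_cancel₀ (hβ0 x hx) (by linear_combination h1)
  refine determining_of_stationary hT hI hU (a := fun _ => 0) (A := fun _ => 0) (B := fun _ => 0)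
    (c := fun _ => 0) contDiffOn_const hβs contDiffOn_const contDiffOn_const contDiffOn_const
    hξ' hη' ht hx hu ?_ ?_ ?_
  · simp
  · simp only [deriv_const', hβ2, (hβ x hx).deriv]; ring
  · simp only [deriv_const', (hβ x hx).deriv]
    linear_combination -(u ^ 2 - u ^ 3) * hk1

/-- The parameter `ν` is the constant value of `W = m'/m²`. The values `ν = 0` and `ν = -1` treat
the constant and the inverse-square coefficient together, with `b` and `c` as in
`quasilinear_system`. -/
theorem nonclassical_of_quasilinear {T I U : Set ℝ} (hT : IsOpen T) (hT' : T.Nonempty)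
    (hI : IsOpen I) (hI' : I.Nonempty) (hU : IsOpen U) (hU' : U.Nonempty)
    {k : ℝ → ℝ} {ξ η : Fun3} {m : ℝ → ℝ} {ν : ℝ} (hν : ν * (ν + 1) = 0)
    (hms : ContDiffOn ℝ ∞ m I) (hm : ∀ x ∈ I, HasDerivAt m (ν * m x ^ 2) x)
    (hm0 : ∀ x ∈ I, m x ≠ 0) (hk : ∀ x ∈ I, k x = 2 * m x ^ 2)
    (hξ : ∀ t ∈ T, ∀ x ∈ I, ∀ u ∈ U, ξ t x u = 3 * m x * u + (2 * ν - 1) * m x)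
    (hη : ∀ t ∈ T, ∀ x ∈ I, ∀ u ∈ U, η t x u
      = -3 * m x ^ 2 * u ^ 3 + 3 * (1 - ν) * m x ^ 2 * u ^ 2 + 3 * ν * m x ^ 2 * u) :
    IsNonclassicalSymmetry (huxley k) (Operator.unitTime ξ η) T I U ∧
      ¬ IsEquivToLie (huxley k) (Operator.unitTime ξ η) T I U := by
  have hkd : ∀ x ∈ I, HasDerivAt k (4 * ν * m x ^ 3) x := fun x hx =>
    hasDerivAt_of_eqOn hI hk hx ((((hm x hx).fun_pow 2).const_mul 2).congr_deriv (by
      push_cast; ring))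
  have hk' : ∀ x ∈ I, DifferentiableAt ℝ k x := fun x hx => (hkd x hx).differentiableAt
  have l1 : ∀ α : ℝ, ∀ x ∈ I, deriv (fun y => α * m y) x = α * (ν * m x ^ 2) := fun α x hx =>
    ((hm x hx).const_mul α).deriv
  have l2 : ∀ α : ℝ, ∀ x ∈ I, deriv (deriv fun y => α * m y) x = α * (2 * ν ^ 2 * m x ^ 3) :=
    fun α x hx => (deriv_eq_of_eqOn hI (l1 α) hx).trans
      (((((hm x hx).fun_pow 2).const_mul ν).const_mul α).congr_deriv (by push_cast; ring)).deriv
  have q1 : ∀ α : ℝ, ∀ x ∈ I, deriv (fun y => α * m y ^ 2) x = α * (2 * ν * m x ^ 3) :=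
    fun α x hx => ((((hm x hx).fun_pow 2).const_mul α).congr_deriv (by push_cast; ring)).deriv
  have q2 : ∀ α : ℝ, ∀ x ∈ I,
      deriv (deriv fun y => α * m y ^ 2) x = α * (6 * ν ^ 2 * m x ^ 4) :=
    fun α x hx => (deriv_eq_of_eqOn hI (q1 α) hx).trans
      (((((hm x hx).fun_pow 3).const_mul (2 * ν)).const_mul α).congr_deriv (by
        push_cast; ring)).deriv
  have c1 : ∀ α : ℝ, ContDiffOn ℝ ∞ (fun y => α * m y) I := fun α => contDiffOn_const.mul hms
  have c2 : ∀ α : ℝ, ContDiffOn ℝ ∞ (fun y => α * m y ^ 2) I := fun α =>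
    contDiffOn_const.mul (hms.pow 2)
  constructor
  · rw [isNonclassicalSymmetry_unitTime_iff hk']
    refine ⟨smoothOn_of_stationary (c1 3) (c1 (2 * ν - 1)) (c2 (-3)) (c2 (3 * (1 - ν)))
      (c2 (3 * ν)) hξ hη, fun t ht x hx u hu => ?_⟩
    refine determining_of_stationary hT hI hU (c1 3) (c1 (2 * ν - 1)) (c2 (-3))
      (c2 (3 * (1 - ν))) (c2 (3 * ν)) hξ hη ht hx hu ?_ ?_ ?_
    -- This equation holds for every `ν`; the other two need `ν (ν + 1) = 0`.
    · rw [l1 _ x hx]; ring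
    · rw [l1 _ x hx, l1 _ x hx, l2 _ x hx, l2 _ x hx, q1 _ x hx, q1 _ x hx, q1 _ x hx, hk x hx]
      rcases mul_eq_zero.mp hν with h | h
      · rw [h]; ring
      · rw [eq_neg_of_add_eq_zero_left h]; ring
    · rw [l1 _ x hx, l1 _ x hx, q2 _ x hx, q2 _ x hx, q2 _ x hx, (hkd x hx).deriv, hk x hx]
      rcases mul_eq_zero.mp hν with h | h
      · rw [h]; ring
      · rw [eq_neg_of_add_eq_zero_left h]; ring
  · obtain ⟨t, ht⟩ := hT'
    obtain ⟨x, hx⟩ := hI'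
    obtain ⟨u, hu⟩ := hU'
    refine not_isEquivToLie_of_pdu_ne_zero hI hU hk' ht hx hu (ξ' := 3 * m x * 1)
      (hasDerivAt_of_eqOn hU (hξ t ht x hx) hu
        (((hasDerivAt_id u).const_mul (3 * m x)).add_const _)) ?_
    have := hm0 x hx
    positivity

/-- Both operators have `τ = 1`, so the multiplier must be `ε₁⁻²` and can be eliminated. -/
theorem EquivTransf.Maps.unitTime {g : EquivTransf} {T I U : Set ℝ} {k K : ℝ → ℝ}
    {ξ η ξ' η' : Fun3} (h : g.Maps T I U k (.unitTime ξ η) K (.unitTime ξ' η')) :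
    (∀ x ∈ I, k x = g.ε₁ ^ 2 * K (g.ε₁ * x + g.ε₃)) ∧
    ∀ t ∈ T, ∀ x ∈ I, ∀ u ∈ U,
      ξ t x u = g.ε₁ * ξ' (g.ε₁ ^ 2 * t + g.ε₂) (g.ε₁ * x + g.ε₃) u ∧
      η t x u = g.ε₁ ^ 2 * η' (g.ε₁ ^ 2 * t + g.ε₂) (g.ε₁ * x + g.ε₃) u := by
  have hε := g.ε₁_ne_zero
  obtain ⟨hK, m, hm⟩ := h
  refine ⟨fun x hx => ?_, fun t ht x hx u hu => ?_⟩
  · rw [hK x hx]; field_simp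
  · obtain ⟨-, h1, h2, h3⟩ := hm t ht x hx u hu
    simp only [Operator.unitTime, mul_one] at h1 h2 h3
    rw [h2, h3]
    constructor
    · linear_combination ξ t x u * h1
    · linear_combination η t x u * h1

/-- The Riccati equation is covariant under `β ↦ ε β(εx + δ)`, `C ↦ ε² C`. Conditions on `β` are
needed only where `K ≠ 0`, because `k` has no zeros on `I`. In the canonical pairs division by zero
yields `K = 0` at the singular points, so these are excluded as well. -/
theorem nonclassical_of_maps_riccati {g : EquivTransf} {T I U : Set ℝ}
    (hT : IsOpen T) (hT' : T.Nonempty) (hI : IsOpen I) (hI' : IsConnected I) (hU : IsOpen U)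
    (hU' : U.Nonempty) {k K : ℝ → ℝ} (hk : ContDiffOn ℝ ∞ k I) (hk0 : ∀ x ∈ I, k x ≠ 0)
    {ξ η : Fun3} {β : ℝ → ℝ} {C κ : ℝ}
    (h : g.Maps T I U k (.unitTime ξ η) K (.unitTime (fun _ x _ => β x) (fun _ _ _ => 0)))
    (hβ : ∀ y, K y ≠ 0 → β y ≠ 0 ∧ HasDerivAt β (β y ^ 2 + C) y ∧ K y * β y ^ 2 = κ ∧
      β y ^ 2 + C ≠ 0) :
    IsNonclassicalSymmetry (huxley k) (Operator.unitTime ξ η) T I U ∧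
      ¬ IsEquivToLie (huxley k) (Operator.unitTime ξ η) T I U := by
  have hε := g.ε₁_ne_zero
  obtain ⟨hK, hm⟩ := h.unitTime
  have hK0 : ∀ x ∈ I, K (g.ε₁ * x + g.ε₃) ≠ 0 := fun x hx h0 => hk0 x hx (by
    rw [hK x hx, h0, mul_zero])
  refine nonclassical_of_riccati hT hT' hI hI' hU hU' hk
    (β := fun x => g.ε₁ * β (g.ε₁ * x + g.ε₃)) (C := g.ε₁ ^ 2 * C) (κ := g.ε₁ ^ 4 * κ)
    (fun t ht x hx u hu => (hm t ht x hx u hu).1)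
    (fun t ht x hx u hu => by rw [(hm t ht x hx u hu).2, mul_zero])
    (fun x hx => mul_ne_zero hε (hβ _ (hK0 x hx)).1) (fun x hx => ?_) (fun x hx => ?_) ?_
  · have h1 := (hβ _ (hK0 x hx)).2.1
    have h2 := ((hasDerivAt_id x).const_mul g.ε₁).add_const g.ε₃
    exact ((HasDerivAt.comp x h1 h2).const_mul g.ε₁).congr_deriv (by ring)
  · rw [hK x hx, ← (hβ _ (hK0 x hx)).2.2.1]; ring
  · obtain ⟨x, hx⟩ := hI'.nonempty
    refine ⟨x, hx, fun h0 => ?_⟩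
    refine mul_ne_zero (pow_ne_zero 2 hε) (hβ _ (hK0 x hx)).2.2.2 ?_
    linear_combination h0

theorem nonclassical_of_canonicalPair {g : EquivTransf} {T I U : Set ℝ}
    (hT : IsOpen T) (hT' : T.Nonempty) (hI : IsOpen I) (hI' : IsConnected I) (hU : IsOpen U)
    (hU' : U.Nonempty) {k K : ℝ → ℝ} (hk : ContDiffOn ℝ ∞ k I) (hk0 : ∀ x ∈ I, k x ≠ 0)
    {ξ η : Fun3} {R : Operator} (hR : CanonicalPair K R)
    (h : g.Maps T I U k (.unitTime ξ η) K R) :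
    IsNonclassicalSymmetry (huxley k) (Operator.unitTime ξ η) T I U ∧
      ¬ IsEquivToLie (huxley k) (Operator.unitTime ξ η) T I U := by
  have hε := g.ε₁_ne_zero
  cases hR with
  | tan c hc =>
    refine nonclassical_of_maps_riccati (β := fun x => -Real.cot x) (C := 1) (κ := c)
      hT hT' hI hI' hU hU' hk hk0 h fun y hy => ?_
    have htan : Real.tan y ≠ 0 := fun h0 => hy (by rw [h0]; ring)
    rw [Real.tan_eq_sin_div_cos] at htan
    -- Nonvanishing of `tan` as a quotient excludes the zeros of `sin` and, through division by
    -- zero, those of `cos`.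
    obtain ⟨hs, hco⟩ := div_ne_zero_iff.mp htan
    have hsc := Real.sin_sq_add_cos_sq y
    have hd : HasDerivAt (fun x => -(Real.cos x / Real.sin x))
        ((-(Real.cos y / Real.sin y)) ^ 2 + 1) y := by
      refine (((Real.hasDerivAt_cos y).fun_div (Real.hasDerivAt_sin y) hs).fun_neg).congr_deriv ?_
      field_simp
      ring
    simp only [Real.cot_eq_cos_div_sin, Real.tan_eq_sin_div_cos]
    refine ⟨neg_ne_zero.mpr (div_ne_zero hco hs), hd, ?_, by positivity⟩
    field_simp
  | tanh c hc =>
    refine nonclassical_of_maps_riccati (β := fun x => -(Real.cosh x / Real.sinh x)) (C := -1)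
      (κ := c) hT hT' hI hI' hU hU' hk hk0 h fun y hy => ?_
    have hco := (Real.cosh_pos y).ne'
    have hs : Real.sinh y ≠ 0 := fun h0 => hy (by rw [Real.tanh_eq_sinh_div_cosh, h0]; ring)
    have hsc := Real.cosh_sq y
    refine ⟨neg_ne_zero.mpr (div_ne_zero hco hs), ?_, ?_, ?_⟩
    · refine (((Real.hasDerivAt_cosh y).fun_div
        (Real.hasDerivAt_sinh y) hs).fun_neg).congr_deriv ?_
      field_simp
      ring
    · rw [Real.tanh_eq_sinh_div_cosh]; field_simp
    · have h1 : (-(Real.cosh y / Real.sinh y)) ^ 2 + -1 = 1 / Real.sinh y ^ 2 := by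
        field_simp
        linear_combination hsc
      rw [h1]
      exact one_div_ne_zero (pow_ne_zero 2 hs)
  | coth c hc =>
    refine nonclassical_of_maps_riccati (β := fun x => -Real.tanh x) (C := -1)
      (κ := c) hT hT' hI hI' hU hU' hk hk0 h fun y hy => ?_
    have hco := (Real.cosh_pos y).ne'
    have hs : Real.sinh y ≠ 0 := fun h0 => hy (by rw [h0]; simp)
    have hsc := Real.cosh_sq y
    simp only [Real.tanh_eq_sinh_div_cosh]
    refine ⟨neg_ne_zero.mpr (div_ne_zero hs hco), ?_, ?_, ?_⟩
    · refine (((Real.hasDerivAt_sinh y).fun_div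
        (Real.hasDerivAt_cosh y) hco).fun_neg).congr_deriv ?_
      field_simp
      ring
    · field_simp
    · have h1 : (-(Real.sinh y / Real.cosh y)) ^ 2 + -1 = -1 / Real.cosh y ^ 2 := by
        field_simp
        linear_combination -hsc
      rw [h1]
      exact div_ne_zero (by norm_num) (pow_ne_zero 2 hco)
  | square c hc =>
    refine nonclassical_of_maps_riccati (β := fun x => -(1 / x)) (C := 0)
      (κ := c) hT hT' hI hI' hU hU' hk hk0 h fun y hy => ?_
    have hy0 : y ≠ 0 := fun h0 => hy (by rw [h0]; ring)
    refine ⟨neg_ne_zero.mpr (one_div_ne_zero hy0), ?_, ?_, ?_⟩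
    · refine (((hasDerivAt_const y (1 : ℝ)).fun_div (hasDerivAt_id y) hy0).fun_neg).congr_deriv ?_
      simp only [id]
      field_simp
      ring
    · field_simp
    · simpa using hy0
  | const_pos c hc =>
    obtain ⟨hK, hm⟩ := h.unitTime
    -- The relation `k = ε₁² c²/2 = 2m²` fixes `m` up to sign, and `ξ = m (3u - 1)` fixes the sign.
    -- A negative `ε₁` is allowed, as only `m ≠ 0` is required.
    refine nonclassical_of_quasilinear (ν := 0) (m := fun _ => g.ε₁ * (c / 2)) hT hT' hI
      hI'.nonempty hU hU' (by ring) contDiffOn_const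
      (fun x _ => (hasDerivAt_const x _).congr_deriv (by ring))
      (fun _ _ => mul_ne_zero hε (by positivity)) (fun x hx => ?_) (fun t ht x hx u hu => ?_)
      (fun t ht x hx u hu => ?_)
    · rw [hK x hx]; ring
    · rw [(hm t ht x hx u hu).1]; ring
    · rw [(hm t ht x hx u hu).2]; ring
  | const_neg c hc =>
    obtain ⟨hK, hm⟩ := h.unitTime
    refine nonclassical_of_quasilinear (ν := 0) (m := fun _ => -(g.ε₁ * (c / 2))) hT hT' hI
      hI'.nonempty hU hU' (by ring) contDiffOn_const
      (fun x _ => (hasDerivAt_const x _).congr_deriv (by ring))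
      (fun _ _ => neg_ne_zero.mpr (mul_ne_zero hε (by positivity))) (fun x hx => ?_)
      (fun t ht x hx u hu => ?_) (fun t ht x hx u hu => ?_)
    · rw [hK x hx]; ring
    · rw [(hm t ht x hx u hu).1]; ring
    · rw [(hm t ht x hx u hu).2]; ring
  | invSquare =>
    obtain ⟨hK, hm⟩ := h.unitTime
    have hy0 : ∀ x ∈ I, g.ε₁ * x + g.ε₃ ≠ 0 := fun x hx h0 => hk0 x hx (by
      rw [hK x hx, h0]; simp)
    have haff : ∀ x, HasDerivAt (fun x => g.ε₁ * x + g.ε₃) (g.ε₁ * 1) x := fun x =>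
      ((hasDerivAt_id x).const_mul g.ε₁).add_const g.ε₃
    refine nonclassical_of_quasilinear (ν := -1) (m := fun x => g.ε₁ / (g.ε₁ * x + g.ε₃)) hT hT'
      hI hI'.nonempty hU hU' (by ring)
      (contDiffOn_const.div (ContDiff.contDiffOn (by fun_prop)) hy0) (fun x hx => ?_)
      (fun x hx => div_ne_zero hε (hy0 x hx)) (fun x hx => ?_)
      (fun t ht x hx u hu => ?_) (fun t ht x hx u hu => ?_)
    · refine ((hasDerivAt_const x g.ε₁).fun_div (haff x) (hy0 x hx)).congr_deriv ?_
      have := hy0 x hx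
      field_simp
      ring
    · have := hy0 x hx
      rw [hK x hx]; field_simp
    · rw [(hm t ht x hx u hu).1]; ring
    · have := hy0 x hx
      rw [(hm t ht x hx u hu).2]; field_simp; ring

/-! ### Assembly of the classification. -/

theorem canonicalPair_of_nonclassical {T I U : Set ℝ} (hT : IsOpen T) (hT' : IsConnected T)
    (hI : IsOpen I) (hI' : IsConnected I) (hU : IsOpen U) (hU' : IsConnected U)
    {k : ℝ → ℝ} (hk : ContDiffOn ℝ ∞ k I) (hk0 : ∀ x ∈ I, k x ≠ 0) {ξ η : Fun3}
    (h : IsNonclassicalSymmetry (huxley k) (Operator.unitTime ξ η) T I U)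
    (hLie : ¬ IsEquivToLie (huxley k) (Operator.unitTime ξ η) T I U) :
    ∃ (g : EquivTransf) (K : ℝ → ℝ) (R : Operator),
      CanonicalPair K R ∧ g.Maps T I U k (.unitTime ξ η) K R := by
  rw [isNonclassicalSymmetry_unitTime_iff fun x hx =>
    (smooth_hasDerivAt hI hk hx).differentiableAt] at h
  obtain ⟨hs, hdet⟩ := h
  obtain ⟨a, b, c, d, hx, ht, hξη, he⟩ := coefficient_equations hT hI hU hU' hs hdet
  rcases quasilinear_dichotomy hT hT' hI hI' hk hk0 (fun t h => (hx t h).1) (fun x h => (ht x h).1)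
    (fun t ht x hx => (he t ht x hx).1) with ha | ha
  · have ha1 : ∀ t ∈ T, ∀ x ∈ I, deriv (a t) x = 0 := fun t ht x hx =>
      (deriv_eq_of_eqOn hI (ha t ht) hx).trans (deriv_const _ _)
    have hξ : ∀ t ∈ T, ∀ x ∈ I, ∀ u ∈ U, ξ t x u = b t x := fun t ht x hx u hu => by
      rw [(hξη t ht x hx u hu).1, ha t ht x hx]; ring
    obtain ⟨hη, hkb⟩ := semilinear_equations hT hI hU hU' hk0 hs hdet (fun t h => (hx t h).2.1) hξ
      fun t ht x hx => ⟨c t x, d t x, fun u hu => by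
        rw [(hξη t ht x hx u hu).2, ha t ht x hx, ha1 t ht x hx]; ring⟩
    -- Since `η = 0` on an open set of `u`, the coefficient `c` vanishes, and the `u`-free part of
    -- the third determining equation reduces to `b_t = b_xx - 2 b b_x`.
    have hc1 : ∀ t ∈ T, ∀ x ∈ I, deriv (c t) x = 0 := fun t ht x hx => by
      have hc0 : ∀ y ∈ I, c t y = 0 := fun y hy =>
        (coeffs_zero hU hU'.nonempty (c0 := d t y) (c1 := c t y) (c2 := 0) (c3 := 0) (c4 := 0)
          (c5 := 0) fun u hu => by
            have h1 := (hξη t ht y hy u hu).2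
            rw [hη t ht y hy u hu, ha t ht y hy, ha1 t ht y hy] at h1
            linear_combination -h1).2.1
      exact (deriv_eq_of_eqOn hI hc0 hx).trans (deriv_const _ _)
    rcases semilinear_classification hT hT' hI hI' hk hk0 (fun t h => (hx t h).2.1)
      (fun x h => (ht x h).2) hξ hη hkb (fun t ht x hx => by
        have h1 := (he t ht x hx).2.2.2
        rw [ha t ht x hx, hc1 t ht x hx] at h1
        linear_combination -h1) with h | ⟨β, C, κ, hκ, hξβ, hβ, hne⟩
    · exact absurd h hLie
    · exact canonical_of_riccati hI hI' hκ hξβ hη (fun x hx => (hβ x hx).1)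
        (fun x hx => (hβ x hx).2.1) (fun x hx => (hβ x hx).2.2) hne
  · rcases quasilinear_classification hT hT' hI hI' hU hU' hk0 hdet hx (fun x h => (ht x h).1) hξη
      (fun t ht x hx => (he t ht x hx).2.1) (fun t ht x hx => (he t ht x hx).2.2.1)
      (fun t ht x hx => (he t ht x hx).2.2.2) ha with ⟨μ, hμ, h⟩ | ⟨δ, h⟩
    · exact canonical_of_const hμ h hT'.nonempty hU'.nonempty
    · exact canonical_of_invSquare h hT'.nonempty hU'.nonempty

end Huxley

theorem theorem2 (T I U : Set ℝ)
    (hT : IsOpen T) (hT' : IsConnected T)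
    (hI : IsOpen I) (hI' : IsConnected I)
    (hU : IsOpen U) (hU' : IsConnected U)
    (k : ℝ → ℝ) (hk : ContDiffOn ℝ (⊤ : ℕ∞) k I) (hk0 : ∀ x ∈ I, k x ≠ 0)
    (ξ η : ℝ → ℝ → ℝ → ℝ) :
    (Huxley.IsNonclassicalSymmetry (Huxley.huxley k) (Huxley.Operator.unitTime ξ η) T I U ∧
      ¬ Huxley.IsEquivToLie (Huxley.huxley k) (Huxley.Operator.unitTime ξ η) T I U) ↔
    ∃ (g : Huxley.EquivTransf) (K : ℝ → ℝ) (R : Huxley.Operator),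
      Huxley.CanonicalPair K R ∧ g.Maps T I U k (Huxley.Operator.unitTime ξ η) K R := by
  constructor
  · rintro ⟨h, hLie⟩
    exact Huxley.canonicalPair_of_nonclassical hT hT' hI hI' hU hU' hk hk0 h hLie
  · rintro ⟨g, K, R, hR, h⟩
    exact Huxley.nonclassical_of_canonicalPair hT hT'.nonempty hI hI' hU hU'.nonempty hk hk0 hR h
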